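/- Let $d\in\{1,2,3\}$, let $\alpha\ge 1$ be an integer, and let $X,X_1,X_2,\dots$ be independent, identically distributed $\mathbb{Z}^d$-valued random variables. Put $S_0=0$ and $S_n=X_1+\cdots+X_n$, let $l(n,x)=\sum_{j=1}^n \mathbf{1}(S_j=x)$ be the local time of the walk at $x\in\mathbb{Z}^d$, and let $L_n(\alpha)=\sum_{x\in\mathbb{Z}^d} l(n,x)^\alpha$ be its $\alpha$-fold self-intersection local time. Assume that the walk is genuinely $d$-dimensional, i.e. the support of $X_1-X_2$ spans $\mathbb{R}^d$ linearly. Define $v_{1,\alpha}(n)=n^{1+\alpha}$, $v_{2,\alpha}(n)=n^2(\log n)^{2\alpha-4}$ and $v_{3,\alpha}(n)=n\log n$. If $$\liminf_{n\to\infty}\frac{\operatorname{Var}(L_n(\alpha))}{v_{d,\alpha}(n)}>0,$$ then $\mathbb{E}|X|^2<\infty$ and $\mathbb{E}X=0$. -/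

import Mathlib

open MeasureTheory ProbabilityTheory Filter
open scoped ENNReal

namespace SelfIntersection

/-- The random walk `S_0 = 0`, `S_n = X_1 + ⋯ + X_n` in `ℤ^d`.
The increments are numbered from `0`: `X j` is the `(j+1)`-st jump. -/
def walk {Ω : Type*} {d : ℕ} (X : ℕ → Ω → (Fin d → ℤ)) (n : ℕ) (ω : Ω) : Fin d → ℤ :=
  ∑ j ∈ Finset.range n, X j ω

/-- The local time `l(n,x) = #{1 ≤ j ≤ n : S_j = x}`. -/
def localTime {Ω : Type*} {d : ℕ} (X : ℕ → Ω → (Fin d → ℤ)) (n : ℕ) (x : Fin d → ℤ) (ω : Ω) : ℕ :=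
  ∑ j ∈ Finset.Icc 1 n, if walk X j ω = x then 1 else 0

/-- The `α`-fold self-intersection local time `L_n(α) = ∑_{x ∈ ℤ^d} l(n,x)^α`
(for `α ≥ 1` only finitely many terms are nonzero). -/
noncomputable def selfIntersection {Ω : Type*} {d : ℕ} (X : ℕ → Ω → (Fin d → ℤ)) (α n : ℕ)
    (ω : Ω) : ℝ :=
  ∑' x : Fin d → ℤ, (localTime X n x ω : ℝ) ^ α

/-- The normalisation `v_{d,α}(n)`: the order of the variance of `L_n(α)` for the simple
random walk in `ℤ^d`. -/
noncomputable def order (d α n : ℕ) : ℝ :=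
  match d with
  | 1 => (n : ℝ) ^ (1 + α)
  | 2 => (n : ℝ) ^ 2 * Real.log n ^ (2 * (α : ℤ) - 4)
  | 3 => (n : ℝ) * Real.log n
  | _ => (n : ℝ)

/-- A lattice point as a vector of Euclidean space. -/
noncomputable def toEuclidean {d : ℕ} (x : Fin d → ℤ) : EuclideanSpace ℝ (Fin d) :=
  WithLp.toLp 2 (fun i => (x i : ℝ))

/-- The support of a `ℤ^d`-valued random variable: the points of positive probability. -/
def supp {Ω : Type*} [MeasurableSpace Ω] {d : ℕ} (P : Measure Ω) (Y : Ω → (Fin d → ℤ)) :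
    Set (Fin d → ℤ) :=
  {x | 0 < P {ω | Y ω = x}}

/-- The walk is genuinely `d`-dimensional: the support of `X_1 - X_2` linearly generates
`d`-dimensional space. -/
def GenuinelyDimensional {Ω : Type*} [MeasurableSpace Ω] {d : ℕ} (P : Measure Ω)
    (X : ℕ → Ω → (Fin d → ℤ)) : Prop :=
  Submodule.span ℝ (toEuclidean '' supp P (fun ω => X 0 ω - X 1 ω)) = ⊤

end SelfIntersection

/-! The contrapositive is proved: unless the steps are centred with a finite second moment, the
variance is o(v_{d,α}(n)), so the liminf is 0. For α = 1 the local time is deterministic; let α ≥ 2.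

Expanding the α-th power writes L_n(α) as the sum over α-tuples t of times of the indicator of A_t,
the event that the walk is at one site at all the times of t. The variance is the sum over pairs (i,
j) of P(A_i ∩ A_j) - P(A_i)P(A_j). If i starts before j and avoids the time interval spanned by j,
that interval has total increment zero on A_j and can be excised: P(A_i ∩ A_j) = P(A_i')P(A_j) with
i' = `cutOut i j` (`IIDSteps.measure_coincide_inter`). If moreover i resumes late enough after j,
then i ↦ i' is injective and i' still avoids j, so these joint probabilities are absorbed by the
subtracted products (`sum_sub_mul_le`). What remains are pairs that share a time, alternate at least
three times, or are nested with the inner tuple near the right end of its gap.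

For these, sort the 2α times. The 2α - 1 increments are independent and each is 0, z or -z, where z
is the displacement between the two sites. Let P(S_t = z) ≤ a_t and G = ∑_{t ≤ n} a_t. The identity
∑_z P(S_u = z)P(S_v = -z) = P(S_{u+v} = 0) leads to `IIDSteps.variance_le`: Var ≤ C n (G^{2α-1} +
G^{2α-4} W), where W, the `returnWeight`, is linear in the return probabilities P(S_t = 0).

Esseen's inequality allows a_t = C (t+1)^{-d/2}. Then the first term is o(v), and the second is o(v)
as soon as P(S_t = 0) = o(t^{-d/2}) (`exists_rates`). This holds
(`IIDSteps.eventually_hitProb_zero_le`) when the second moment is infinite, because the symmetrised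
exponent then dominates arbitrarily large quadratic forms near 0, and when the mean is nonzero,
because a return to 0 forces one half of the path to violate the law of large numbers. -/

namespace SelfIntersection

/-! ### Independence of increments and excision of a time interval -/

/-- Independent identically distributed `ℤ^d`-valued steps. -/
structure IIDSteps {Ω : Type*} [MeasurableSpace Ω] {d : ℕ} (P : Measure Ω)
    (X : ℕ → Ω → (Fin d → ℤ)) : Prop where
  measurable : ∀ i, Measurable (X i)
  indep : iIndepFun X P
  ident : ∀ i, IdentDistrib (X i) (X 0) P P

/-- The probability that the walk is at `z` at time `t`. -/
noncomputable def hitProb {Ω : Type*} [MeasurableSpace Ω] {d : ℕ} (P : Measure Ω)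
    (X : ℕ → Ω → (Fin d → ℤ)) (t : ℕ) (z : Fin d → ℤ) : ℝ≥0∞ :=
  P {ω | walk X t ω = z}

/-- The σ-algebra generated by the steps with index in `S`. -/
@[reducible]
def stepSigma {Ω : Type*} {d : ℕ} (X : ℕ → Ω → (Fin d → ℤ)) (S : Set ℕ) : MeasurableSpace Ω :=
  ⨆ i ∈ S, MeasurableSpace.comap (X i) inferInstance

/-- The event that the walk is at the same site at all the times `t r`. -/
def coincide {Ω ι : Type*} {d : ℕ} (X : ℕ → Ω → (Fin d → ℤ)) (t : ι → ℕ) : Set Ω :=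
  {ω | ∀ r r', walk X (t r) ω = walk X (t r') ω}

section Walk

variable {Ω : Type*} {d : ℕ} {X : ℕ → Ω → (Fin d → ℤ)}

lemma measurable_sum_stepSigma {S : Set ℕ} {F : Finset ℕ} (h : ∀ k ∈ F, k ∈ S) :
    Measurable[stepSigma X S] (fun ω => ∑ k ∈ F, X k ω) := by
  refine @Finset.measurable_sum _ _ _ _ _ _ (stepSigma X S) _ _ ?_
  intro k hk
  refine Measurable.mono (comap_measurable (X k)) ?_ le_rfl
  exact le_iSup₂_of_le k (h k hk) le_rfl

lemma walk_add_sum_Ico {s t : ℕ} (h : s ≤ t) (ω : Ω) :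
    walk X s ω + ∑ k ∈ Finset.Ico s t, X k ω = walk X t ω := by
  simp only [walk]
  exact Finset.sum_range_add_sum_Ico _ h

lemma sum_Ico_eq_walk_shift (s t : ℕ) (ω : Ω) :
    ∑ k ∈ Finset.Ico s t, X k ω = walk (fun k => X (s + k)) (t - s) ω := by
  simp only [walk]
  exact Finset.sum_Ico_eq_sum_range _ _ _

lemma measurableSet_coincide_stepSigma {ι : Type*} [Finite ι] {Y : ℕ → Ω → (Fin d → ℤ)}
    {S : Set ℕ} (t : ι → ℕ)
    (h : ∀ r, Measurable[stepSigma X S] (walk Y (t r))) :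
    MeasurableSet[stepSigma X S] (coincide Y t) := by
  have : coincide Y t = ⋂ r, ⋂ r', {ω | walk Y (t r) ω = walk Y (t r') ω} := by
    ext ω; simp [coincide]
  rw [this]
  refine MeasurableSet.iInter fun r => MeasurableSet.iInter fun r' => ?_
  exact measurableSet_eq_fun (h r) (h r')

end Walk

namespace IIDSteps

variable {Ω : Type*} [MeasurableSpace Ω] {d : ℕ} {P : Measure Ω}
  {X : ℕ → Ω → (Fin d → ℤ)}

lemma measurable_walk (h : IIDSteps P X) (t : ℕ) : Measurable (walk X t) :=
  Finset.measurable_sum _ fun i _ => h.measurable i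

lemma measurableSet_walk_eq (h : IIDSteps P X) (t : ℕ) (z : Fin d → ℤ) :
    MeasurableSet {ω | walk X t ω = z} :=
  h.measurable_walk t (measurableSet_singleton z)

lemma measurableSet_coincide (h : IIDSteps P X) {ι : Type*} [Finite ι] (t : ι → ℕ) :
    MeasurableSet (coincide X t) := by
  have : coincide X t = ⋂ r, ⋂ r', {ω | walk X (t r) ω = walk X (t r') ω} := by
    ext ω; simp [coincide]
  rw [this]
  exact MeasurableSet.iInter fun r => MeasurableSet.iInter fun r' =>
    measurableSet_eq_fun (h.measurable_walk _) (h.measurable_walk _)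

lemma comp (h : IIDSteps P X) {φ : ℕ → ℕ} (hφ : φ.Injective) :
    IIDSteps P (fun k => X (φ k)) where
  measurable _ := h.measurable _
  indep := h.indep.precomp hφ
  ident _ := (h.ident _).trans (h.ident _).symm

/-- Both laws are the product of copies of the law of one step. This lets a walk be run on any
selection of distinct steps, in particular on those left after an excision. -/
lemma map_comp (h : IIDSteps P X) {φ : ℕ → ℕ} (hφ : φ.Injective) :
    P.map (fun ω k => X (φ k) ω) = P.map (fun ω k => X k ω) := by
  rw [(h.comp hφ).indep.map_fun_eq_infinitePi_map (h.comp hφ).measurable,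
    h.indep.map_fun_eq_infinitePi_map h.measurable]
  congr 1
  ext1 k
  rw [(h.ident (φ k)).map_eq, (h.ident k).map_eq]

lemma measure_comp (h : IIDSteps P X) {φ : ℕ → ℕ} (hφ : φ.Injective)
    {B : Set (ℕ → Fin d → ℤ)} (hB : MeasurableSet B) :
    P {ω | (fun k => X (φ k) ω) ∈ B} = P {ω | (fun k => X k ω) ∈ B} := by
  have h1 : Measurable (fun ω k => X (φ k) ω) := measurable_pi_iff.2 fun k => h.measurable _
  have h2 : Measurable (fun ω k => X k ω) := measurable_pi_iff.2 fun k => h.measurable _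
  have := congrArg (fun μ => μ B) (h.map_comp hφ)
  simp only [Measure.map_apply h1 hB, Measure.map_apply h2 hB] at this
  exact this

lemma indep_stepSigma (h : IIDSteps P X) {S T : Set ℕ} (hST : Disjoint S T) :
    Indep (stepSigma X S) (stepSigma X T) P :=
  indep_iSup_of_disjoint (fun i => (h.measurable i).comap_le) h.indep hST

lemma measure_inter (h : IIDSteps P X) {S T : Set ℕ} (hST : Disjoint S T) {A B : Set Ω}
    (hA : MeasurableSet[stepSigma X S] A) (hB : MeasurableSet[stepSigma X T] B) :
    P (A ∩ B) = P A * P B :=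
  (Indep_iff _ _ _).1 (h.indep_stepSigma hST) A B hA hB

lemma hitProb_comp (h : IIDSteps P X) {φ : ℕ → ℕ} (hφ : φ.Injective) (t : ℕ)
    (z : Fin d → ℤ) : hitProb P (fun k => X (φ k)) t z = hitProb P X t z := by
  have hB : MeasurableSet {x : ℕ → Fin d → ℤ | ∑ k ∈ Finset.range t, x k = z} :=
    (Finset.measurable_sum (f := fun k (x : ℕ → Fin d → ℤ) => x k) (Finset.range t)
      fun i _ => measurable_pi_apply i) (measurableSet_singleton z)
  exact h.measure_comp hφ hB

lemma measure_sum_Ico_eq (h : IIDSteps P X) (s t : ℕ) (z : Fin d → ℤ) :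
    P {ω | ∑ k ∈ Finset.Ico s t, X k ω = z} = hitProb P X (t - s) z := by
  simp_rw [sum_Ico_eq_walk_shift]
  exact h.hitProb_comp (add_right_injective s) _ _

lemma measure_coincide_comp (h : IIDSteps P X) {φ : ℕ → ℕ} (hφ : φ.Injective)
    {ι : Type*} [Finite ι] (t : ι → ℕ) :
    P (coincide (fun k => X (φ k)) t) = P (coincide X t) := by
  have hB : MeasurableSet {x : ℕ → Fin d → ℤ | ∀ r r', ∑ k ∈ Finset.range (t r), x k
      = ∑ k ∈ Finset.range (t r'), x k} := by
    have hm : ∀ r, Measurable fun x : ℕ → Fin d → ℤ => ∑ k ∈ Finset.range (t r), x k :=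
      fun r => Finset.measurable_sum _ fun i _ => measurable_pi_apply i
    simp only [Set.ofPred_forall]
    exact MeasurableSet.iInter fun r => MeasurableSet.iInter fun r' =>
      measurableSet_eq_fun (hm r) (hm r')
  exact h.measure_comp hφ hB

/-- The increments of the walk along a nondecreasing sequence of times are independent. -/
lemma measure_forall_increment_eq [IsProbabilityMeasure P] (h : IIDSteps P X) {m : ℕ}
    (s : Fin (m + 1) → ℕ) (hs : Monotone s) (e : Fin m → Fin d → ℤ) :
    P {ω | ∀ i, ∑ k ∈ Finset.Ico (s i.castSucc) (s i.succ), X k ω = e i}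
      = ∏ i, hitProb P X (s i.succ - s i.castSucc) (e i) := by
  induction m with
  | zero => simp
  | succ m ih =>
    rw [Fin.prod_univ_castSucc]
    have ih' := ih (fun i => s i.castSucc) (fun i j hij => hs (by simpa using hij))
      (fun i => e i.castSucc)
    simp only [Fin.succ_castSucc] at *
    rw [← ih', ← h.measure_sum_Ico_eq]
    -- The earlier increments use steps before the last but one time, the last increment uses steps
    -- from it on.
    rw [← h.measure_inter (S := Set.Iio (s (Fin.last m).castSucc))
      (T := Set.Ici (s (Fin.last m).castSucc))]
    · congr 1
      ext ω
      simp only [Set.mem_inter_iff, Set.mem_ofPred_eq, Fin.forall_fin_succ' (n := m), Fin.succ_castSucc]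
    · exact Set.disjoint_left.2 fun x hx hx' => absurd (Set.mem_Iio.1 hx) (not_lt.2 (Set.mem_Ici.1 hx'))
    · rw [Set.ofPred_forall]
      refine MeasurableSet.iInter fun i => ?_
      refine measurable_sum_stepSigma ?_ (measurableSet_singleton _)
      intro k hk
      have := (Finset.mem_Ico.1 hk).2
      exact lt_of_lt_of_le this (hs (by simp [Fin.le_def]))
    · refine measurable_sum_stepSigma ?_ (measurableSet_singleton _)
      intro k hk
      exact (Finset.mem_Ico.1 hk).1

lemma hitProb_le_one [IsProbabilityMeasure P] (t : ℕ) (z : Fin d → ℤ) : hitProb P X t z ≤ 1 := prob_le_one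

lemma hitProb_add (h : IIDSteps P X) (u v : ℕ) (x : Fin d → ℤ) :
    hitProb P X (u + v) x = ∑' z, hitProb P X u z * hitProb P X v (x - z) := by
  have key : ∀ z, hitProb P X u z * hitProb P X v (x - z)
      = P ({ω | walk X u ω = z} ∩ {ω | walk X (u + v) ω = x}) := by
    intro z
    have h1 := h.measure_sum_Ico_eq u (u + v) (x - z)
    rw [Nat.add_sub_cancel_left] at h1
    rw [← h1, hitProb, ← h.measure_inter (S := Set.Iio u) (T := Set.Ici u)]
    · congr 1
      ext ω
      have := walk_add_sum_Ico (X := X) (Nat.le_add_right u v) ω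
      simp only [Set.mem_inter_iff, Set.mem_ofPred_eq]
      rw [← this]
      constructor
      · rintro ⟨rfl, h2⟩; exact ⟨rfl, by rw [h2]; abel⟩
      · rintro ⟨rfl, h2⟩; exact ⟨rfl, by rw [← h2]; abel⟩
    · exact Set.disjoint_left.2 fun x hx hx' => absurd (Set.mem_Iio.1 hx) (not_lt.2 (Set.mem_Ici.1 hx'))
    · exact measurable_sum_stepSigma (fun k hk => Finset.mem_range.1 hk)
        (measurableSet_singleton _)
    · exact measurable_sum_stepSigma (fun k hk => (Finset.mem_Ico.1 hk).1)
        (measurableSet_singleton _)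
  simp_rw [key]
  rw [← measure_iUnion]
  · simp only [hitProb]
    congr 1
    ext ω; simp
  · intro a b hab
    exact Set.disjoint_left.2 fun ω h1 h2 => hab (h1.1.symm.trans h2.1)
  · exact fun z => (h.measurableSet_walk_eq _ _).inter (h.measurableSet_walk_eq _ _)

/-- The Chapman–Kolmogorov identity at the origin; it converts every sum over the displacement of
two sites into a return probability. -/
lemma tsum_hitProb_mul_neg (h : IIDSteps P X) (u v : ℕ) :
    ∑' z, hitProb P X u z * hitProb P X v (-z) = hitProb P X (u + v) 0 := by
  simpa using (h.hitProb_add u v 0).symm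

/-- If the times `i` avoid the time interval `[a, b]` spanned by `j`, the self-intersections along
`i` and `j` decouple once the time interval is cut out. -/
lemma measure_coincide_inter (h : IIDSteps P X) {ι κ : Type*} [Finite ι] [Finite κ]
    {i : ι → ℕ} {j : κ → ℕ} {a b : ℕ}
    (hj : ∀ r, a ≤ j r ∧ j r ≤ b) (ha : ∃ r, j r = a) (hb : ∃ r, j r = b)
    (hi : ∀ r, i r < a ∨ b < i r) :
    P (coincide X i ∩ coincide X j)
      = P (coincide X fun r => if i r < a then i r else i r - (b - a)) * P (coincide X j) := by
  obtain ⟨ra, hra⟩ := ha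
  obtain ⟨rb, hrb⟩ := hb
  have hab : a ≤ b := hra ▸ (hj ra).2
  -- The relabelling that skips the steps in `[a, b)`; the walk driven by `X ∘ φ` is the excised
  -- walk.
  set φ : ℕ → ℕ := fun k => if k < a then k else k + (b - a) with hφ
  have hinj : φ.Injective := by
    intro k l hkl
    simp only [hφ] at hkl
    split_ifs at hkl <;> omega
  set i' : ι → ℕ := fun r => if i r < a then i r else i r - (b - a) with hi'
  have hmem : ∀ k, φ k ∈ (Set.Ico a b)ᶜ := by
    intro k
    simp only [hφ, Set.mem_compl_iff, Set.mem_Ico]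
    split_ifs <;> omega
  have hlow : ∀ n ≤ a, ∀ ω, walk (fun k => X (φ k)) n ω = walk X n ω := by
    intro n hn ω
    simp only [walk]
    refine Finset.sum_congr rfl fun k hk => ?_
    have : k < a := (Finset.mem_range.1 hk).trans_le hn
    simp [hφ, this]
  have hhigh : ∀ n, a ≤ n → ∀ ω, walk (fun k => X (φ k)) n ω
      + ∑ k ∈ Finset.Ico a b, X k ω = walk X (n + (b - a)) ω := by
    intro n hn ω
    rw [← walk_add_sum_Ico hn, hlow a le_rfl, add_assoc, add_comm (∑ k ∈ Finset.Ico a n, _),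
      ← add_assoc, walk_add_sum_Ico hab, ← walk_add_sum_Ico (s := b) (t := n + (b - a)) (by omega)]
    congr 1
    rw [Finset.sum_Ico_eq_sum_range, Finset.sum_Ico_eq_sum_range]
    have : n + (b - a) - b = n - a := by omega
    rw [this]
    refine Finset.sum_congr rfl fun k _ => ?_
    have : φ (a + k) = b + k := by simp [hφ]; omega
    rw [this]
  -- On `coincide X j` the steps in `[a, b)` sum to zero, so there the original walk at the times
  -- `i` agrees with the excised walk at the shifted times. The two events on the right depend on
  -- disjoint sets of steps.
  have hset : coincide X i ∩ coincide X j = coincide (fun k => X (φ k)) i' ∩ coincide X j := by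
    ext ω
    simp only [Set.mem_inter_iff]
    refine and_congr_left fun hωj => ?_
    have hz : ∑ k ∈ Finset.Ico a b, X k ω = 0 := by
      have h1 := hωj ra rb
      rw [hra, hrb, ← walk_add_sum_Ico hab] at h1
      simpa using h1
    have hw : ∀ r, walk (fun k => X (φ k)) (i' r) ω = walk X (i r) ω := by
      intro r
      by_cases hr : i r < a
      · simp only [hi', hr, if_true]
        exact hlow _ hr.le ω
      · have hbr : b < i r := (hi r).resolve_left hr
        simp only [hi', hr, if_false]
        have h1 := hhigh (i r - (b - a)) (by omega) ω
        rw [hz, add_zero] at h1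
        rw [h1]
        congr 1
        omega
    simp only [coincide, Set.mem_ofPred_eq, hw]
  rw [hset, h.measure_inter (S := (Set.Ico a b)ᶜ) (T := Set.Ico a b), h.measure_coincide_comp hinj]
  · exact disjoint_compl_left
  · refine measurableSet_coincide_stepSigma _ fun r => ?_
    have hm : ∀ k, Measurable[stepSigma X (Set.Ico a b)ᶜ] (X (φ k)) := fun k =>
      Measurable.mono (comap_measurable (X (φ k))) (le_iSup₂_of_le (φ k) (hmem k) le_rfl) le_rfl
    exact @Finset.measurable_sum _ _ _ _ _ _ (stepSigma X (Set.Ico a b)ᶜ) _ _ fun k _ => hm k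
  -- Only positions relative to time `a` matter, so this event is a function of the steps in `[a,
  -- b)`.
  · have : coincide X j = ⋂ r, ⋂ r', {ω | ∑ k ∈ Finset.Ico a (j r), X k ω
        = ∑ k ∈ Finset.Ico a (j r'), X k ω} := by
      ext ω
      simp only [coincide, Set.mem_ofPred_eq, Set.mem_iInter]
      refine forall_congr' fun r => forall_congr' fun r' => ?_
      rw [← walk_add_sum_Ico (hj r).1, ← walk_add_sum_Ico (hj r').1, add_right_inj]
    rw [this]
    refine MeasurableSet.iInter fun r => MeasurableSet.iInter fun r' => ?_
    have hm : ∀ r, Measurable[stepSigma X (Set.Ico a b)]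
        (fun ω => ∑ k ∈ Finset.Ico a (j r), X k ω) := fun r =>
      measurable_sum_stepSigma fun k hk => by
        have := Finset.mem_Ico.1 hk
        exact ⟨this.1, this.2.trans_le (hj r).2⟩
    exact measurableSet_eq_fun (hm r) (hm r')

end IIDSteps

end SelfIntersection

/-! ### Variance expansion and cancellation of decoupled pairs -/

namespace SelfIntersection

/-- The tuples of times in `{1, …, n}`. -/
def timeTuples (ι : Type*) [Fintype ι] [DecidableEq ι] (n : ℕ) : Finset (ι → ℕ) :=
  Fintype.piFinset fun _ => Finset.Icc 1 n

lemma mem_timeTuples {ι : Type*} [Fintype ι] [DecidableEq ι] {n : ℕ} {t : ι → ℕ} :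
    t ∈ timeTuples ι n ↔ ∀ r, 1 ≤ t r ∧ t r ≤ n := by
  simp [timeTuples]

/-- `i` starts before `j` and avoids the time interval spanned by `j`. -/
def StartsBeforeAvoiding {ι : Type*} (i j : ι → ℕ) : Prop :=
  (∃ r, i r < ⨅ r, j r) ∧ ∀ r, i r < (⨅ r, j r) ∨ (⨆ r, j r) < i r

/-- `i` starts before `j` and, after `j` has started, does not return before time
`2 max j - min j`. -/
def StartsBeforeFarFrom {ι : Type*} (i j : ι → ℕ) : Prop :=
  (∃ r, i r < ⨅ r, j r) ∧ ∀ r, i r < (⨅ r, j r) ∨ 2 * (⨆ r, j r) < i r + ⨅ r, j r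

/-- Cut out the time interval spanned by `j` from the time axis. -/
noncomputable def cutOut {ι : Type*} (i j : ι → ℕ) (r : ι) : ℕ :=
  if i r < ⨅ r, j r then i r else i r - ((⨆ r, j r) - ⨅ r, j r)

section Combinatorics

variable {ι : Type*}

lemma iInf_le_nat (j : ι → ℕ) (r : ι) : (⨅ r, j r) ≤ j r := ciInf_le (OrderBot.bddBelow _) r

lemma le_iSup_nat [Finite ι] (j : ι → ℕ) (r : ι) : j r ≤ ⨆ r, j r :=
  le_ciSup (Set.finite_range _).bddAbove r

lemma exists_eq_iInf_nat [Finite ι] [Nonempty ι] (j : ι → ℕ) : ∃ r, j r = ⨅ r, j r :=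
  exists_eq_ciInf_of_finite

lemma exists_eq_iSup_nat [Finite ι] [Nonempty ι] (j : ι → ℕ) : ∃ r, j r = ⨆ r, j r :=
  exists_eq_ciSup_of_finite

lemma iInf_le_iSup_nat [Finite ι] [Nonempty ι] (j : ι → ℕ) : (⨅ r, j r) ≤ ⨆ r, j r :=
  (iInf_le_nat j (Classical.arbitrary ι)).trans (le_iSup_nat j _)

lemma StartsBeforeFarFrom.avoiding [Finite ι] [Nonempty ι] {i j : ι → ℕ}
    (h : StartsBeforeFarFrom i j) : StartsBeforeAvoiding i j := by
  refine ⟨h.1, fun r => (h.2 r).imp_right fun hr => ?_⟩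
  have := iInf_le_iSup_nat j
  omega

lemma StartsBeforeAvoiding.iInf_lt [Finite ι] {i j : ι → ℕ}
    (h : StartsBeforeAvoiding i j) : (⨅ r, i r) < ⨅ r, j r := by
  obtain ⟨r, hr⟩ := h.1
  exact (iInf_le_nat i r).trans_lt hr

/-- This explains the threshold `2 max j - min j`: a later time, moved left by `max j - min j`,
still lies beyond `max j`. -/
lemma StartsBeforeFarFrom.cutOut_avoiding [Finite ι] [Nonempty ι] {i j : ι → ℕ}
    (h : StartsBeforeFarFrom i j) : StartsBeforeAvoiding (cutOut i j) j := by
  have hj := iInf_le_iSup_nat j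
  refine ⟨?_, fun r => ?_⟩
  · obtain ⟨r, hr⟩ := h.1
    exact ⟨r, by simp [cutOut, hr]⟩
  · rcases h.2 r with hr | hr
    · left; simp [cutOut, hr]
    · right
      have : ¬ i r < ⨅ r, j r := by omega
      simp only [cutOut, this, if_false]
      omega

lemma StartsBeforeFarFrom.cutOut_mem [Fintype ι] [DecidableEq ι] [Nonempty ι] {i j : ι → ℕ}
    {n : ℕ} (h : StartsBeforeFarFrom i j) (hi : i ∈ timeTuples ι n) (hj : j ∈ timeTuples ι n) :
    cutOut i j ∈ timeTuples ι n := by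
  rw [mem_timeTuples] at *
  intro r
  have h1 := iInf_le_iSup_nat j
  obtain ⟨r0, hr0⟩ := exists_eq_iInf_nat j
  have h2 := hj r0
  have h3 := hi r
  rcases h.2 r with hr | hr
  · simpa [cutOut, hr] using h3
  · have : ¬ i r < ⨅ r, j r := by omega
    simp only [cutOut, this, if_false]
    omega

/-- Unmoved times stay below `min j` and moved times stay above `max j`, so the image shows which
times were moved, and the shift depends on `j` only. -/
lemma StartsBeforeFarFrom.cutOut_injective [Finite ι] [Nonempty ι] {i i' j : ι → ℕ}
    (h : StartsBeforeFarFrom i j) (h' : StartsBeforeFarFrom i' j)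
    (heq : cutOut i j = cutOut i' j) : i = i' := by
  have hj := iInf_le_iSup_nat j
  ext r
  have := congrFun heq r
  simp only [cutOut] at this
  rcases h.2 r with hr | hr <;> rcases h'.2 r with hr' | hr' <;> split_ifs at this <;> omega

open scoped Classical in
/-- If cutting out decouples, the sum of the covariances is bounded by the sum of the joint
weights over the pairs that cannot be matched with a decoupled pair. -/
lemma sum_sub_mul_le [Fintype ι] [DecidableEq ι] [Nonempty ι] {n : ℕ}
    {q : (ι → ℕ) → ℝ} {Q : (ι → ℕ) → (ι → ℕ) → ℝ} (hq : ∀ i, 0 ≤ q i)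
    (hsymm : ∀ i j, Q i j = Q j i)
    (hQ : ∀ i j, StartsBeforeAvoiding i j → Q i j = q (cutOut i j) * q j) :
    ∑ p ∈ timeTuples ι n ×ˢ timeTuples ι n, (Q p.1 p.2 - q p.1 * q p.2)
      ≤ ∑ p ∈ (timeTuples ι n ×ˢ timeTuples ι n).filter
          (fun p => ¬ StartsBeforeFarFrom p.1 p.2 ∧ ¬ StartsBeforeFarFrom p.2 p.1),
          Q p.1 p.2 := by
  set T := timeTuples ι n ×ˢ timeTuples ι n with hT
  -- The map `(i, j) ↦ (cutOut i j, j)` injects the far pairs into the avoiding pairs and turns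
  -- joint weights into products.
  have key : ∑ p ∈ T.filter (fun p => StartsBeforeFarFrom p.1 p.2), Q p.1 p.2
      ≤ ∑ p ∈ T.filter (fun p => StartsBeforeAvoiding p.1 p.2), q p.1 * q p.2 := by
    calc ∑ p ∈ T.filter (fun p => StartsBeforeFarFrom p.1 p.2), Q p.1 p.2
        = ∑ p ∈ T.filter (fun p => StartsBeforeFarFrom p.1 p.2), q (cutOut p.1 p.2) * q p.2 :=
          Finset.sum_congr rfl fun p hp => hQ _ _ (Finset.mem_filter.1 hp).2.avoiding
      _ = ∑ p ∈ (T.filter (fun p => StartsBeforeFarFrom p.1 p.2)).image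
            (fun p => (cutOut p.1 p.2, p.2)), q p.1 * q p.2 := by
          rw [Finset.sum_image]
          rintro ⟨i, j⟩ hp ⟨i', j'⟩ hp' heq
          simp only [Prod.mk.injEq] at heq
          obtain ⟨h1, rfl⟩ := heq
          have := (Finset.mem_filter.1 hp).2.cutOut_injective (Finset.mem_filter.1 hp').2 h1
          exact Prod.ext this rfl
      _ ≤ _ := by
          refine Finset.sum_le_sum_of_subset_of_nonneg ?_ fun p _ _ => mul_nonneg (hq _) (hq _)
          intro p hp
          obtain ⟨⟨i, j⟩, hij, rfl⟩ := Finset.mem_image.1 hp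
          obtain ⟨h1, h2⟩ := Finset.mem_filter.1 hij
          obtain ⟨h3, h4⟩ := Finset.mem_product.1 h1
          exact Finset.mem_filter.2
            ⟨Finset.mem_product.2 ⟨h2.cutOut_mem h3 h4, h4⟩, h2.cutOut_avoiding⟩
  have swap : ∀ (f : (ι → ℕ) → (ι → ℕ) → ℝ) (R : (ι → ℕ) → (ι → ℕ) → Prop),
      ∑ p ∈ T.filter (fun p => R p.2 p.1), f p.1 p.2 = ∑ p ∈ T.filter (fun p => R p.1 p.2),
        f p.2 p.1 := by
    intro f R
    refine Finset.sum_bij' (fun p _ => p.swap) (fun p _ => p.swap) ?_ ?_ ?_ ?_ ?_ <;>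
      simp +contextual [hT]
  have key' : ∑ p ∈ T.filter (fun p => StartsBeforeFarFrom p.2 p.1), Q p.1 p.2
      ≤ ∑ p ∈ T.filter (fun p => StartsBeforeAvoiding p.2 p.1), q p.1 * q p.2 := by
    rw [swap Q StartsBeforeFarFrom, swap (fun i j => q i * q j) StartsBeforeAvoiding]
    simpa only [hsymm, mul_comm] using key
  have split : ∑ p ∈ T, Q p.1 p.2 ≤ ∑ p ∈ T.filter (fun p => StartsBeforeFarFrom p.1 p.2), Q p.1 p.2
      + ∑ p ∈ T.filter (fun p => StartsBeforeFarFrom p.2 p.1), Q p.1 p.2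
      + ∑ p ∈ T.filter (fun p => ¬ StartsBeforeFarFrom p.1 p.2 ∧ ¬ StartsBeforeFarFrom p.2 p.1),
          Q p.1 p.2 := by
    rw [Finset.sum_filter, Finset.sum_filter, Finset.sum_filter, ← Finset.sum_add_distrib,
      ← Finset.sum_add_distrib]
    refine le_of_eq (Finset.sum_congr rfl fun p _ => ?_)
    by_cases h1 : StartsBeforeFarFrom p.1 p.2
    · have h2 : ¬ StartsBeforeFarFrom p.2 p.1 := fun h2 =>
        lt_asymm h1.avoiding.iInf_lt h2.avoiding.iInf_lt
      simp [h1, h2]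
    · by_cases h2 : StartsBeforeFarFrom p.2 p.1 <;> simp [h1, h2]
  -- The products of both orientations fit disjointly into the full sum; the other products are
  -- nonnegative and are dropped.
  have lower : ∑ p ∈ T.filter (fun p => StartsBeforeAvoiding p.1 p.2), q p.1 * q p.2
      + ∑ p ∈ T.filter (fun p => StartsBeforeAvoiding p.2 p.1), q p.1 * q p.2
      ≤ ∑ p ∈ T, q p.1 * q p.2 := by
    rw [Finset.sum_filter, Finset.sum_filter, ← Finset.sum_add_distrib]
    refine Finset.sum_le_sum fun p _ => ?_
    have h0 := mul_nonneg (hq p.1) (hq p.2)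
    by_cases h1 : StartsBeforeAvoiding p.1 p.2
    · have h2 : ¬ StartsBeforeAvoiding p.2 p.1 := fun h2 => lt_asymm h1.iInf_lt h2.iInf_lt
      simp [h1, h2]
    · by_cases h2 : StartsBeforeAvoiding p.2 p.1 <;> simp [h1, h2, h0]
  rw [Finset.sum_sub_distrib]
  linarith

/-- The times `i` and `j` have a time in common. -/
def SharesTime (i j : ι → ℕ) : Prop := ∃ r s, i r = j s

/-- The times `i` and `j` alternate at least three times, `i` first. -/
def Interlaced {κ : Type*} (i : ι → ℕ) (j : κ → ℕ) : Prop :=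
  ∃ r₁ s₁ r₂ s₂, i r₁ < j s₁ ∧ j s₁ < i r₂ ∧ i r₂ < j s₂

/-- `j` sits in a gap of `i` and the distance from `j` to the right end of the gap is at most the
length of the time interval spanned by `j`. -/
def NestedNear (i j : ι → ℕ) : Prop :=
  (∃ r, i r < ⨅ r, j r) ∧ (∀ r, i r < (⨅ r, j r) ∨ (⨆ r, j r) < i r) ∧
    ∃ r, (⨆ r, j r) < i r ∧ i r + (⨅ r, j r) ≤ 2 * ⨆ r, j r

/-- If `i` visits the closed interval spanned by `j`, it does so either at an endpoint, which is a
tie, or strictly inside, which gives `min i < min j < i r < max j`. If it does not, only the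
distance condition can fail, and this is nesting near the right end. -/
lemma tie_or_interlaced_or_nestedNear_of_iInf_lt [Finite ι] [Nonempty ι] {i j : ι → ℕ}
    (hij : (⨅ r, i r) < ⨅ r, j r) (h : ¬ StartsBeforeFarFrom i j) :
    SharesTime i j ∨ Interlaced i j ∨ NestedNear i j := by
  obtain ⟨r0, hr0⟩ := exists_eq_iInf_nat i
  obtain ⟨s0, hs0⟩ := exists_eq_iInf_nat j
  obtain ⟨s1, hs1⟩ := exists_eq_iSup_nat j
  have hex : ∃ r, i r < ⨅ r, j r := ⟨r0, by omega⟩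
  by_cases h2 : ∃ r, (⨅ r, j r) ≤ i r ∧ i r ≤ ⨆ r, j r
  · obtain ⟨r, hr, hr'⟩ := h2
    by_cases h3 : i r = ⨅ r, j r
    · exact Or.inl ⟨r, s0, h3.trans hs0.symm⟩
    by_cases h4 : i r = ⨆ r, j r
    · exact Or.inl ⟨r, s1, h4.trans hs1.symm⟩
    exact Or.inr (Or.inl ⟨r0, s0, r, s1, by omega, by omega, by omega⟩)
  · push Not at h2
    right; right
    have hall : ∀ r, i r < (⨅ r, j r) ∨ (⨆ r, j r) < i r := fun r =>
      (lt_or_ge (i r) (⨅ r, j r)).imp_right fun hr => h2 r hr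
    refine ⟨hex, hall, ?_⟩
    by_contra hcon
    push Not at hcon
    exact h ⟨hex, fun r => (hall r).imp_right fun hr => hcon r hr⟩

lemma tie_or_interlaced_or_nestedNear [Finite ι] [Nonempty ι] {i j : ι → ℕ}
    (h : ¬ StartsBeforeFarFrom i j) (h' : ¬ StartsBeforeFarFrom j i) :
    SharesTime i j ∨ Interlaced i j ∨ Interlaced j i ∨ NestedNear i j ∨ NestedNear j i := by
  rcases lt_trichotomy (⨅ r, i r) (⨅ r, j r) with hlt | heq | hlt
  · rcases tie_or_interlaced_or_nestedNear_of_iInf_lt hlt h with h1 | h1 | h1 <;> simp [h1]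
  · obtain ⟨r0, hr0⟩ := exists_eq_iInf_nat i
    obtain ⟨s0, hs0⟩ := exists_eq_iInf_nat j
    exact Or.inl ⟨r0, s0, by omega⟩
  · rcases tie_or_interlaced_or_nestedNear_of_iInf_lt hlt h' with ⟨r, s, h1⟩ | h1 | h1
    · exact Or.inl ⟨s, r, h1.symm⟩
    · simp [h1]
    · simp [h1]

end Combinatorics

section Expansion

variable {Ω : Type*} {d : ℕ} {X : ℕ → Ω → (Fin d → ℤ)}

open scoped Classical in
-- The power of a sum over times is a sum over tuples, and a tuple contributes at no site other than
-- the position at any one of its times. As `α ≥ 1` there is such a time, so the sum over sites has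
-- one candidate term.
lemma selfIntersection_eq_sum {α : ℕ} (hα : 1 ≤ α) (n : ℕ) (ω : Ω) :
    selfIntersection X α n ω
      = ∑ t ∈ timeTuples (Fin α) n, (coincide X t).indicator (fun _ => (1 : ℝ)) ω := by
  have hpow : ∀ x, (localTime X n x ω : ℝ) ^ α
      = ∑ t ∈ timeTuples (Fin α) n, ∏ r, if walk X (t r) ω = x then (1 : ℝ) else 0 := by
    intro x
    simp only [localTime, Nat.cast_sum, Nat.cast_ite, Nat.cast_one, Nat.cast_zero, timeTuples]
    rw [← Finset.prod_univ_sum (fun _ : Fin α => Finset.Icc 1 n)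
      (fun _ j => if walk X j ω = x then (1 : ℝ) else 0)]
    simp
  let r0 : Fin α := ⟨0, hα⟩
  have hsupp : ∀ t : Fin α → ℕ, ∀ x, x ≠ walk X (t r0) ω →
      ∏ r, (if walk X (t r) ω = x then (1 : ℝ) else 0) = 0 := by
    intro t x hx
    exact Finset.prod_eq_zero (Finset.mem_univ r0) (by simp [Ne.symm hx])
  simp only [selfIntersection, hpow]
  rw [Summable.tsum_finsetSum fun t _ => summable_of_ne_finset_zero
    (s := {walk X (t r0) ω}) fun x hx => hsupp t x (by simpa using hx)]
  refine Finset.sum_congr rfl fun t _ => ?_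
  rw [tsum_eq_single (walk X (t r0) ω) (hsupp t)]
  by_cases h : ω ∈ coincide X t
  · rw [Set.indicator_of_mem h]
    exact Finset.prod_eq_one fun r _ => by rw [if_pos (h r r0)]
  · rw [Set.indicator_of_notMem h]
    have : ∃ r, walk X (t r) ω ≠ walk X (t r0) ω := by
      by_contra hcon
      push Not at hcon
      exact h fun r r' => (hcon r).trans (hcon r').symm
    obtain ⟨r, hr⟩ := this
    exact Finset.prod_eq_zero (Finset.mem_univ r) (by simp [hr])

variable [MeasurableSpace Ω] {P : Measure Ω} [IsProbabilityMeasure P]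

lemma variance_sum_indicator {κ : Type*} (T : Finset κ) {A : κ → Set Ω}
    (hA : ∀ i, MeasurableSet (A i)) :
    variance (fun ω => ∑ t ∈ T, (A t).indicator (fun _ => (1 : ℝ)) ω) P
      = ∑ p ∈ T ×ˢ T, (P.real (A p.1 ∩ A p.2) - P.real (A p.1) * P.real (A p.2)) := by
  have hint : ∀ B, MeasurableSet B → Integrable (B.indicator fun _ => (1 : ℝ)) P :=
    fun B hB => (integrable_const 1).indicator hB
  have hval : ∀ B, MeasurableSet B → ∫ ω, B.indicator (fun _ => (1 : ℝ)) ω ∂P = P.real B :=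
    fun B hB => by simp [integral_indicator_const, hB]
  have hmem : MemLp (fun ω => ∑ t ∈ T, (A t).indicator (fun _ => (1 : ℝ)) ω) 2 P :=
    memLp_finsetSum _ fun t _ => (memLp_const 1).indicator (hA t)
  rw [variance_eq_sub hmem]
  have h1 : ∀ ω, ((fun ω => ∑ t ∈ T, (A t).indicator (fun _ => (1 : ℝ)) ω) ^ 2) ω
      = ∑ p ∈ T ×ˢ T, (A p.1 ∩ A p.2).indicator (fun _ => (1 : ℝ)) ω := by
    intro ω
    simp only [Pi.pow_apply, sq, Finset.sum_mul_sum, Finset.sum_product]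
    refine Finset.sum_congr rfl fun i _ => Finset.sum_congr rfl fun j _ => ?_
    by_cases hi : ω ∈ A i <;> by_cases hj : ω ∈ A j <;> simp [hi, hj]
  simp_rw [h1]
  rw [integral_finsetSum _ fun p _ => hint _ ((hA _).inter (hA _)),
    integral_finsetSum _ fun p _ => hint _ (hA _), Finset.sum_sub_distrib]
  congr 1
  · exact Finset.sum_congr rfl fun p _ => hval _ ((hA _).inter (hA _))
  · rw [sq, Finset.sum_mul_sum, Finset.sum_product]
    exact Finset.sum_congr rfl fun i _ => Finset.sum_congr rfl fun j _ => by
      rw [hval _ (hA _), hval _ (hA _)]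

open scoped Classical in
lemma IIDSteps.variance_selfIntersection_le (h : IIDSteps P X) {α : ℕ} (hα : 1 ≤ α) (n : ℕ) :
    ENNReal.ofReal (variance (selfIntersection X α n) P)
      ≤ ∑ p ∈ (timeTuples (Fin α) n ×ˢ timeTuples (Fin α) n).filter
          (fun p => ¬ StartsBeforeFarFrom p.1 p.2 ∧ ¬ StartsBeforeFarFrom p.2 p.1),
          P (coincide X p.1 ∩ coincide X p.2) := by
  have : Nonempty (Fin α) := ⟨⟨0, hα⟩⟩
  have h0 : selfIntersection X α n
      = fun ω => ∑ t ∈ timeTuples (Fin α) n, (coincide X t).indicator (fun _ => (1 : ℝ)) ω :=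
    funext fun ω => selfIntersection_eq_sum hα n ω
  rw [h0, variance_sum_indicator _ fun t => h.measurableSet_coincide t]
  have hle := sum_sub_mul_le (n := n) (q := fun i : Fin α → ℕ => P.real (coincide X i))
    (Q := fun i j => P.real (coincide X i ∩ coincide X j)) (fun i => measureReal_nonneg)
    (fun i j => by rw [Set.inter_comm]) (fun i j hij => by
      have := h.measure_coincide_inter (i := i) (j := j)
        (fun r => ⟨iInf_le_nat j r, le_iSup_nat j r⟩) (exists_eq_iInf_nat j)
        (exists_eq_iSup_nat j) hij.2
      simp only [measureReal_def, this, ENNReal.toReal_mul]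
      rfl)
  refine (ENNReal.ofReal_le_ofReal hle).trans ?_
  rw [ENNReal.ofReal_sum_of_nonneg fun p _ => measureReal_nonneg]
  exact Finset.sum_le_sum fun p _ => by
    rw [measureReal_def, ENNReal.ofReal_toReal (measure_ne_top _ _)]

end Expansion

end SelfIntersection

/-! ### Sorted times and Green function bounds for the remaining pairs -/

namespace SelfIntersection

section Sorting

lemma exists_monotone_comp {ι : Type*} {N : ℕ} (e : Fin N ≃ ι) (t : ι → ℕ) :
    ∃ σ : Fin N ≃ ι, Monotone (t ∘ σ) :=
  ⟨(Tuple.sort (t ∘ e)).trans e, Tuple.monotone_sort (t ∘ e)⟩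

open scoped Classical in
/-- Sum over tuples of times by sorting them. -/
lemma sum_timeTuples_le_sum_monotone {ι : Type*} [Fintype ι] [DecidableEq ι] {N : ℕ}
    (e : Fin N ≃ ι) (n : ℕ) (f : (ι → ℕ) → ℝ≥0∞) :
    ∑ t ∈ timeTuples ι n, f t
      ≤ ∑ σ : Fin N ≃ ι, ∑ s ∈ (timeTuples (Fin N) n).filter Monotone, f (s ∘ σ.symm) := by
  -- Tuples with repeated times are sorted by several `σ`, hence only an upper bound.
  calc ∑ t ∈ timeTuples ι n, f t
      ≤ ∑ t ∈ timeTuples ι n, ∑ σ : Fin N ≃ ι, if Monotone (t ∘ σ) then f t else 0 := by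
        refine Finset.sum_le_sum fun t _ => ?_
        obtain ⟨σ, hσ⟩ := exists_monotone_comp e t
        calc f t = if Monotone (t ∘ σ) then f t else 0 := by rw [if_pos hσ]
          _ ≤ _ := Finset.single_le_sum
            (f := fun σ : Fin N ≃ ι => if Monotone (t ∘ σ) then f t else 0)
            (fun _ _ => zero_le) (Finset.mem_univ σ)
    _ = ∑ σ : Fin N ≃ ι, ∑ s ∈ (timeTuples (Fin N) n).filter Monotone, f (s ∘ σ.symm) := by
        rw [Finset.sum_comm]
        refine Finset.sum_congr rfl fun σ _ => ?_
        rw [← Finset.sum_filter]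
        refine Finset.sum_bij' (fun t _ => t ∘ σ) (fun s _ => s ∘ σ.symm) ?_ ?_ ?_ ?_ ?_
        · intro t ht
          simp only [Finset.mem_filter, mem_timeTuples] at ht ⊢
          exact ⟨fun r => ht.1 _, ht.2⟩
        · intro s hs
          simp only [Finset.mem_filter, mem_timeTuples] at hs ⊢
          refine ⟨fun r => hs.1 _, ?_⟩
          simpa [Function.comp_assoc] using hs.2
        all_goals
          intro t ht
          simp [Function.comp_assoc]

lemma exists_switch_nat {W : ℕ → Bool} {c : Bool} {a b : ℕ} (hab : a < b) (ha : W a = c)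
    (hb : W b = !c) : ∃ k, a ≤ k ∧ k < b ∧ W k = c ∧ W (k + 1) = !c := by
  induction b, hab using Nat.le_induction with
  | base => exact ⟨a, le_rfl, Nat.lt_succ_self a, ha, hb⟩
  | succ b hab ih =>
    by_cases h : W b = c
    · exact ⟨b, (Nat.lt_of_succ_le hab).le, Nat.lt_succ_self b, h, hb⟩
    · obtain ⟨k, h1, h2, h3⟩ := ih (by cases c <;> simpa using h)
      exact ⟨k, h1, h2.trans (Nat.lt_succ_self b), h3⟩

lemma exists_switch {m : ℕ} {w : Fin (m + 1) → Bool} {c : Bool} {a b : Fin (m + 1)} (hab : a < b)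
    (ha : w a = c) (hb : w b = !c) :
    ∃ k : Fin m, a ≤ k.castSucc ∧ k.succ ≤ b ∧ w k.castSucc = c ∧ w k.succ = !c := by
  obtain ⟨k, h1, h2, h3, h4⟩ := exists_switch_nat
    (W := fun k => if h : k < m + 1 then w ⟨k, h⟩ else c) (c := c) (a := a) (b := b) hab
    (by simp [ha]) (by simp [hb, Nat.lt_succ_iff.1 b.2])
  have hk : k < m := by omega
  have hk1 : k < m + 1 := by omega
  simp only [hk1, dif_pos] at h3
  simp only [Nat.add_lt_add_iff_right, hk, dif_pos] at h4
  exact ⟨⟨k, hk⟩, h1, by simpa [Fin.le_def] using h2, h3, h4⟩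

/-- Some increment is at least the average. -/
lemma exists_large_increment {m : ℕ} {s : Fin (m + 1) → ℕ} {a b : Fin (m + 1)} (hab : a < b) :
    ∃ l : Fin m, a ≤ l.castSucc ∧ l.succ ≤ b ∧ s b - s a ≤ m * (s l.succ - s l.castSucc) := by
  by_contra! hcon
  set V := s b - s a
  -- If every increment were below the average, each would be at most `(V - 1) / m`, and at most `m`
  -- of them would add up to `V - 1`.
  have hstep : ∀ l : Fin m, a ≤ l.castSucc → l.succ ≤ b →
      s l.succ ≤ s l.castSucc + (V - 1) / m := by
    intro l h1 h2
    have h3 := hcon l h1 h2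
    have hm : 0 < m := l.pos
    have : s l.succ - s l.castSucc ≤ (V - 1) / m := by
      rw [Nat.le_div_iff_mul_le hm, mul_comm]
      omega
    omega
  have hind : ∀ k : ℕ, (a : ℕ) ≤ k → ∀ hk : k < m + 1, k ≤ b →
      s ⟨k, hk⟩ ≤ s a + (k - a) * ((V - 1) / m) := by
    intro k hak
    induction k, hak using Nat.le_induction with
    | base => intro hk _; simp
    | succ k hak ih =>
      intro hk hkb
      have h1 := ih (by omega) (by omega)
      have h2 := hstep ⟨k, by omega⟩ (by simpa [Fin.le_def] using hak)
        (by simpa [Fin.le_def] using hkb)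
      simp only [Fin.succ_mk, Fin.castSucc_mk] at h2
      have : k + 1 - (a : ℕ) = k - a + 1 := by omega
      rw [this, add_mul, one_mul]
      omega
  have hfin := hind b hab.le b.2 le_rfl
  simp only [Fin.eta] at hfin
  have hbm : ((b : ℕ) - a) * ((V - 1) / m) ≤ V - 1 := by
    calc ((b : ℕ) - a) * ((V - 1) / m) ≤ m * ((V - 1) / m) :=
          Nat.mul_le_mul_right _ (by have := b.2; omega)
      _ ≤ V - 1 := Nat.mul_div_le _ _
  -- For `V = 0` the summed bound is harmless; then any index between `a` and `b` contradicts
  -- `hcon`, and this provides one.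
  obtain ⟨l, h1, h2, -⟩ := exists_switch (w := fun k => decide (k ≤ a)) (c := true) hab
    (by simp) (by simpa using hab)
  have := hcon l h1 h2
  omega

end Sorting

section Word

variable {Ω : Type*} {d : ℕ} {X : ℕ → Ω → (Fin d → ℤ)} {α m : ℕ}

/-- The event that the successive increments along the times `s` are `e`. -/
def incrementsEq (X : ℕ → Ω → (Fin d → ℤ)) (s : Fin (m + 1) → ℕ)
    (e : Fin m → Fin d → ℤ) : Set Ω :=
  {ω | ∀ i, ∑ k ∈ Finset.Ico (s i.castSucc) (s i.succ), X k ω = e i}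

/-- The increments forced on a walk that is at `0` when the word reads `true` and at `z` when it
reads `false`. -/
def wordIncrement (w : Fin (m + 1) → Bool) (z : Fin d → ℤ) (k : Fin m) : Fin d → ℤ :=
  if w k.castSucc = w k.succ then 0 else if w k.castSucc then z else -z

/-- The parameter `z` is the displacement from the common site of the first tuple to that of the
second; the sorted word of tuple labels then dictates every increment. -/
lemma coincide_inter_subset (σ : Fin (m + 1) ≃ Fin α ⊕ Fin α) {s : Fin (m + 1) → ℕ}
    (hs : Monotone s) (hα : 1 ≤ α) :
    coincide X (s ∘ σ.symm ∘ Sum.inl) ∩ coincide X (s ∘ σ.symm ∘ Sum.inr)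
      ⊆ ⋃ z, incrementsEq X s (wordIncrement (fun k => (σ k).isLeft) z) := by
  rintro ω ⟨hi, hj⟩
  let r0 : Fin α := ⟨0, hα⟩
  let x := walk X (s (σ.symm (Sum.inl r0))) ω
  let y := walk X (s (σ.symm (Sum.inr r0))) ω
  have hx : ∀ k, (σ k).isLeft = true → walk X (s k) ω = x := by
    intro k hk
    obtain ⟨r, hr⟩ := Sum.isLeft_iff.1 hk
    have := hi r r0
    simp only [Function.comp_apply] at this
    rwa [← hr, Equiv.symm_apply_apply] at this
  have hy : ∀ k, (σ k).isLeft = false → walk X (s k) ω = y := by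
    intro k hk
    obtain ⟨r, hr⟩ := Sum.isRight_iff.1 (by simpa using hk)
    have := hj r r0
    simp only [Function.comp_apply] at this
    rwa [← hr, Equiv.symm_apply_apply] at this
  refine Set.mem_iUnion.2 ⟨y - x, fun k => ?_⟩
  have hinc := walk_add_sum_Ico (X := X) (hs k.castSucc_lt_succ.le) ω
  have hinc' := eq_sub_of_add_eq' hinc
  rw [hinc', wordIncrement]
  cases h1 : (σ k.castSucc).isLeft <;> cases h2 : (σ k.succ).isLeft
  · rw [hy _ h1, hy _ h2]; simp
  · rw [hy _ h1, hx _ h2]; simp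
  · rw [hx _ h1, hy _ h2]; simp
  · rw [hx _ h1, hx _ h2]; simp

/-- A shared time identifies the two sites, so `z = 0` and no sum over displacements is needed. -/
lemma coincide_inter_subset_of_tie (σ : Fin (m + 1) ≃ Fin α ⊕ Fin α) {s : Fin (m + 1) → ℕ}
    (hs : Monotone s) (htie : SharesTime (s ∘ σ.symm ∘ Sum.inl) (s ∘ σ.symm ∘ Sum.inr)) :
    coincide X (s ∘ σ.symm ∘ Sum.inl) ∩ coincide X (s ∘ σ.symm ∘ Sum.inr)
      ⊆ incrementsEq X s 0 := by
  rintro ω ⟨hi, hj⟩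
  obtain ⟨r, r', hrr⟩ := htie
  simp only [Function.comp_apply] at hrr
  have hx : ∀ k, walk X (s k) ω = walk X (s (σ.symm (Sum.inl r))) ω := by
    intro k
    rcases hk : σ k with l | l
    · have := hi l r
      simp only [Function.comp_apply] at this
      rwa [← hk, Equiv.symm_apply_apply] at this
    · have := hj l r'
      simp only [Function.comp_apply] at this
      rw [← hk, Equiv.symm_apply_apply] at this
      rw [this, hrr]
  intro k
  have hinc := walk_add_sum_Ico (X := X) (hs k.castSucc_lt_succ.le) ω
  rw [hx k.castSucc, hx k.succ] at hinc
  simpa using hinc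

end Word

section Chain

variable {Ω : Type*} [MeasurableSpace Ω] {d : ℕ} (P : Measure Ω) (X : ℕ → Ω → (Fin d → ℤ))

/-- The expected number of times `t ∈ D` at which the walk is at `z`. -/
noncomputable def green (D : Finset ℕ) (z : Fin d → ℤ) : ℝ≥0∞ := ∑ t ∈ D, hitProb P X t z

variable {P X}

lemma green_mono {D D' : Finset ℕ} (h : D ⊆ D') (z : Fin d → ℤ) :
    green P X D z ≤ green P X D' z := Finset.sum_le_sum_of_subset h

lemma green_le {a : ℕ → ℝ≥0∞} (ha : ∀ t z, hitProb P X t z ≤ a t) (D : Finset ℕ)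
    (z : Fin d → ℤ) : green P X D z ≤ ∑ t ∈ D, a t :=
  Finset.sum_le_sum fun t _ => ha t z

variable [IsProbabilityMeasure P]

open scoped Classical in
-- A monotone tuple is determined by its first time and its gaps. Letting these range freely costs a
-- factor `n` for the first time and makes the sum over the gaps factorise.
lemma IIDSteps.sum_measure_incrementsEq_le (h : IIDSteps P X) {m n : ℕ} (D : Fin m → Finset ℕ)
    (e : Fin m → Fin d → ℤ) :
    ∑ s ∈ (timeTuples (Fin (m + 1)) n).filter
        (fun s => Monotone s ∧ ∀ k : Fin m, s k.succ - s k.castSucc ∈ D k),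
      P (incrementsEq X s e) ≤ n * ∏ k, green P X (D k) (e k) := by
  set M := (timeTuples (Fin (m + 1)) n).filter
    (fun s => Monotone s ∧ ∀ k : Fin m, s k.succ - s k.castSucc ∈ D k) with hM
  have hval : ∀ s ∈ M, P (incrementsEq X s e)
      = ∏ k, hitProb P X (s k.succ - s k.castSucc) (e k) := fun s hs =>
    h.measure_forall_increment_eq s (Finset.mem_filter.1 hs).2.1 e
  rw [Finset.sum_congr rfl hval]
  let g : (Fin (m + 1) → ℕ) → ℕ × (Fin m → ℕ) := fun s => (s 0, fun k => s k.succ - s k.castSucc)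
  have hinj : Set.InjOn g M := by
    intro s hs s' hs' heq
    have hs1 : Monotone s := (Finset.mem_filter.1 hs).2.1
    have hs2 : Monotone s' := (Finset.mem_filter.1 hs').2.1
    simp only [g, Prod.mk.injEq] at heq
    ext k
    induction k using Fin.induction with
    | zero => exact heq.1
    | succ k ih =>
      have h1 := congrFun heq.2 k
      have h2 := hs1 k.castSucc_lt_succ.le
      have h3 := hs2 k.castSucc_lt_succ.le
      omega
  calc ∑ s ∈ M, ∏ k, hitProb P X (s k.succ - s k.castSucc) (e k)
      = ∑ p ∈ M.image g, ∏ k, hitProb P X (p.2 k) (e k) := by rw [Finset.sum_image hinj]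
    _ ≤ ∑ p ∈ Finset.Icc 1 n ×ˢ Fintype.piFinset D, ∏ k, hitProb P X (p.2 k) (e k) := by
        refine Finset.sum_le_sum_of_subset ?_
        intro p hp
        obtain ⟨s, hs, rfl⟩ := Finset.mem_image.1 hp
        obtain ⟨h1, -, h3⟩ := Finset.mem_filter.1 hs
        rw [mem_timeTuples] at h1
        simp only [g, Finset.mem_product, Finset.mem_Icc, Fintype.mem_piFinset]
        exact ⟨h1 0, h3⟩
    _ = n * ∏ k, green P X (D k) (e k) := by
        rw [Finset.sum_product]
        simp only [Finset.sum_const, Nat.card_Icc, nsmul_eq_mul, green]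
        rw [Finset.prod_univ_sum]
        simp

open scoped Classical in
lemma IIDSteps.sum_monotone_measure_incrementsEq_le (h : IIDSteps P X) {m n : ℕ}
    (e : Fin m → Fin d → ℤ) :
    ∑ s ∈ (timeTuples (Fin (m + 1)) n).filter Monotone, P (incrementsEq X s e)
      ≤ n * ∏ k, green P X (Finset.range (n + 1)) (e k) := by
  refine le_trans (Finset.sum_le_sum_of_subset ?_)
    (h.sum_measure_incrementsEq_le (fun _ => Finset.range (n + 1)) e)
  intro s hs
  obtain ⟨h1, h2⟩ := Finset.mem_filter.1 hs
  refine Finset.mem_filter.2 ⟨h1, h2, fun k => ?_⟩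
  rw [mem_timeTuples] at h1
  have := (h1 k.succ).2
  simp only [Finset.mem_range]
  omega

lemma prod_le_mul_pow {m : ℕ} (f : Fin m → ℝ≥0∞) {G : ℝ≥0∞} (hf : ∀ k, f k ≤ G)
    {p q r : Fin m} (hpq : p ≠ q) (hpr : p ≠ r) (hqr : q ≠ r) :
    ∏ k, f k ≤ f p * f q * f r * G ^ (m - 3) := by
  rw [← Finset.mul_prod_erase _ _ (Finset.mem_univ p),
    ← Finset.mul_prod_erase (Finset.univ.erase p) _ (a := q) (by simp [hpq.symm]),
    ← Finset.mul_prod_erase ((Finset.univ.erase p).erase q) _ (a := r)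
      (by simp [hpr.symm, hqr.symm]), ← mul_assoc, ← mul_assoc]
  gcongr
  refine (Finset.prod_le_pow_card _ _ _ fun k _ => hf k).trans (le_of_eq ?_)
  rw [Finset.card_erase_of_mem (by simp [hpr.symm, hqr.symm]),
    Finset.card_erase_of_mem (by simp [hpq.symm]), Finset.card_erase_of_mem (by simp)]
  simp [Nat.sub_sub]

variable {α m : ℕ} {a : ℕ → ℝ≥0∞}

open scoped Classical in
lemma IIDSteps.sum_tie_le (h : IIDSteps P X) (ha : ∀ t z, hitProb P X t z ≤ a t) (n : ℕ)
    (σ : Fin (m + 1) ≃ Fin α ⊕ Fin α) :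
    ∑ s ∈ (timeTuples (Fin (m + 1)) n).filter Monotone,
      (if SharesTime (s ∘ σ.symm ∘ Sum.inl) (s ∘ σ.symm ∘ Sum.inr) then
        P (coincide X (s ∘ σ.symm ∘ Sum.inl) ∩ coincide X (s ∘ σ.symm ∘ Sum.inr)) else 0)
      ≤ n * (∑ t ∈ Finset.range (n + 1), a t) ^ m := by
  calc _ ≤ ∑ s ∈ (timeTuples (Fin (m + 1)) n).filter Monotone, P (incrementsEq X s 0) := by
        refine Finset.sum_le_sum fun s hs => ?_
        split_ifs with htie
        · exact measure_mono (coincide_inter_subset_of_tie σ (Finset.mem_filter.1 hs).2 htie)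
        · exact zero_le
    _ ≤ n * ∏ k : Fin m, green P X (Finset.range (n + 1)) 0 :=
        h.sum_monotone_measure_incrementsEq_le _
    _ ≤ n * (∑ t ∈ Finset.range (n + 1), a t) ^ m := by
        gcongr
        simpa using pow_le_pow_left₀ zero_le (green_le ha (Finset.range (n + 1)) 0) m

open scoped Classical in
-- Three alternations force gaps with increments `z`, `-z`, `z`; these keep their Green functions,
-- and the other `m - 3` gaps are bounded uniformly in the increment.
lemma IIDSteps.sum_interlaced_le (h : IIDSteps P X) (ha : ∀ t z, hitProb P X t z ≤ a t) (n : ℕ)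
    (hα : 1 ≤ α) (σ : Fin (m + 1) ≃ Fin α ⊕ Fin α) :
    ∑ s ∈ (timeTuples (Fin (m + 1)) n).filter Monotone,
      (if Interlaced (s ∘ σ.symm ∘ Sum.inl) (s ∘ σ.symm ∘ Sum.inr) then
        P (coincide X (s ∘ σ.symm ∘ Sum.inl) ∩ coincide X (s ∘ σ.symm ∘ Sum.inr)) else 0)
      ≤ n * (∑ t ∈ Finset.range (n + 1), a t) ^ (m - 3)
        * ∑' z, green P X (Finset.range (n + 1)) z * green P X (Finset.range (n + 1)) (-z)
          * green P X (Finset.range (n + 1)) z := by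
  set w : Fin (m + 1) → Bool := fun k => (σ k).isLeft with hw
  set D := Finset.range (n + 1)
  -- The pattern of labels depends on `σ` only, so a single interlaced `s` locates the three
  -- switches for all `s`; without one the sum vanishes.
  by_cases hex : ∃ s : Fin (m + 1) → ℕ, Monotone s ∧
      Interlaced (s ∘ σ.symm ∘ Sum.inl) (s ∘ σ.symm ∘ Sum.inr)
  · obtain ⟨s, hs, r₁, s₁, r₂, s₂, h1, h2, h3⟩ := hex
    simp only [Function.comp_apply] at h1 h2 h3
    obtain ⟨p, hp1, hp2, hp3, hp4⟩ := exists_switch (w := w) (c := true)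
      (hs.reflect_lt h1) (by simp [hw]) (by simp [hw])
    obtain ⟨q, hq1, hq2, hq3, hq4⟩ := exists_switch (w := w) (c := false)
      (hs.reflect_lt h2) (by simp [hw]) (by simp [hw])
    obtain ⟨r, hr1, hr2, hr3, hr4⟩ := exists_switch (w := w) (c := true)
      (hs.reflect_lt h3) (by simp [hw]) (by simp [hw])
    have hpq : p < q := by
      have := hp2.trans hq1
      rw [Fin.le_def, Fin.val_succ, Fin.val_castSucc] at this
      exact Fin.lt_def.2 this
    have hqr : q < r := by
      have := hq2.trans hr1
      rw [Fin.le_def, Fin.val_succ, Fin.val_castSucc] at this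
      exact Fin.lt_def.2 this
    calc _ ≤ ∑ s ∈ (timeTuples (Fin (m + 1)) n).filter Monotone,
          ∑' z, P (incrementsEq X s (wordIncrement w z)) := by
          refine Finset.sum_le_sum fun s hs => ?_
          split_ifs with hint
          · exact (measure_mono (coincide_inter_subset σ (Finset.mem_filter.1 hs).2 hα)).trans
              (measure_iUnion_le _)
          · exact zero_le
      _ = ∑' z, ∑ s ∈ (timeTuples (Fin (m + 1)) n).filter Monotone,
          P (incrementsEq X s (wordIncrement w z)) :=
          (Summable.tsum_finsetSum fun _ _ => ENNReal.summable).symm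
      _ ≤ ∑' z, n * (∑ t ∈ D, a t) ^ (m - 3) * (green P X D z * green P X D (-z)
          * green P X D z) := by
          refine ENNReal.tsum_le_tsum fun z => ?_
          refine (h.sum_monotone_measure_incrementsEq_le _).trans ?_
          rw [mul_assoc]
          gcongr
          refine (prod_le_mul_pow _ (fun k => green_le ha D _) hpq.ne (hpq.trans hqr).ne
            hqr.ne).trans (le_of_eq ?_)
          simp only [Bool.not_true, Bool.not_false] at hp4 hq4 hr4
          simp only [wordIncrement, hp3, hp4, hq3, hq4, hr3, hr4]
          simp [mul_comm, D]
      _ = _ := ENNReal.tsum_mul_left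
  · push Not at hex
    rw [Finset.sum_eq_zero]
    · exact zero_le
    · intro s hs
      exact if_neg (hex s (Finset.mem_filter.1 hs).2)

/-- The gap `p` enters the block of `j`, `q` leaves it and `l` is a longest-type gap inside: at
least `1 / m` of the span of `j`. Nearness bounds the gap `q` by that span, hence by `m` times the
gap `l`. -/
lemma NestedNear.exists_gaps (hα : 2 ≤ α) (σ : Fin (m + 1) ≃ Fin α ⊕ Fin α)
    {s : Fin (m + 1) → ℕ} (hs : Monotone s)
    (h : NestedNear (s ∘ σ.symm ∘ Sum.inl) (s ∘ σ.symm ∘ Sum.inr)) :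
    ∃ p l q : Fin m, p < l ∧ l < q ∧
      ((σ p.castSucc).isLeft = true ∧ (σ p.succ).isLeft = false) ∧
      ((σ l.castSucc).isLeft = false ∧ (σ l.succ).isLeft = false) ∧
      ((σ q.castSucc).isLeft = false ∧ (σ q.succ).isLeft = true) ∧
      s q.succ - s q.castSucc ≤ m * (s l.succ - s l.castSucc) := by
  have : Nonempty (Fin α) := ⟨⟨0, by omega⟩⟩
  set i := s ∘ σ.symm ∘ Sum.inl with hi
  set j := s ∘ σ.symm ∘ Sum.inr with hj
  set w : Fin (m + 1) → Bool := fun k => (σ k).isLeft with hw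
  let B : Finset (Fin (m + 1)) := Finset.univ.filter fun k => w k = false
  have hBmem : ∀ r, σ.symm (Sum.inr r) ∈ B := fun r => by simp [B, hw]
  have hBne : B.Nonempty := ⟨_, hBmem ⟨0, by omega⟩⟩
  have hwB : ∀ k ∈ B, w k = false := fun k hk => (Finset.mem_filter.1 hk).2
  have hBj : ∀ k ∈ B, ∃ r, s k = j r := by
    intro k hk
    obtain ⟨r, hr⟩ := Sum.isRight_iff.1 (by simpa [hw] using hwB k hk)
    exact ⟨r, by simp [hj, ← hr]⟩
  set k0 := B.min' hBne
  set k1 := B.max' hBne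
  have hk0 : k0 ∈ B := B.min'_mem hBne
  have hk1 : k1 ∈ B := B.max'_mem hBne
  have hs0 : s k0 = ⨅ r, j r := by
    refine le_antisymm ?_ ?_
    · obtain ⟨r, hr⟩ := exists_eq_iInf_nat j
      rw [← hr]
      exact hs (B.min'_le _ (hBmem r))
    · obtain ⟨r, hr⟩ := hBj k0 hk0
      rw [hr]; exact iInf_le_nat j r
  have hs1 : s k1 = ⨆ r, j r := by
    refine le_antisymm ?_ ?_
    · obtain ⟨r, hr⟩ := hBj k1 hk1
      rw [hr]; exact le_iSup_nat j r
    · obtain ⟨r, hr⟩ := exists_eq_iSup_nat j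
      rw [← hr]
      exact hs (B.le_max' _ (hBmem r))
  -- Two different positions in the block of `j` exist because `α ≥ 2`.
  have hk01 : k0 < k1 := by
    refine Finset.min'_lt_max' B (hBmem ⟨0, by omega⟩) (hBmem ⟨1, by omega⟩) ?_
    simp
  have hbetween : ∀ k, k0 ≤ k → k ≤ k1 → w k = false := by
    intro k h0 h1
    by_contra hk
    obtain ⟨r, hr⟩ := Sum.isLeft_iff.1 (by simpa [hw] using hk)
    have hir : i r = s k := by simp [hi, ← hr]
    have h2 := hs h0
    have h3 := hs h1
    rcases h.2.1 r with h4 | h4 <;> omega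
  obtain ⟨⟨r0, hr0⟩, -, r1, hr1, hr1'⟩ := h
  have hi0 : i r0 = s (σ.symm (Sum.inl r0)) := rfl
  have hi1 : i r1 = s (σ.symm (Sum.inl r1)) := rfl
  obtain ⟨p, hp1, hp2, hp3, hp4⟩ := exists_switch (w := w) (c := true)
    (a := σ.symm (Sum.inl r0)) (b := k0) (hs.reflect_lt (by omega)) (by simp [hw])
    (by simpa using hwB k0 hk0)
  obtain ⟨q, hq1, hq2, hq3, hq4⟩ := exists_switch (w := w) (c := false)
    (a := k1) (b := σ.symm (Sum.inl r1)) (hs.reflect_lt (by omega)) (hwB k1 hk1)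
    (by simp [hw])
  obtain ⟨l, hl1, hl2, hl3⟩ := exists_large_increment (s := s) hk01
  have hpl : p < l := by
    have := hp2.trans hl1
    rw [Fin.le_def, Fin.val_succ, Fin.val_castSucc] at this
    exact Fin.lt_def.2 this
  have hlq : l < q := by
    have := hl2.trans hq1
    rw [Fin.le_def, Fin.val_succ, Fin.val_castSucc] at this
    exact Fin.lt_def.2 this
  refine ⟨p, l, q, hpl, hlq, ⟨hp3, hp4⟩,
    ⟨hbetween _ hl1 (l.castSucc_lt_succ.le.trans hl2),
      hbetween _ (hl1.trans l.castSucc_lt_succ.le) hl2⟩, ⟨hq3, hq4⟩, le_trans ?_ hl3⟩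
  have h5 := hs hq1
  have h6 := hs hq2
  omega

open scoped Classical in
-- Fix the gaps `(p, l, q)` of `NestedNear.exists_gaps`, at most `m ^ 3` choices, and the length `v`
-- of `l`. The gap `l` costs `a v`, the gaps `p` and `q` carry `z` and `-z`, and the length of `q`
-- is at most `m * v`.
lemma IIDSteps.sum_nestedNear_le (h : IIDSteps P X) (ha : ∀ t z, hitProb P X t z ≤ a t) (n : ℕ)
    (hα : 2 ≤ α) (σ : Fin (m + 1) ≃ Fin α ⊕ Fin α) :
    ∑ s ∈ (timeTuples (Fin (m + 1)) n).filter Monotone,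
      (if NestedNear (s ∘ σ.symm ∘ Sum.inl) (s ∘ σ.symm ∘ Sum.inr) then
        P (coincide X (s ∘ σ.symm ∘ Sum.inl) ∩ coincide X (s ∘ σ.symm ∘ Sum.inr)) else 0)
      ≤ (m ^ 3 : ℕ) * (n * (∑ t ∈ Finset.range (n + 1), a t) ^ (m - 3)
        * ∑ v ∈ Finset.range (n + 1), a v * ∑' z, green P X (Finset.range (n + 1)) z
          * green P X (Finset.range (min (m * v) n + 1)) (-z)) := by
  set w : Fin (m + 1) → Bool := fun k => (σ k).isLeft with hw
  let good : Fin m × Fin m × Fin m → Prop := fun c => c.1 < c.2.1 ∧ c.2.1 < c.2.2 ∧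
    (w c.1.castSucc = true ∧ w c.1.succ = false) ∧
    (w c.2.1.castSucc = false ∧ w c.2.1.succ = false) ∧
    (w c.2.2.castSucc = false ∧ w c.2.2.succ = true)
  let D : Fin m × Fin m × Fin m → ℕ → Fin m → Finset ℕ := fun c v k =>
    if k = c.2.1 then {v} else if k = c.2.2 then Finset.range (min (m * v) n + 1)
      else Finset.range (n + 1)
  let M := (timeTuples (Fin (m + 1)) n).filter Monotone
  let F : (Fin (m + 1) → ℕ) → ℝ≥0∞ := fun s => ∑' z, P (incrementsEq X s (wordIncrement w z))
  have hsub : ∀ c v k, D c v k ⊆ if k = c.2.1 then {v} else Finset.range (n + 1) := by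
    intro c v k
    simp only [D]
    split_ifs
    · exact subset_rfl
    · exact Finset.range_mono (by omega)
    · exact subset_rfl
  have hstep1 : ∀ s ∈ M,
      (if NestedNear (s ∘ σ.symm ∘ Sum.inl) (s ∘ σ.symm ∘ Sum.inr) then
        P (coincide X (s ∘ σ.symm ∘ Sum.inl) ∩ coincide X (s ∘ σ.symm ∘ Sum.inr)) else 0)
      ≤ ∑ c : Fin m × Fin m × Fin m, ∑ v ∈ Finset.range (n + 1),
        if good c ∧ ∀ k : Fin m, s k.succ - s k.castSucc ∈ D c v k then F s else 0 := by
    intro s hs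
    obtain ⟨hs1, hs2⟩ := Finset.mem_filter.1 hs
    rw [mem_timeTuples] at hs1
    split_ifs with hN
    · obtain ⟨p, l, q, hpl, hlq, hp, hl, hq, hle⟩ := hN.exists_gaps hα σ hs2
      have hsle : ∀ k : Fin m, s k.succ - s k.castSucc ≤ n := fun k => by
        have := (hs1 k.succ).2; omega
      have hcond : good (p, l, q) ∧ ∀ k : Fin m, s k.succ - s k.castSucc
          ∈ D (p, l, q) (s l.succ - s l.castSucc) k := by
        refine ⟨⟨hpl, hlq, hp, hl, hq⟩, fun k => ?_⟩
        have := hsle k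
        simp only [D]
        split_ifs with h1 h2
        · simp [h1]
        · subst h2
          simp only [Finset.mem_range]
          omega
        · simp only [Finset.mem_range]
          omega
      calc _ ≤ F s := (measure_mono (coincide_inter_subset σ hs2 (by omega))).trans
              (measure_iUnion_le _)
        _ = if good (p, l, q) ∧ ∀ k : Fin m, s k.succ - s k.castSucc
              ∈ D (p, l, q) (s l.succ - s l.castSucc) k then F s else 0 := by rw [if_pos hcond]
        _ ≤ ∑ v ∈ Finset.range (n + 1), if good (p, l, q) ∧ ∀ k : Fin m,
              s k.succ - s k.castSucc ∈ D (p, l, q) v k then F s else 0 :=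
            Finset.single_le_sum (f := fun v => if good (p, l, q) ∧ ∀ k : Fin m,
              s k.succ - s k.castSucc ∈ D (p, l, q) v k then F s else 0)
              (fun _ _ => zero_le) (by have := hsle l; simp only [Finset.mem_range]; omega)
        _ ≤ _ := Finset.single_le_sum (f := fun c => ∑ v ∈ Finset.range (n + 1),
              if good c ∧ ∀ k : Fin m, s k.succ - s k.castSucc ∈ D c v k then F s else 0)
              (fun _ _ => zero_le) (Finset.mem_univ (p, l, q))
    · exact zero_le
  have hstep2 : ∀ c v, ∑ s ∈ M,
      (if good c ∧ ∀ k : Fin m, s k.succ - s k.castSucc ∈ D c v k then F s else 0)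
      ≤ n * (∑ t ∈ Finset.range (n + 1), a t) ^ (m - 3) * (a v * ∑' z,
        green P X (Finset.range (n + 1)) z * green P X (Finset.range (min (m * v) n + 1)) (-z)) := by
    intro c v
    by_cases hc : good c
    swap
    · simp [hc]
    obtain ⟨p, l, q⟩ := c
    obtain ⟨hpl, hlq, ⟨hp1, hp2⟩, ⟨hl1, hl2⟩, ⟨hq1, hq2⟩⟩ := id hc
    simp only at hpl hlq hp1 hp2 hl1 hl2 hq1 hq2
    simp only [hc, true_and]
    rw [← Finset.sum_filter, Finset.filter_filter,
      ← Summable.tsum_finsetSum fun _ _ => ENNReal.summable, ← ENNReal.tsum_mul_left,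
      ← ENNReal.tsum_mul_left]
    refine ENNReal.tsum_le_tsum fun z => ?_
    refine (h.sum_measure_incrementsEq_le _ _).trans ?_
    rw [mul_assoc]
    gcongr
    rw [← Finset.mul_prod_erase _ _ (Finset.mem_univ l),
      ← Finset.mul_prod_erase (Finset.univ.erase l) _ (a := p) (by simp [hpl.ne]),
      ← Finset.mul_prod_erase ((Finset.univ.erase l).erase p) _ (a := q)
        (by simp [hlq.ne', (hpl.trans hlq).ne'])]
    have e1 : green P X (D (p, l, q) v l) (wordIncrement w z l) ≤ a v := by
      simpa [D, green] using ha v _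
    have e2 : green P X (D (p, l, q) v p) (wordIncrement w z p)
        = green P X (Finset.range (n + 1)) z := by
      simp [D, hpl.ne, (hpl.trans hlq).ne, wordIncrement, hp1, hp2]
    have e3 : green P X (D (p, l, q) v q) (wordIncrement w z q)
        = green P X (Finset.range (min (m * v) n + 1)) (-z) := by
      simp [D, hlq.ne', wordIncrement, hq1, hq2]
    rw [e2, e3]
    have e4 : ∏ k ∈ ((Finset.univ.erase l).erase p).erase q,
        green P X (D (p, l, q) v k) (wordIncrement w z k)
        ≤ (∑ t ∈ Finset.range (n + 1), a t) ^ (m - 3) := by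
      refine (Finset.prod_le_pow_card _ _ (∑ t ∈ Finset.range (n + 1), a t)
        fun k hk => ?_).trans (le_of_eq ?_)
      · have hkl : k ≠ l := by simp only [Finset.mem_erase] at hk; exact hk.2.2.1
        have := hsub (p, l, q) v k
        simp only [hkl, if_false] at this
        exact (green_mono this _).trans (green_le ha _ _)
      · rw [Finset.card_erase_of_mem (by simp [hlq.ne', (hpl.trans hlq).ne']),
          Finset.card_erase_of_mem (by simp [hpl.ne]), Finset.card_erase_of_mem (by simp)]
        simp [Nat.sub_sub]
    calc _ ≤ a v * (green P X (Finset.range (n + 1)) z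
          * (green P X (Finset.range (min (m * v) n + 1)) (-z)
          * (∑ t ∈ Finset.range (n + 1), a t) ^ (m - 3))) := by gcongr
      _ = _ := by ring
  calc _ ≤ ∑ s ∈ M, ∑ c : Fin m × Fin m × Fin m, ∑ v ∈ Finset.range (n + 1),
        if good c ∧ ∀ k : Fin m, s k.succ - s k.castSucc ∈ D c v k then F s else 0 :=
        Finset.sum_le_sum hstep1
    _ = ∑ c : Fin m × Fin m × Fin m, ∑ v ∈ Finset.range (n + 1), ∑ s ∈ M,
        if good c ∧ ∀ k : Fin m, s k.succ - s k.castSucc ∈ D c v k then F s else 0 := by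
        rw [Finset.sum_comm]
        exact Finset.sum_congr rfl fun c _ => Finset.sum_comm
    _ ≤ ∑ _c : Fin m × Fin m × Fin m, ∑ v ∈ Finset.range (n + 1),
        n * (∑ t ∈ Finset.range (n + 1), a t) ^ (m - 3) * (a v * ∑' z,
        green P X (Finset.range (n + 1)) z * green P X (Finset.range (min (m * v) n + 1)) (-z)) :=
        Finset.sum_le_sum fun c _ => Finset.sum_le_sum fun v _ => hstep2 c v
    _ = _ := by
        rw [Finset.sum_const, ← Finset.mul_sum, nsmul_eq_mul]
        congr 2
        simp [pow_succ, mul_assoc]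

end Chain

end SelfIntersection

/-! ### From Green functions to return probabilities -/

namespace SelfIntersection

/-- A value `t = u + v` arises from at most `min (t + 1) A` pairs, since `u ≤ t` and `u < A`. -/
lemma sum_range_sum_range_add_le (f : ℕ → ℝ≥0∞) {A B N : ℕ} (h : A + B ≤ N + 1) :
    ∑ u ∈ Finset.range A, ∑ v ∈ Finset.range B, f (u + v)
      ≤ ∑ t ∈ Finset.range N, (min (t + 1) A : ℕ) * f t := by
  calc ∑ u ∈ Finset.range A, ∑ v ∈ Finset.range B, f (u + v)
      ≤ ∑ u ∈ Finset.range A, ∑ t ∈ Finset.range N, if u < t + 1 then f t else 0 := by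
        refine Finset.sum_le_sum fun u hu => ?_
        rw [← Finset.sum_filter]
        have hinj : Set.InjOn (fun v => u + v) (Finset.range B : Set ℕ) :=
          (add_right_injective u).injOn
        rw [← Finset.sum_image (f := f) hinj]
        refine Finset.sum_le_sum_of_subset ?_
        intro t ht
        obtain ⟨v, hv, rfl⟩ := Finset.mem_image.1 ht
        simp only [Finset.mem_range, Finset.mem_filter] at *
        omega
    _ = ∑ t ∈ Finset.range N, (min (t + 1) A : ℕ) * f t := by
        rw [Finset.sum_comm]
        refine Finset.sum_congr rfl fun t _ => ?_
        rw [← Finset.sum_filter, Finset.sum_const, nsmul_eq_mul]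
        congr 2
        have : (Finset.range A).filter (fun u => u < t + 1) = Finset.range (min (t + 1) A) := by
          ext u; simp only [Finset.mem_filter, Finset.mem_range]; omega
        rw [this, Finset.card_range]

variable {Ω : Type*} [MeasurableSpace Ω] {d : ℕ} {P : Measure Ω} {X : ℕ → Ω → (Fin d → ℤ)}

/-- The weighted number of returns to the origin that controls the variance. -/
noncomputable def returnWeight (P : Measure Ω) (X : ℕ → Ω → (Fin d → ℤ)) (a : ℕ → ℝ≥0∞)
    (n : ℕ) : ℝ≥0∞ :=
  ∑ w ∈ Finset.range (n + 1), a w *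
    ∑ t ∈ Finset.range (2 * n + 1), (min (t + 1) (w + 1) : ℕ) * hitProb P X t 0

open scoped Classical in
lemma sum_pairs_eq_sum_timeTuples {α : ℕ} (n : ℕ)
    (f : (Fin α → ℕ) → (Fin α → ℕ) → ℝ≥0∞) :
    ∑ p ∈ timeTuples (Fin α) n ×ˢ timeTuples (Fin α) n, f p.1 p.2
      = ∑ t ∈ timeTuples (Fin α ⊕ Fin α) n, f (t ∘ Sum.inl) (t ∘ Sum.inr) := by
  refine Finset.sum_bij' (fun p _ => Sum.elim p.1 p.2) (fun t _ => (t ∘ Sum.inl, t ∘ Sum.inr))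
    ?_ ?_ ?_ ?_ ?_
  · intro p hp
    simp only [Finset.mem_product, mem_timeTuples] at *
    rintro (r | r)
    · exact hp.1 r
    · exact hp.2 r
  · intro t ht
    simp only [Finset.mem_product, mem_timeTuples] at *
    exact ⟨fun r => ht _, fun r => ht _⟩
  · intro p _; simp
  · intro t _; simp [Sum.elim_comp_inl_inr]
  · intro p _; simp

open scoped Classical in
lemma sum_pairs_le_of_sorted {α m : ℕ} (e : Fin (m + 1) ≃ Fin α ⊕ Fin α) (n : ℕ)
    (C : (Fin α → ℕ) → (Fin α → ℕ) → Prop) {B : ℝ≥0∞}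
    (hB : ∀ σ : Fin (m + 1) ≃ Fin α ⊕ Fin α,
      ∑ s ∈ (timeTuples (Fin (m + 1)) n).filter Monotone,
        (if C (s ∘ σ.symm ∘ Sum.inl) (s ∘ σ.symm ∘ Sum.inr) then
          P (coincide X (s ∘ σ.symm ∘ Sum.inl) ∩ coincide X (s ∘ σ.symm ∘ Sum.inr)) else 0) ≤ B) :
    ∑ p ∈ timeTuples (Fin α) n ×ˢ timeTuples (Fin α) n,
      (if C p.1 p.2 then P (coincide X p.1 ∩ coincide X p.2) else 0)
      ≤ Fintype.card (Fin (m + 1) ≃ Fin α ⊕ Fin α) * B := by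
  rw [sum_pairs_eq_sum_timeTuples n
    (fun i j => if C i j then P (coincide X i ∩ coincide X j) else 0)]
  refine (sum_timeTuples_le_sum_monotone e n _).trans ?_
  refine (Finset.sum_le_card_nsmul _ _ B fun σ _ => hB σ).trans (le_of_eq ?_)
  rw [nsmul_eq_mul, Finset.card_univ]

lemma IIDSteps.tsum_green_mul_green_neg (h : IIDSteps P X) (A B : ℕ) :
    ∑' z, green P X (Finset.range A) z * green P X (Finset.range B) (-z)
      = ∑ u ∈ Finset.range A, ∑ v ∈ Finset.range B, hitProb P X (u + v) 0 := by
  simp only [green, Finset.sum_mul_sum]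
  rw [Summable.tsum_finsetSum fun _ _ => ENNReal.summable]
  refine Finset.sum_congr rfl fun u _ => ?_
  rw [Summable.tsum_finsetSum fun _ _ => ENNReal.summable]
  exact Finset.sum_congr rfl fun v _ => h.tsum_hitProb_mul_neg u v

variable {a : ℕ → ℝ≥0∞}

/-- Of the two gaps with increment `z`, the longer one, of length `w`, is bounded by `a w`; the
factor 2 accounts for which one it is. The shorter one combines with the gap of increment `-z` into
a return. -/
lemma IIDSteps.tsum_green_triple_le (h : IIDSteps P X) (ha : ∀ t z, hitProb P X t z ≤ a t)
    (n : ℕ) :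
    ∑' z, green P X (Finset.range (n + 1)) z * green P X (Finset.range (n + 1)) (-z)
      * green P X (Finset.range (n + 1)) z ≤ 2 * returnWeight P X a n := by
  set R := Finset.range (n + 1) with hR
  have hexp : ∀ z, green P X R z * green P X R (-z) * green P X R z
      ≤ 2 * ∑ w ∈ R, ∑ u ∈ Finset.range (w + 1), ∑ v ∈ R,
        a w * (hitProb P X u z * hitProb P X v (-z)) := by
    intro z
    set G := green P X R (-z) with hG
    have h1 : green P X R z * green P X R z
        ≤ 2 * ∑ w ∈ R, ∑ u ∈ Finset.range (w + 1), a w * hitProb P X u z := by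
      have h2 : ∀ u ∈ R, ∀ w ∈ R, hitProb P X u z * hitProb P X w z
          ≤ (if u < w + 1 then a w * hitProb P X u z else 0)
            + (if w < u + 1 then a u * hitProb P X w z else 0) := by
        intro u _ w _
        rcases le_total u w with huw | huw
        · refine le_trans ?_ le_self_add
          rw [if_pos (Nat.lt_succ_of_le huw), mul_comm]
          gcongr
          exact ha _ _
        · refine le_trans ?_ le_add_self
          rw [if_pos (Nat.lt_succ_of_le huw)]
          gcongr
          exact ha _ _
      have h3 : ∀ w ∈ R, ∑ u ∈ R, (if u < w + 1 then a w * hitProb P X u z else 0)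
          = ∑ u ∈ Finset.range (w + 1), a w * hitProb P X u z := by
        intro w hw
        rw [← Finset.sum_filter]
        congr 1
        ext u
        simp only [hR, Finset.mem_filter, Finset.mem_range] at *
        omega
      calc green P X R z * green P X R z
          = ∑ u ∈ R, ∑ w ∈ R, hitProb P X u z * hitProb P X w z := by
            simp only [green, Finset.sum_mul_sum]
        _ ≤ ∑ u ∈ R, ∑ w ∈ R, ((if u < w + 1 then a w * hitProb P X u z else 0)
            + (if w < u + 1 then a u * hitProb P X w z else 0)) :=
            Finset.sum_le_sum fun u hu => Finset.sum_le_sum fun w hw => h2 u hu w hw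
        _ = ∑ w ∈ R, ∑ u ∈ R, (if u < w + 1 then a w * hitProb P X u z else 0)
            + ∑ u ∈ R, ∑ w ∈ R, (if w < u + 1 then a u * hitProb P X w z else 0) := by
            simp only [Finset.sum_add_distrib]
            rw [Finset.sum_comm]
        _ = _ := by rw [Finset.sum_congr rfl h3, two_mul]
    calc green P X R z * G * green P X R z = green P X R z * green P X R z * G := by ring
      _ ≤ (2 * ∑ w ∈ R, ∑ u ∈ Finset.range (w + 1), a w * hitProb P X u z) * G := by gcongr
      _ = _ := by
        simp only [hG, green, mul_assoc, Finset.sum_mul, Finset.mul_sum]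
        rw [Finset.sum_comm]
        exact Finset.sum_congr rfl fun w _ => Finset.sum_comm
  calc _ ≤ ∑' z, 2 * ∑ w ∈ R, ∑ u ∈ Finset.range (w + 1), ∑ v ∈ R,
        a w * (hitProb P X u z * hitProb P X v (-z)) := ENNReal.tsum_le_tsum hexp
    _ = 2 * ∑ w ∈ R, a w * ∑ u ∈ Finset.range (w + 1), ∑ v ∈ R, hitProb P X (u + v) 0 := by
        rw [ENNReal.tsum_mul_left, Summable.tsum_finsetSum fun _ _ => ENNReal.summable]
        congr 1
        refine Finset.sum_congr rfl fun w _ => ?_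
        rw [Summable.tsum_finsetSum fun _ _ => ENNReal.summable, Finset.mul_sum]
        refine Finset.sum_congr rfl fun u _ => ?_
        rw [Summable.tsum_finsetSum fun _ _ => ENNReal.summable, Finset.mul_sum]
        refine Finset.sum_congr rfl fun v _ => ?_
        rw [ENNReal.tsum_mul_left, h.tsum_hitProb_mul_neg]
    _ ≤ 2 * returnWeight P X a n := by
        unfold returnWeight
        gcongr with w hw
        refine sum_range_sum_range_add_le (fun t => hitProb P X t 0) ?_
        have := Finset.mem_range.1 hw
        omega

/-- The restricted gap has length at most `m * v`, and `min (t + 1) (m * v + 1)` is at most `m`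
times `min (t + 1) (v + 1)`. -/
lemma IIDSteps.sum_mul_tsum_green_le (h : IIDSteps P X) (n : ℕ) {m : ℕ} (hm : 1 ≤ m) :
    ∑ v ∈ Finset.range (n + 1), a v * ∑' z, green P X (Finset.range (n + 1)) z
      * green P X (Finset.range (min (m * v) n + 1)) (-z) ≤ m * returnWeight P X a n := by
  unfold returnWeight
  rw [Finset.mul_sum]
  refine Finset.sum_le_sum fun v _ => ?_
  rw [mul_left_comm]
  gcongr
  rw [h.tsum_green_mul_green_neg, Finset.sum_comm]
  have h1 := sum_range_sum_range_add_le (fun t => hitProb P X t 0)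
    (A := min (m * v) n + 1) (B := n + 1) (N := 2 * n + 1) (by omega)
  refine le_trans (le_of_eq ?_) (h1.trans ?_)
  · exact Finset.sum_congr rfl fun u _ => Finset.sum_congr rfl fun w _ => by rw [add_comm]
  · rw [Finset.mul_sum]
    refine Finset.sum_le_sum fun t _ => ?_
    rw [← mul_assoc, ← Nat.cast_mul]
    gcongr
    have h2 : m * v + 1 ≤ m * (v + 1) := by rw [mul_add]; omega
    have h3 : t + 1 ≤ m * (t + 1) := Nat.le_mul_of_pos_left _ hm
    rw [← Nat.mul_min_mul_left]
    omega

variable [IsProbabilityMeasure P]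

open scoped Classical in
/-- The variance bound in terms of the probabilities of return. -/
theorem IIDSteps.variance_le (h : IIDSteps P X) (ha : ∀ t z, hitProb P X t z ≤ a t) {α : ℕ}
    (hα : 2 ≤ α) : ∃ C : ℕ, ∀ n : ℕ,
    ENNReal.ofReal (variance (selfIntersection X α n) P)
      ≤ C * (n * ((∑ t ∈ Finset.range (n + 1), a t) ^ (2 * α - 1)
        + (∑ t ∈ Finset.range (n + 1), a t) ^ (2 * α - 4) * returnWeight P X a n)) := by
  have : Nonempty (Fin α) := ⟨⟨0, by omega⟩⟩
  -- `m = 2 * α - 1` is the number of gaps between the `2 * α` sorted times.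
  obtain ⟨m, hm⟩ : ∃ m, m + 1 = α + α := ⟨2 * α - 1, by omega⟩
  have e : Fin (m + 1) ≃ Fin α ⊕ Fin α := (finCongr hm).trans finSumFinEquiv.symm
  set N := Fintype.card (Fin (m + 1) ≃ Fin α ⊕ Fin α) with hN
  refine ⟨N * (1 + 4 + 2 * (m ^ 3 * m)), fun n => ?_⟩
  set G := ∑ t ∈ Finset.range (n + 1), a t with hG
  set W := returnWeight P X a n with hW
  have hm1 : 2 * α - 1 = m := by omega
  have hm3 : 2 * α - 4 = m - 3 := by omega
  rw [hm1, hm3]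
  set T := timeTuples (Fin α) n with hT
  let Q : (Fin α → ℕ) → (Fin α → ℕ) → ℝ≥0∞ := fun i j => P (coincide X i ∩ coincide X j)
  have hQ : ∀ i j, Q i j = Q j i := fun i j => by simp only [Q, Set.inter_comm]
  let S : ((Fin α → ℕ) → (Fin α → ℕ) → Prop) → ℝ≥0∞ := fun C =>
    ∑ p ∈ T ×ˢ T, if C p.1 p.2 then Q p.1 p.2 else 0
  have hswap : ∀ C, S (fun i j => C j i) = S C := by
    intro C
    refine Finset.sum_bij' (fun p _ => p.swap) (fun p _ => p.swap) ?_ ?_ ?_ ?_ ?_ <;>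
      simp +contextual [hQ]
  have hcover : ENNReal.ofReal (variance (selfIntersection X α n) P)
      ≤ S SharesTime + S Interlaced + S (fun i j => Interlaced j i)
        + S NestedNear + S (fun i j => NestedNear j i) := by
    refine (h.variance_selfIntersection_le (by omega) n).trans ?_
    simp only [S]
    rw [Finset.sum_filter, ← Finset.sum_add_distrib, ← Finset.sum_add_distrib,
      ← Finset.sum_add_distrib, ← Finset.sum_add_distrib]
    refine Finset.sum_le_sum fun p _ => ?_
    by_cases hbad : ¬ StartsBeforeFarFrom p.1 p.2 ∧ ¬ StartsBeforeFarFrom p.2 p.1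
    swap
    · rw [if_neg hbad]; exact zero_le
    rw [if_pos hbad]
    change Q p.1 p.2 ≤ _
    rcases tie_or_interlaced_or_nestedNear hbad.1 hbad.2 with h1 | h1 | h1 | h1 | h1
    · rw [if_pos h1]; simp only [add_assoc]; exact le_self_add
    · simp only [if_pos h1, add_assoc]; exact le_add_left le_self_add
    · simp only [if_pos h1, add_assoc]; exact le_add_left (le_add_left le_self_add)
    · simp only [if_pos h1, add_assoc]; exact le_add_left (le_add_left (le_add_left le_self_add))
    · simp only [if_pos h1, add_assoc]
      exact le_add_left (le_add_left (le_add_left le_add_self))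
  rw [hswap Interlaced, hswap NestedNear] at hcover
  have htie : S SharesTime ≤ N * (n * G ^ m) :=
    sum_pairs_le_of_sorted (P := P) (X := X) e n SharesTime fun σ => h.sum_tie_le ha n σ
  have hint : S Interlaced ≤ N * (n * G ^ (m - 3) * (2 * W)) :=
    sum_pairs_le_of_sorted (P := P) (X := X) e n Interlaced fun σ =>
      (h.sum_interlaced_le ha n (by omega) σ).trans (by gcongr; exact h.tsum_green_triple_le ha n)
  have hnest : S NestedNear ≤ N * ((m ^ 3 : ℕ) * (n * G ^ (m - 3) * (m * W))) :=
    sum_pairs_le_of_sorted (P := P) (X := X) e n NestedNear fun σ =>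
      (h.sum_nestedNear_le ha n hα σ).trans (by
        gcongr; exact h.sum_mul_tsum_green_le n (by omega))
  calc _ ≤ _ := hcover
    _ ≤ N * (n * G ^ m) + N * (n * G ^ (m - 3) * (2 * W)) + N * (n * G ^ (m - 3) * (2 * W))
        + N * ((m ^ 3 : ℕ) * (n * G ^ (m - 3) * (m * W)))
        + N * ((m ^ 3 : ℕ) * (n * G ^ (m - 3) * (m * W))) := by gcongr
    _ = N * ((n * G ^ m) + (4 + 2 * (m ^ 3 * m)) * (n * (G ^ (m - 3) * W))) := by
        push_cast; ring
    _ ≤ N * ((1 + 4 + 2 * (m ^ 3 * m)) * (n * G ^ m)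
        + (1 + 4 + 2 * (m ^ 3 * m)) * (n * (G ^ (m - 3) * W))) := by
        have h1 : (1 : ℝ≥0∞) ≤ 1 + 4 + 2 * (m ^ 3 * m) := by
          rw [add_assoc]; exact le_self_add
        have h2 : (4 : ℝ≥0∞) + 2 * (m ^ 3 * m) ≤ 1 + 4 + 2 * (m ^ 3 * m) := by
          rw [add_assoc]; exact le_add_self
        gcongr N * (?_ + ?_ * _)
        exact le_mul_of_one_le_left zero_le h1
    _ = _ := by push_cast; ring

end SelfIntersection

/-! ### Characteristic functions of the walk -/

namespace SelfIntersection

/-- The pairing of a frequency with a lattice point. -/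
def pairing {d : ℕ} (θ : Fin d → ℝ) (y : Fin d → ℤ) : ℝ := ∑ i, θ i * (y i : ℝ)

/-- The cube `[-ε, ε]^d`. -/
def cube (d : ℕ) (ε : ℝ) : Set (Fin d → ℝ) := {θ | ∀ i, |θ i| ≤ ε}

/-- One minus the characteristic function of the symmetrised step. -/
noncomputable def symmExponent {Ω : Type*} [MeasurableSpace Ω] {d : ℕ} (P : Measure Ω)
    (X : ℕ → Ω → (Fin d → ℤ)) (θ : Fin d → ℝ) : ℝ :=
  ∫ ω, (1 - Real.cos (pairing θ (X 0 ω - X 1 ω))) ∂P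

/-- The characteristic function of a step. -/
noncomputable def stepChar {Ω : Type*} [MeasurableSpace Ω] {d : ℕ} (P : Measure Ω)
    (X : ℕ → Ω → (Fin d → ℤ)) (θ : Fin d → ℝ) : ℂ :=
  ∫ ω, Complex.exp (pairing θ (X 0 ω) * Complex.I) ∂P

section Pairing

variable {d : ℕ}

lemma pairing_add (θ : Fin d → ℝ) (x y : Fin d → ℤ) :
    pairing θ (x + y) = pairing θ x + pairing θ y := by
  simp [pairing, mul_add, Finset.sum_add_distrib]

lemma pairing_sub (θ : Fin d → ℝ) (x y : Fin d → ℤ) :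
    pairing θ (x - y) = pairing θ x - pairing θ y := by
  simp [pairing, mul_sub, Finset.sum_sub_distrib]

lemma sub_pairing (θ θ' : Fin d → ℝ) (y : Fin d → ℤ) :
    pairing (θ - θ') y = pairing θ y - pairing θ' y := by
  simp [pairing, sub_mul, Finset.sum_sub_distrib]

lemma measurable_pairing : Measurable fun p : (Fin d → ℝ) × (Fin d → ℤ) => pairing p.1 p.2 := by
  unfold pairing
  refine Finset.measurable_sum _ fun i _ => ?_
  have h1 : Measurable fun p : (Fin d → ℝ) × (Fin d → ℤ) => p.1 i := by fun_prop
  have h2 : Measurable fun p : (Fin d → ℝ) × (Fin d → ℤ) => ((p.2 i : ℤ) : ℝ) :=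
    (measurable_from_top (f := fun z : ℤ => (z : ℝ))).comp (by fun_prop)
  exact h1.mul h2

lemma measurable_pairing_right (θ : Fin d → ℝ) : Measurable (pairing θ) :=
  measurable_of_countable _

lemma measurable_pairing_left (y : Fin d → ℤ) : Measurable fun θ => pairing θ y :=
  measurable_pairing.comp (measurable_id.prodMk measurable_const)

end Pairing

variable {Ω : Type*} [MeasurableSpace Ω] {d : ℕ} {P : Measure Ω} {X : ℕ → Ω → (Fin d → ℤ)}

section Exponent

lemma IIDSteps.measurable_diff (h : IIDSteps P X) : Measurable fun ω => X 0 ω - X 1 ω :=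
  (h.measurable 0).sub (h.measurable 1)

lemma symmExponent_nonneg (θ : Fin d → ℝ) : 0 ≤ symmExponent P X θ :=
  integral_nonneg fun _ => sub_nonneg.2 (Real.cos_le_one _)

lemma IIDSteps.integral_exp_step (h : IIDSteps P X) (θ : Fin d → ℝ) (k : ℕ) :
    ∫ ω, Complex.exp (pairing θ (X k ω) * Complex.I) ∂P = stepChar P X θ :=
  ((h.ident k).comp (measurable_of_countable
    fun y => Complex.exp (pairing θ y * Complex.I))).integral_eq

variable [IsProbabilityMeasure P]

lemma integrable_exp_of_measurable {f : Ω → ℝ} (hf : Measurable f) :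
    Integrable (fun ω => Complex.exp (f ω * Complex.I)) P :=
  Integrable.of_bound (C := 1) (by fun_prop) (ae_of_all _ fun ω => by
    rw [Complex.norm_exp_ofReal_mul_I])

lemma integrable_one_sub_cos {f : Ω → ℝ} (hf : Measurable f) :
    Integrable (fun ω => 1 - Real.cos (f ω)) P :=
  (integrable_const 1).sub (Integrable.of_bound (C := 1) (by fun_prop)
    (ae_of_all _ fun ω => Real.abs_cos_le_one _))

lemma IIDSteps.integral_exp_walk (h : IIDSteps P X) (θ : Fin d → ℝ) (t : ℕ) :
    ∫ ω, Complex.exp (pairing θ (walk X t ω) * Complex.I) ∂P = stepChar P X θ ^ t := by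
  induction t with
  | zero => simp [walk, pairing]
  | succ t ih =>
    have hind : IndepFun (walk X t) (X t) P := by
      have := h.indep.indepFun_sum_range_succ (fun i => h.measurable i) t
      convert this using 1
      ext ω
      simp [walk]
    have hfun : ∀ ω, Complex.exp (pairing θ (walk X (t + 1) ω) * Complex.I)
        = Complex.exp (pairing θ (walk X t ω) * Complex.I)
          * Complex.exp (pairing θ (X t ω) * Complex.I) := by
      intro ω
      have : walk X (t + 1) ω = walk X t ω + X t ω := by simp [walk, Finset.sum_range_succ]
      rw [this, pairing_add, ← Complex.exp_add]
      push_cast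
      ring_nf
    simp_rw [hfun]
    have hm : Measurable fun y : Fin d → ℤ => Complex.exp (pairing θ y * Complex.I) :=
      measurable_of_countable _
    have hmul := (hind.comp hm hm).integral_fun_mul_eq_mul_integral
      (hm.comp (h.measurable_walk t)).aestronglyMeasurable
      (hm.comp (h.measurable t)).aestronglyMeasurable
    simp only [Function.comp_apply] at hmul
    rw [hmul, ih, h.integral_exp_step, pow_succ]

/-- By independence and equality in law of `X 0` and `X 1`, the squared modulus is the
characteristic function of `X 0 - X 1`, whose real part is the mean of the cosine. -/
lemma IIDSteps.norm_stepChar_sq (h : IIDSteps P X) (θ : Fin d → ℝ) :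
    ‖stepChar P X θ‖ ^ 2 = 1 - symmExponent P X θ := by
  have hm : Measurable fun y : Fin d → ℤ => Complex.exp (pairing θ y * Complex.I) :=
    measurable_of_countable _
  have hm' : Measurable fun y : Fin d → ℤ => Complex.exp (-pairing θ y * Complex.I) :=
    measurable_of_countable _
  have hind := (h.indep.indepFun (i := 0) (j := 1) (by simp)).comp hm hm'
  have hprod := hind.integral_fun_mul_eq_mul_integral
    (hm.comp (h.measurable 0)).aestronglyMeasurable
    (hm'.comp (h.measurable 1)).aestronglyMeasurable
  simp only [Function.comp_apply] at hprod
  have hconj : ∫ ω, Complex.exp (-pairing θ (X 1 ω) * Complex.I) ∂P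
      = (starRingEnd ℂ) (stepChar P X θ) := by
    rw [← h.integral_exp_step θ 1, ← integral_conj]
    refine integral_congr_ae (ae_of_all _ fun ω => ?_)
    simp only [← Complex.exp_conj, map_mul, Complex.conj_ofReal, Complex.conj_I]
    ring_nf
  rw [hconj, h.integral_exp_step, Complex.mul_conj, Complex.normSq_eq_norm_sq] at hprod
  have hre := congrArg Complex.re hprod
  rw [Complex.ofReal_re] at hre
  rw [← hre]
  have hdm := (measurable_pairing_right θ).comp h.measurable_diff
  have hcos : symmExponent P X θ = 1 - ∫ ω, Real.cos (pairing θ (X 0 ω - X 1 ω)) ∂P := by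
    rw [symmExponent, integral_sub (integrable_const 1)]
    · simp
    · exact Integrable.of_bound (C := 1) (Real.measurable_cos.comp hdm).aestronglyMeasurable
        (ae_of_all _ fun ω => Real.abs_cos_le_one _)
  rw [hcos, sub_sub_cancel]
  have hexp : ∀ ω, Complex.exp (pairing θ (X 0 ω) * Complex.I)
      * Complex.exp (-pairing θ (X 1 ω) * Complex.I)
      = Complex.exp (pairing θ (X 0 ω - X 1 ω) * Complex.I) := by
    intro ω
    rw [← Complex.exp_add, pairing_sub]
    push_cast
    ring_nf
  simp_rw [hexp]
  change Complex.reCLM _ = _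
  have hcomm := Complex.reCLM.integral_comp_comm (integrable_exp_of_measurable (P := P) hdm)
  simp only [Function.comp_apply] at hcomm
  rw [← hcomm]
  refine integral_congr_ae (ae_of_all _ fun ω => ?_)
  simp [Complex.exp_ofReal_mul_I_re]

lemma IIDSteps.norm_stepChar_pow_le (h : IIDSteps P X) (θ : Fin d → ℝ) (t : ℕ) :
    ‖stepChar P X θ‖ ^ t ≤ Real.exp (-(t * (symmExponent P X θ / 2))) := by
  have h1 : ‖stepChar P X θ‖ ≤ Real.exp (-(symmExponent P X θ / 2)) := by
    refine le_of_sq_le_sq ?_ (Real.exp_pos _).le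
    rw [h.norm_stepChar_sq, ← Real.exp_nat_mul]
    have := Real.add_one_le_exp (-symmExponent P X θ)
    have h2 : ((2 : ℕ) : ℝ) * -(symmExponent P X θ / 2) = -symmExponent P X θ := by
      push_cast; ring
    rw [h2]
    linarith
  calc ‖stepChar P X θ‖ ^ t ≤ Real.exp (-(symmExponent P X θ / 2)) ^ t := by gcongr
    _ = _ := by rw [← Real.exp_nat_mul]; ring_nf

/-- A quadratic lower bound for the exponent near the origin. -/
lemma IIDSteps.symmExponent_ge (h : IIDSteps P X) (F : Finset (Fin d → ℤ)) {θ : Fin d → ℝ}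
    (hF : ∀ y ∈ F, |pairing θ y| ≤ Real.pi) :
    ∑ y ∈ F, 2 / Real.pi ^ 2 * P.real {ω | X 0 ω - X 1 ω = y} * pairing θ y ^ 2
      ≤ symmExponent P X θ := by
  have hms : ∀ y, MeasurableSet {ω | X 0 ω - X 1 ω = y} := fun y =>
    h.measurable_diff (measurableSet_singleton y)
  have hdm := (measurable_pairing_right θ).comp h.measurable_diff
  have hle : ∀ ω, ∑ y ∈ F, {ω | X 0 ω - X 1 ω = y}.indicator
      (fun _ => 1 - Real.cos (pairing θ y)) ω ≤ 1 - Real.cos (pairing θ (X 0 ω - X 1 ω)) := by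
    intro ω
    classical
    simp only [Set.indicator_apply, Set.mem_ofPred_eq]
    rw [Finset.sum_ite_eq]
    split_ifs
    · exact le_rfl
    · exact sub_nonneg.2 (Real.cos_le_one _)
  calc _ ≤ ∑ y ∈ F, P.real {ω | X 0 ω - X 1 ω = y} * (1 - Real.cos (pairing θ y)) := by
        refine Finset.sum_le_sum fun y hy => ?_
        -- The bound `cos x ≤ 1 - 2 x² / π²` holds for `|x| ≤ π`, whence the hypothesis on `F`.
        have := Real.cos_le_one_sub_mul_cos_sq (hF y hy)
        rw [mul_comm (2 / Real.pi ^ 2), mul_assoc]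
        gcongr
        linarith
    _ = ∫ ω, ∑ y ∈ F, {ω | X 0 ω - X 1 ω = y}.indicator
          (fun _ => 1 - Real.cos (pairing θ y)) ω ∂P := by
        rw [integral_finsetSum _ fun y _ => (integrable_const _).indicator (hms y)]
        refine Finset.sum_congr rfl fun y _ => ?_
        rw [integral_indicator_const _ (hms y), smul_eq_mul]
    _ ≤ _ := integral_mono (integrable_finsetSum _ fun y _ => (integrable_const _).indicator (hms y))
        (integrable_one_sub_cos hdm) hle

end Exponent

end SelfIntersection

/-! ### Esseen's concentration inequality -/

namespace SelfIntersection

variable {Ω : Type*} [MeasurableSpace Ω] {d : ℕ} {P : Measure Ω} {X : ℕ → Ω → (Fin d → ℤ)}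

lemma measurableSet_cube (ε : ℝ) : MeasurableSet (cube d ε) := by
  have : cube d ε = ⋂ i, {θ | |θ i| ≤ ε} := by ext θ; simp [cube]
  rw [this]
  exact MeasurableSet.iInter fun i => measurableSet_le (by fun_prop) measurable_const

variable [IsProbabilityMeasure P]

lemma IIDSteps.measurable_symmExponent (h : IIDSteps P X) : Measurable (symmExponent P X) := by
  have hm : Measurable fun p : (Fin d → ℝ) × Ω =>
      1 - Real.cos (pairing p.1 (X 0 p.2 - X 1 p.2)) :=
    measurable_const.sub (Real.measurable_cos.comp (measurable_pairing.comp
      (measurable_fst.prodMk (h.measurable_diff.comp measurable_snd))))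
  exact (hm.stronglyMeasurable.integral_prod_right (ν := P)).measurable

/-- The squared modulus of the Fourier transform of `ν` at `S_t - x` is nonnegative and equals the
squared mass of `ν` when `S_t = x`. By Fubini its mean is a double integral of the characteristic
function of `S_t - x` at differences of frequencies. -/
lemma IIDSteps.hitProb_mul_sq_le (h : IIDSteps P X) (ν : Measure (Fin d → ℝ))
    [IsFiniteMeasure ν] (t : ℕ) (x : Fin d → ℤ) :
    P.real {ω | walk X t ω = x} * ν.real Set.univ ^ 2
      ≤ ∫ p, Real.exp (-(t * (symmExponent P X (p.1 - p.2) / 2))) ∂(ν.prod ν) := by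
  have hwx : Measurable fun ω => walk X t ω - x := (h.measurable_walk t).sub measurable_const
  have hmeas : Measurable fun q : ((Fin d → ℝ) × (Fin d → ℝ)) × Ω =>
      Complex.exp (pairing (q.1.1 - q.1.2) (walk X t q.2 - x) * Complex.I) := by
    have : Measurable fun q : ((Fin d → ℝ) × (Fin d → ℝ)) × Ω =>
        pairing (q.1.1 - q.1.2) (walk X t q.2 - x) :=
      measurable_pairing.comp (Measurable.prodMk (by fun_prop) (hwx.comp measurable_snd))
    fun_prop
  have hint : Integrable (fun q : ((Fin d → ℝ) × (Fin d → ℝ)) × Ω =>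
      Complex.exp (pairing (q.1.1 - q.1.2) (walk X t q.2 - x) * Complex.I))
      ((ν.prod ν).prod P) :=
    Integrable.of_bound (C := 1) hmeas.aestronglyMeasurable (ae_of_all _ fun q => by
      rw [Complex.norm_exp_ofReal_mul_I])
  have hkernel : ∀ y : Fin d → ℤ,
      ∫ p : (Fin d → ℝ) × (Fin d → ℝ), Complex.exp (pairing (p.1 - p.2) y * Complex.I) ∂(ν.prod ν)
      = ((‖∫ θ, Complex.exp (pairing θ y * Complex.I) ∂ν‖ ^ 2 : ℝ) : ℂ) := by
    intro y
    have hsplit : ∀ p : (Fin d → ℝ) × (Fin d → ℝ),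
        Complex.exp (pairing (p.1 - p.2) y * Complex.I)
        = Complex.exp (pairing p.1 y * Complex.I)
          * (starRingEnd ℂ) (Complex.exp (pairing p.2 y * Complex.I)) := by
      intro p
      rw [← Complex.exp_conj, ← Complex.exp_add, sub_pairing]
      simp only [map_mul, Complex.conj_ofReal, Complex.conj_I]
      push_cast
      ring_nf
    simp_rw [hsplit]
    rw [integral_prod_mul (fun θ => Complex.exp (pairing θ y * Complex.I))
      (fun θ => (starRingEnd ℂ) (Complex.exp (pairing θ y * Complex.I))), integral_conj,
      Complex.mul_conj, Complex.normSq_eq_norm_sq]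
  have hswap := integral_integral_swap (f := fun (p : (Fin d → ℝ) × (Fin d → ℝ)) (ω : Ω) =>
      Complex.exp (pairing (p.1 - p.2) (walk X t ω - x) * Complex.I)) hint
  have hinner : ∀ p : (Fin d → ℝ) × (Fin d → ℝ),
      ‖∫ ω, Complex.exp (pairing (p.1 - p.2) (walk X t ω - x) * Complex.I) ∂P‖
        ≤ Real.exp (-(t * (symmExponent P X (p.1 - p.2) / 2))) := by
    intro p
    have hsplit : ∀ ω, Complex.exp (pairing (p.1 - p.2) (walk X t ω - x) * Complex.I)
        = Complex.exp (((-pairing (p.1 - p.2) x : ℝ) : ℂ) * Complex.I)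
          * Complex.exp (pairing (p.1 - p.2) (walk X t ω) * Complex.I) := by
      intro ω
      rw [← Complex.exp_add, pairing_sub]
      push_cast
      ring_nf
    simp_rw [hsplit]
    rw [integral_const_mul, h.integral_exp_walk, norm_mul, Complex.norm_exp_ofReal_mul_I, one_mul,
      norm_pow]
    exact h.norm_stepChar_pow_le _ _
  have hsq : ∫ ω, ((‖∫ θ, Complex.exp (pairing θ (walk X t ω - x) * Complex.I) ∂ν‖ ^ 2 : ℝ) : ℂ) ∂P
      = ∫ p : (Fin d → ℝ) × (Fin d → ℝ),
        ∫ ω, Complex.exp (pairing (p.1 - p.2) (walk X t ω - x) * Complex.I) ∂P ∂(ν.prod ν) := by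
    rw [hswap]
    exact integral_congr_ae (ae_of_all _ fun ω => (hkernel _).symm)
  have hbound : ∫ ω, ‖∫ θ, Complex.exp (pairing θ (walk X t ω - x) * Complex.I) ∂ν‖ ^ 2 ∂P
      ≤ ∫ p, Real.exp (-(t * (symmExponent P X (p.1 - p.2) / 2))) ∂(ν.prod ν) := by
    rw [integral_complex_ofReal] at hsq
    refine le_trans (le_abs_self _) ?_
    rw [← Real.norm_eq_abs, ← Complex.norm_real, hsq]
    refine norm_integral_le_of_norm_le ?_ (ae_of_all _ hinner)
    refine Integrable.of_bound (C := 1) ?_ (ae_of_all _ fun p => ?_)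
    · have := h.measurable_symmExponent
      exact Measurable.aestronglyMeasurable (by fun_prop)
    · rw [Real.norm_eq_abs, Real.abs_exp, Real.exp_le_one_iff]
      have := symmExponent_nonneg (P := P) (X := X) (p.1 - p.2)
      have h0 : (0 : ℝ) ≤ t * (symmExponent P X (p.1 - p.2) / 2) := by positivity
      linarith
  refine le_trans ?_ hbound
  have hms := h.measurableSet_walk_eq t x
  rw [← smul_eq_mul, ← integral_indicator_const _ hms]
  refine integral_mono ((integrable_const _).indicator hms) ?_ fun ω => ?_
  · have hK : Measurable fun y : Fin d → ℤ =>
        ‖∫ θ, Complex.exp (pairing θ y * Complex.I) ∂ν‖ ^ 2 := measurable_of_countable _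
    refine Integrable.of_bound (C := ν.real Set.univ ^ 2) (hK.comp hwx).aestronglyMeasurable
      (ae_of_all _ fun ω => ?_)
    rw [Real.norm_of_nonneg (by positivity)]
    gcongr
    refine (norm_integral_le_of_norm_le_const (C := 1) (ae_of_all _ fun θ => ?_)).trans ?_
    · rw [Complex.norm_exp_ofReal_mul_I]
    · simp
  · by_cases hω : walk X t ω = x
    · rw [Set.indicator_of_mem (by exact hω), hω]
      simp [pairing]
    · rw [Set.indicator_of_notMem (by exact hω)]
      positivity

/-- Esseen's concentration inequality. -/
lemma IIDSteps.hitProb_mul_le_lintegral (h : IIDSteps P X) {ε : ℝ} (hε : 0 < ε) (t : ℕ)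
    (x : Fin d → ℤ) :
    hitProb P X t x * ENNReal.ofReal ε ^ d
      ≤ ∫⁻ θ in cube d ε, ENNReal.ofReal (Real.exp (-(t * (symmExponent P X θ / 2)))) := by
  set B : Set (Fin d → ℝ) := Set.univ.pi fun _ => Set.Icc 0 ε with hB
  have hBm : MeasurableSet B := MeasurableSet.univ_pi fun _ => measurableSet_Icc
  have hvol : volume B = ENNReal.ofReal ε ^ d := by
    rw [hB, volume_pi_pi]; simp
  have hBfin : volume B ≠ ∞ := by rw [hvol]; exact ENNReal.pow_ne_top ENNReal.ofReal_ne_top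
  have hB0 : volume B ≠ 0 := by
    rw [hvol]; exact pow_ne_zero _ (by simpa using hε)
  have : IsFiniteMeasure (volume.restrict B) := ⟨by
    rw [Measure.restrict_apply_univ]; exact hBfin.lt_top⟩
  set ν := volume.restrict B with hν
  set f : (Fin d → ℝ) → ℝ≥0∞ := fun θ =>
    ENNReal.ofReal (Real.exp (-(t * (symmExponent P X θ / 2)))) with hf
  have hfm : Measurable f := by
    have := h.measurable_symmExponent
    fun_prop
  have hreal := h.hitProb_mul_sq_le ν t x
  have hlint : hitProb P X t x * (volume B) ^ 2 ≤ ∫⁻ p, f (p.1 - p.2) ∂(ν.prod ν) := by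
    have h1 : ENNReal.ofReal (∫ p, Real.exp (-(t * (symmExponent P X (p.1 - p.2) / 2)))
        ∂(ν.prod ν)) ≤ ∫⁻ p, f (p.1 - p.2) ∂(ν.prod ν) := by
      refine (ENNReal.ofReal_le_ofReal (le_abs_self _)).trans ?_
      rw [← Real.norm_eq_abs]
      refine (ENNReal.ofReal_le_ofReal (norm_integral_le_lintegral_norm _)).trans ?_
      refine ENNReal.ofReal_toReal_le.trans (le_of_eq ?_)
      refine lintegral_congr fun p => ?_
      rw [Real.norm_of_nonneg (Real.exp_pos _).le]
    refine le_trans (le_of_eq ?_) ((ENNReal.ofReal_le_ofReal hreal).trans h1)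
    rw [ENNReal.ofReal_mul measureReal_nonneg, ENNReal.ofReal_pow measureReal_nonneg,
      measureReal_def, measureReal_def, ENNReal.ofReal_toReal (measure_ne_top _ _),
      ENNReal.ofReal_toReal (measure_ne_top _ _), hν, Measure.restrict_apply_univ]
    rfl
  -- Differences of points of `[0, ε]^d` lie in `cube d ε`, so translation invariance bounds the
  -- inner integral; the outer one gives one factor `volume B`, which cancels below.
  have hprod : ∫⁻ p, f (p.1 - p.2) ∂(ν.prod ν) ≤ volume B * ∫⁻ θ in cube d ε, f θ := by
    have hfm2 : Measurable fun p : (Fin d → ℝ) × (Fin d → ℝ) => f (p.1 - p.2) :=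
      hfm.comp (measurable_fst.sub measurable_snd)
    rw [lintegral_prod_symm' _ hfm2]
    calc ∫⁻ θ', ∫⁻ θ, f (θ - θ') ∂ν ∂ν ≤ ∫⁻ _, (∫⁻ θ in cube d ε, f θ) ∂ν := by
          refine setLIntegral_mono' hBm fun θ' hθ' => ?_
          calc ∫⁻ θ, f (θ - θ') ∂ν
              ≤ ∫⁻ θ in B, (cube d ε).indicator f (θ - θ') := by
                refine setLIntegral_mono' hBm fun θ hθ => ?_
                rw [Set.indicator_of_mem]
                intro i
                have h1 := hθ i (Set.mem_univ i)
                have h2 := hθ' i (Set.mem_univ i)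
                simp only [Set.mem_Icc] at h1 h2
                rw [Pi.sub_apply, abs_le]
                constructor <;> linarith
            _ ≤ ∫⁻ θ, (cube d ε).indicator f (θ - θ') := setLIntegral_le_lintegral _ _
            _ = ∫⁻ θ, (cube d ε).indicator f θ := lintegral_sub_right_eq_self _ _
            _ = _ := lintegral_indicator (measurableSet_cube ε) _
      _ = volume B * ∫⁻ θ in cube d ε, f θ := by
          rw [lintegral_const, hν, Measure.restrict_apply_univ, mul_comm]
  have hfinal := hlint.trans hprod
  rw [sq, ← mul_assoc, mul_comm _ (volume B)] at hfinal
  rw [← hvol]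
  exact (ENNReal.mul_le_mul_iff_right hB0 hBfin).1 hfinal

end SelfIntersection

/-! ### Gaussian integrals and lattice bases -/

namespace SelfIntersection

open Matrix in
lemma lintegral_gaussian_matrix {d : ℕ} {M : Matrix (Fin d) (Fin d) ℝ} (hM : M.det ≠ 0)
    {c : Fin d → ℝ} (hc : ∀ k, 0 < c k) :
    ∫⁻ θ : Fin d → ℝ, ENNReal.ofReal (Real.exp (-∑ k, c k * (M *ᵥ θ) k ^ 2))
      = ENNReal.ofReal (|M.det|⁻¹ * ∏ k, √(Real.pi / c k)) := by
  have hprod : ∀ η : Fin d → ℝ, Real.exp (-∑ k, c k * η k ^ 2)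
      = ∏ k, Real.exp (-c k * η k ^ 2) := by
    intro η
    rw [← Real.exp_sum, ← Finset.sum_neg_distrib]
    simp
  have hint : Integrable fun η : Fin d → ℝ => Real.exp (-∑ k, c k * η k ^ 2) := by
    simp_rw [hprod]
    exact Integrable.fintype_prod (f := fun k x => Real.exp (-c k * x ^ 2))
      fun k => integrable_exp_neg_mul_sq (hc k)
  have hval : ∫⁻ η : Fin d → ℝ, ENNReal.ofReal (Real.exp (-∑ k, c k * η k ^ 2))
      = ENNReal.ofReal (∏ k, √(Real.pi / c k)) := by
    rw [← ofReal_integral_eq_lintegral_ofReal hint (ae_of_all _ fun _ => (Real.exp_pos _).le)]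
    simp_rw [hprod]
    rw [integral_fintype_prod_volume_eq_prod fun k x => Real.exp (-c k * x ^ 2)]
    simp_rw [integral_gaussian]
  have hmeas : Measurable fun η : Fin d → ℝ =>
      ENNReal.ofReal (Real.exp (-∑ k, c k * η k ^ 2)) := by fun_prop
  have hlin : Measurable (Matrix.toLin' M) := (LinearMap.continuous_of_finiteDimensional _).measurable
  have hmap := Real.map_matrix_volume_pi_eq_smul_volume_pi hM
  have := lintegral_map (μ := volume) hmeas hlin
  rw [hmap, lintegral_smul_measure, hval] at this
  simp only [Matrix.toLin'_apply] at this
  rw [← this, smul_eq_mul, ENNReal.ofReal_mul (by positivity), abs_inv]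

/-- The matrix whose rows are the lattice vectors `y k`. -/
def rowMatrix {d : ℕ} (y : Fin d → Fin d → ℤ) : Matrix (Fin d) (Fin d) ℝ :=
  Matrix.of fun k i => (y k i : ℝ)

/-- The determinant obtained by replacing the `k`-th vector by `v`. -/
noncomputable def replaceDet {d : ℕ} (y : Fin d → Fin d → ℤ) (k : Fin d) (v : Fin d → ℤ) : ℝ :=
  (rowMatrix (Function.update y k v)).det

/-- The order `(t + 1)^(-d/2)` of the return probabilities. -/
noncomputable def decay (d t : ℕ) : ℝ := (√((t : ℝ) + 1))⁻¹ ^ d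

open Matrix in
lemma rowMatrix_mulVec {d : ℕ} (y : Fin d → Fin d → ℤ) (θ : Fin d → ℝ) (k : Fin d) :
    (rowMatrix y *ᵥ θ) k = pairing θ (y k) := by
  simp [Matrix.mulVec, dotProduct, rowMatrix, pairing, mul_comm]

lemma decay_pos (d t : ℕ) : 0 < decay d t := by unfold decay; positivity

lemma sqrt_div_le_decay {K : ℝ} (hK : 0 ≤ K) {t : ℕ} (ht : 1 ≤ t) :
    √(K / t) ≤ √(2 * K) * (√((t : ℝ) + 1))⁻¹ := by
  have ht' : (1 : ℝ) ≤ t := by exact_mod_cast ht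
  rw [← Real.sqrt_inv, ← Real.sqrt_mul (by positivity)]
  refine Real.sqrt_le_sqrt ?_
  rw [← div_eq_mul_inv, div_le_div_iff₀ (by positivity) (by positivity)]
  nlinarith

/-- A Gaussian bound for the integral of a quadratic form with one additional large direction. -/
lemma lintegral_exp_quadratic_le {d : ℕ} (y : Fin d → Fin d → ℤ) (k₀ : Fin d)
    (F : Finset (Fin d → ℤ)) {p : (Fin d → ℤ) → ℝ} (hp : ∀ v, 0 ≤ p v) {a b t : ℝ} (ha : 0 < a)
    (hb : 0 < b) (ht : 0 < t) (hA : 0 < ∑ v ∈ F, p v * replaceDet y k₀ v ^ 2) :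
    ∫⁻ θ : Fin d → ℝ, ENNReal.ofReal (Real.exp (-(t * (a * ∑ k, pairing θ (y k) ^ 2
        + b * ∑ v ∈ F, p v * pairing θ v ^ 2))))
      ≤ ENNReal.ofReal (√(Real.pi / (t * a)) ^ (d - 1)
        * √(Real.pi / (t * (b * ∑ v ∈ F, p v * replaceDet y k₀ v ^ 2)))) := by
  set A := ∑ v ∈ F, p v * replaceDet y k₀ v ^ 2 with hAdef
  -- The quadratic form is written as a `w`-average over `v` of forms in which `v` replaces `y k₀`.
  -- With weights proportional to `p v * replaceDet y k₀ v ^ 2`, the Jacobian of each Gaussian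
  -- cancels the determinant in `c v k₀`, so all `v` with nonzero determinant give the same
  -- integral.
  set w : (Fin d → ℤ) → ℝ := fun v => p v * replaceDet y k₀ v ^ 2 / A with hw
  have hw0 : ∀ v, 0 ≤ w v := fun v => div_nonneg (mul_nonneg (hp v) (sq_nonneg _)) hA.le
  have hw1 : ∑ v ∈ F, w v = 1 := by
    simp only [hw]
    rw [← Finset.sum_div, ← hAdef, div_self hA.ne']
  let c : (Fin d → ℤ) → Fin d → ℝ := fun v k =>
    if k = k₀ then t * (b * A) / replaceDet y k₀ v ^ 2 else t * a
  let g : (Fin d → ℤ) → (Fin d → ℝ) → ℝ := fun v θ =>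
    ∑ k, c v k * pairing θ (Function.update y k₀ v k) ^ 2
  have hg : ∀ v θ, g v θ = t * (b * A) / replaceDet y k₀ v ^ 2 * pairing θ v ^ 2
      + ∑ k ∈ Finset.univ.erase k₀, t * a * pairing θ (y k) ^ 2 := by
    intro v θ
    simp only [g]
    rw [← Finset.add_sum_erase _ _ (Finset.mem_univ k₀)]
    congr 1
    · simp [c]
    · refine Finset.sum_congr rfl fun k hk => ?_
      have hk' := Finset.ne_of_mem_erase hk
      simp [c, hk']
  have hpoint : ∀ θ : Fin d → ℝ, Real.exp (-(t * (a * ∑ k, pairing θ (y k) ^ 2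
        + b * ∑ v ∈ F, p v * pairing θ v ^ 2))) ≤ ∑ v ∈ F, w v * Real.exp (-g v θ) := by
    intro θ
    -- Jensen's inequality replaces the exponential of the average by the average of the
    -- exponentials, each a Gaussian in `d` independent directions.
    have hjensen := convexOn_exp.map_sum_le (t := F) (w := w) (p := fun v => -g v θ)
      (fun v _ => hw0 v) hw1 (fun v _ => Set.mem_univ _)
    simp only [smul_eq_mul] at hjensen
    refine le_trans (Real.exp_le_exp.2 ?_) hjensen
    simp only [mul_neg, Finset.sum_neg_distrib, neg_le_neg_iff, hg, mul_add]
    rw [Finset.sum_add_distrib, ← Finset.sum_mul, hw1, one_mul, add_comm]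
    refine add_le_add ?_ ?_
    · rw [Finset.mul_sum, Finset.mul_sum]
      refine (Finset.sum_le_sum_of_subset_of_nonneg (Finset.subset_univ (Finset.univ.erase k₀))
        fun k _ _ => by positivity).trans (le_of_eq ?_)
      exact Finset.sum_congr rfl fun k _ => by ring
    · have hsum : t * (b * ∑ v ∈ F, p v * pairing θ v ^ 2)
          = ∑ v ∈ F, t * (b * (p v * pairing θ v ^ 2)) := by simp only [Finset.mul_sum]
      rw [hsum]
      refine Finset.sum_le_sum fun v _ => ?_
      -- If `v` does not complete the other rows to a basis, its weight is zero.
      by_cases hv : replaceDet y k₀ v = 0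
      · simp only [hw, hv]
        have := hp v
        simp only [ne_eq, OfNat.ofNat_ne_zero, not_false_eq_true, zero_pow, mul_zero, zero_div,
          zero_mul]
        positivity
      · refine le_of_eq ?_
        simp only [hw]
        field_simp
  have hgauss : ∀ v ∈ F, ∫⁻ θ : Fin d → ℝ, ENNReal.ofReal (w v * Real.exp (-g v θ))
      ≤ ENNReal.ofReal (w v) * ENNReal.ofReal (√(Real.pi / (t * a)) ^ (d - 1)
        * √(Real.pi / (t * (b * A)))) := by
    intro v _
    simp_rw [ENNReal.ofReal_mul (hw0 v)]
    rw [lintegral_const_mul' _ _ ENNReal.ofReal_ne_top]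
    by_cases hv : replaceDet y k₀ v = 0
    · simp [hw, hv]
    gcongr
    have hc : ∀ k, 0 < c v k := by
      intro k
      simp only [c]
      split_ifs <;> positivity
    have := lintegral_gaussian_matrix (M := rowMatrix (Function.update y k₀ v)) hv hc
    simp only [rowMatrix_mulVec] at this
    rw [this]
    refine ENNReal.ofReal_le_ofReal (le_of_eq ?_)
    rw [← Finset.mul_prod_erase _ _ (Finset.mem_univ k₀)]
    have h1 : ∏ k ∈ Finset.univ.erase k₀, √(Real.pi / c v k) = √(Real.pi / (t * a)) ^ (d - 1) := by
      rw [Finset.prod_congr rfl fun k hk => by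
        rw [show c v k = t * a from if_neg (Finset.ne_of_mem_erase hk)]]
      rw [Finset.prod_const, Finset.card_erase_of_mem (Finset.mem_univ _)]
      simp
    have h2 : √(Real.pi / c v k₀) = |replaceDet y k₀ v| * √(Real.pi / (t * (b * A))) := by
      rw [← Real.sqrt_sq_eq_abs, ← Real.sqrt_mul (sq_nonneg _)]
      congr 1
      simp only [c, if_true]
      field_simp
    rw [h1, h2]
    change |replaceDet y k₀ v|⁻¹ * _ = _
    have : |replaceDet y k₀ v| ≠ 0 := abs_ne_zero.2 hv
    field_simp
  calc _ ≤ ∫⁻ θ : Fin d → ℝ, ∑ v ∈ F, ENNReal.ofReal (w v * Real.exp (-g v θ)) := by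
        refine lintegral_mono fun θ => ?_
        rw [← ENNReal.ofReal_sum_of_nonneg fun v _ => mul_nonneg (hw0 v) (Real.exp_pos _).le]
        exact ENNReal.ofReal_le_ofReal (hpoint θ)
    _ = ∑ v ∈ F, ∫⁻ θ : Fin d → ℝ, ENNReal.ofReal (w v * Real.exp (-g v θ)) := by
        refine lintegral_finsetSum _ fun v _ => ?_
        have : Measurable fun θ : Fin d → ℝ => g v θ := by
          simp only [g]
          exact Finset.measurable_sum _ fun k _ =>
            ((measurable_pairing_left _).pow_const 2).const_mul _
        fun_prop
    _ ≤ ∑ v ∈ F, ENNReal.ofReal (w v) * ENNReal.ofReal (√(Real.pi / (t * a)) ^ (d - 1)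
        * √(Real.pi / (t * (b * A)))) := Finset.sum_le_sum hgauss
    _ = _ := by
        rw [← Finset.sum_mul, ← ENNReal.ofReal_sum_of_nonneg fun v _ => hw0 v, hw1]
        simp

lemma exists_cube_pairing_le {d : ℕ} (F : Finset (Fin d → ℤ)) :
    ∃ ε : ℝ, 0 < ε ∧ ∀ θ ∈ cube d ε, ∀ y ∈ F, |pairing θ y| ≤ Real.pi := by
  set S : ℝ := ∑ y ∈ F, ∑ i, |(y i : ℝ)| with hS
  have hS0 : 0 ≤ S := Finset.sum_nonneg fun y _ => Finset.sum_nonneg fun i _ => abs_nonneg _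
  refine ⟨Real.pi / (1 + S), by positivity, fun θ hθ y hy => ?_⟩
  calc |pairing θ y| ≤ ∑ i, |θ i * (y i : ℝ)| := Finset.abs_sum_le_sum_abs _ _
    _ ≤ ∑ i, Real.pi / (1 + S) * |(y i : ℝ)| := by
        refine Finset.sum_le_sum fun i _ => ?_
        rw [abs_mul]
        gcongr
        exact hθ i
    _ = Real.pi / (1 + S) * ∑ i, |(y i : ℝ)| := by rw [Finset.mul_sum]
    _ ≤ Real.pi / (1 + S) * (1 + S) := by
        gcongr
        have := Finset.single_le_sum (f := fun y : Fin d → ℤ => ∑ i, |(y i : ℝ)|)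
          (fun y _ => Finset.sum_nonneg fun i _ => abs_nonneg _) hy
        simp only [← hS] at this
        linarith
    _ = Real.pi := by field_simp

lemma sum_mul_sq_le {ι κ : Type*} [Fintype ι] [Fintype κ] (B : ι → κ → ℝ) :
    ∃ K : ℝ, 0 < K ∧ ∀ v : κ → ℝ, ∀ i, (∑ k, B i k * v k) ^ 2 ≤ K * ∑ k, v k ^ 2 := by
  refine ⟨1 + ∑ i, ∑ k, B i k ^ 2, by positivity, fun v i => ?_⟩
  refine (Finset.sum_mul_sq_le_sq_mul_sq _ _ _).trans ?_
  gcongr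
  have := Finset.single_le_sum (f := fun i => ∑ k, B i k ^ 2)
    (fun i _ => Finset.sum_nonneg fun k _ => sq_nonneg _) (Finset.mem_univ i)
  linarith

open Matrix in
-- The inverse matrix recovers `θ` from its pairings. Away from the origin this bounds the quadratic
-- form from below.
lemma sq_le_mul_sum_pairing_sq {d : ℕ} {y : Fin d → Fin d → ℤ} (hy : (rowMatrix y).det ≠ 0) :
    ∃ K : ℝ, 0 < K ∧ ∀ θ : Fin d → ℝ, ∀ i, θ i ^ 2 ≤ K * ∑ k, pairing θ (y k) ^ 2 := by
  obtain ⟨K, hK, h⟩ := sum_mul_sq_le ((rowMatrix y)⁻¹ : Matrix (Fin d) (Fin d) ℝ)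
  refine ⟨K, hK, fun θ i => ?_⟩
  have h1 := h (rowMatrix y *ᵥ θ) i
  simp only [rowMatrix_mulVec] at h1
  refine le_trans (le_of_eq ?_) h1
  have h2 : (rowMatrix y)⁻¹ *ᵥ (rowMatrix y *ᵥ θ) = θ := by
    rw [mulVec_mulVec, nonsing_inv_mul _ (isUnit_iff_ne_zero.2 hy), one_mulVec]
  have h3 := congrFun h2 i
  rw [← h3]
  simp only [mulVec, dotProduct, ← rowMatrix_mulVec]

open Matrix in
-- By Cramer's rule the numbers `replaceDet y k v`, divided by the determinant, are the coordinates
-- of `v` in the basis `y`.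
lemma sq_le_mul_sum_replaceDet_sq {d : ℕ} {y : Fin d → Fin d → ℤ} (hy : (rowMatrix y).det ≠ 0) :
    ∃ K : ℝ, 0 < K ∧ ∀ v : Fin d → ℤ, ∀ i, (v i : ℝ) ^ 2 ≤ K * ∑ k, replaceDet y k v ^ 2 := by
  set N := rowMatrix y with hN
  obtain ⟨K, hK, h⟩ := sum_mul_sq_le fun i k => N.det⁻¹ * N k i
  refine ⟨K, hK, fun v i => ?_⟩
  refine le_trans (le_of_eq ?_) (h (fun k => replaceDet y k v) i)
  have h1 : ∀ k, replaceDet y k v = cramer Nᵀ (fun i => (v i : ℝ)) k := by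
    intro k
    rw [cramer_transpose_apply, replaceDet]
    congr 1
    ext l j
    by_cases hl : l = k
    · subst hl; simp [rowMatrix]
    · simp [rowMatrix, hl, hN]
  have h2 := congrFun (mulVec_cramer Nᵀ (fun i => (v i : ℝ))) i
  simp only [mulVec, dotProduct, transpose_apply, det_transpose, Pi.smul_apply, smul_eq_mul] at h2
  simp only [h1, mul_assoc]
  rw [← Finset.mul_sum, h2, inv_mul_cancel_left₀ hy]

end SelfIntersection

/-! ### Decay of hitting probabilities -/

namespace SelfIntersection

variable {Ω : Type*} [MeasurableSpace Ω] {d : ℕ} {P : Measure Ω} {X : ℕ → Ω → (Fin d → ℤ)}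

/-- The probability that two independent steps differ by `v`. -/
noncomputable def diffProb (P : Measure Ω) (X : ℕ → Ω → (Fin d → ℤ)) (v : Fin d → ℤ) : ℝ :=
  P.real {ω | X 0 ω - X 1 ω = v}

lemma diffProb_nonneg (v : Fin d → ℤ) : 0 ≤ diffProb P X v := measureReal_nonneg

lemma GenuinelyDimensional.exists_rowMatrix [IsProbabilityMeasure P]
    (h : GenuinelyDimensional P X) :
    ∃ y : Fin d → Fin d → ℤ, (rowMatrix y).det ≠ 0 ∧ ∀ k, 0 < diffProb P X (y k) := by
  obtain ⟨b, hbS, hbspan, hbind⟩ := exists_linearIndependent ℝ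
    (toEuclidean '' supp P (fun ω => X 0 ω - X 1 ω))
  unfold GenuinelyDimensional at h
  rw [h] at hbspan
  let B : Module.Basis b ℝ (EuclideanSpace ℝ (Fin d)) :=
    Module.Basis.mk hbind (by rw [Subtype.range_coe, hbspan])
  have : Fintype b := FiniteDimensional.fintypeBasisIndex B
  have hcard : Fintype.card b = d := by
    rw [← Module.finrank_eq_card_basis B, finrank_euclideanSpace_fin]
  let e : Fin d ≃ b := (Fintype.equivFinOfCardEq hcard).symm
  choose y hy hyb using fun k => hbS (e k).2
  refine ⟨y, ?_, fun k => ?_⟩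
  · have hli : LinearIndependent ℝ fun k => toEuclidean (y k) := by
      simp_rw [hyb]
      exact hbind.comp e e.injective
    have hli' := hli.map' (WithLp.linearEquiv 2 ℝ (Fin d → ℝ)).toLinearMap
      (LinearEquiv.ker _)
    have hrow : LinearIndependent ℝ (rowMatrix y).row := hli'
    rw [Matrix.linearIndependent_rows_iff_isUnit, Matrix.isUnit_iff_isUnit_det] at hrow
    exact hrow.ne_zero
  · exact ENNReal.toReal_pos (hy k).ne' (measure_ne_top _ _)

lemma rowMatrix_injective {y : Fin d → Fin d → ℤ} (hy : (rowMatrix y).det ≠ 0) :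
    Function.Injective y := by
  intro k l hkl
  by_contra hne
  exact hy (Matrix.det_zero_of_row_eq hne (by ext i; simp [rowMatrix, hkl]))

lemma hitProb_le_of_mul_le {t : ℕ} {z : Fin d → ℤ} {ε B : ℝ} (hε : 0 < ε)
    (hle : hitProb P X t z * ENNReal.ofReal ε ^ d ≤ ENNReal.ofReal B) :
    hitProb P X t z ≤ ENNReal.ofReal (B / ε ^ d) := by
  rw [ENNReal.ofReal_div_of_pos (by positivity), ENNReal.ofReal_pow hε.le]
  rw [ENNReal.le_div_iff_mul_le]
  · exact hle
  · left; exact pow_ne_zero _ (by simpa using hε)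
  · left; exact ENNReal.pow_ne_top ENNReal.ofReal_ne_top

variable [IsProbabilityMeasure P]

/-- Only the atoms `y k` of the symmetrised step are kept; `c` comes from the smallest of their
probabilities. -/
lemma IIDSteps.exists_quadratic_le_symmExponent (h : IIDSteps P X) {y : Fin d → Fin d → ℤ}
    (hy : (rowMatrix y).det ≠ 0) (hp : ∀ k, 0 < diffProb P X (y k)) :
    ∃ c ε : ℝ, 0 < c ∧ 0 < ε ∧ ∀ θ ∈ cube d ε,
      c * ∑ k, pairing θ (y k) ^ 2 ≤ symmExponent P X θ := by
  classical
  obtain ⟨ε, hε, hcube⟩ := exists_cube_pairing_le (Finset.univ.image y)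
  obtain ⟨c, hc, hcle⟩ : ∃ c : ℝ, 0 < c ∧ ∀ k, c ≤ diffProb P X (y k) := by
    rcases isEmpty_or_nonempty (Fin d) with hd | hd
    · exact ⟨1, one_pos, fun k => hd.elim k⟩
    · obtain ⟨k0, hk0⟩ := Finite.exists_min fun k => diffProb P X (y k)
      exact ⟨_, hp k0, hk0⟩
  refine ⟨2 / Real.pi ^ 2 * c, ε, by positivity, hε, fun θ hθ => ?_⟩
  refine le_trans ?_ (h.symmExponent_ge (Finset.univ.image y) (hcube θ hθ))
  rw [Finset.sum_image fun k _ l _ hkl => rowMatrix_injective hy hkl, Finset.mul_sum]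
  refine Finset.sum_le_sum fun k _ => ?_
  gcongr
  exact hcle k

/-- The walk spreads out at least as fast as `(t + 1)^(d/2)`. -/
theorem IIDSteps.exists_hitProb_le_decay (h : IIDSteps P X) (hdim : GenuinelyDimensional P X) :
    ∃ C : ℝ, 0 < C ∧ ∀ t z, hitProb P X t z ≤ ENNReal.ofReal (C * decay d t) := by
  obtain ⟨y, hy, hp⟩ := hdim.exists_rowMatrix
  obtain ⟨c, ε, hc, hε, hquad⟩ := h.exists_quadratic_le_symmExponent hy hp
  set K : ℝ := Real.pi / (c / 2) with hK
  have hK0 : 0 < K := by positivity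
  set C : ℝ := |(rowMatrix y).det|⁻¹ * √(2 * K) ^ d / ε ^ d with hC
  have hC0 : 0 < C := by positivity
  -- The summand 1 covers `t = 0`, where `decay d 0 = 1`.
  refine ⟨C + 1, by positivity, fun t z => ?_⟩
  rcases Nat.eq_zero_or_pos t with rfl | ht
  · refine (hitProb_le_one 0 z).trans ?_
    rw [← ENNReal.ofReal_one]
    refine ENNReal.ofReal_le_ofReal ?_
    simp only [decay, Nat.cast_zero, zero_add, Real.sqrt_one, inv_one, one_pow, mul_one]
    linarith
  have ht' : (0 : ℝ) < t := by exact_mod_cast ht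
  have hmain : hitProb P X t z * ENNReal.ofReal ε ^ d
      ≤ ENNReal.ofReal (|(rowMatrix y).det|⁻¹ * ∏ _k : Fin d, √(Real.pi / (t * (c / 2)))) := by
    refine (h.hitProb_mul_le_lintegral hε t z).trans ?_
    rw [← lintegral_gaussian_matrix hy fun _ => by positivity]
    refine le_trans ?_ (setLIntegral_le_lintegral (cube d ε) _)
    refine setLIntegral_mono' (measurableSet_cube ε) fun θ hθ => ?_
    refine ENNReal.ofReal_le_ofReal (Real.exp_le_exp.2 ?_)
    simp only [rowMatrix_mulVec]
    rw [neg_le_neg_iff, ← Finset.mul_sum, mul_assoc]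
    gcongr
    linarith [hquad θ hθ]
  refine (hitProb_le_of_mul_le hε hmain).trans (ENNReal.ofReal_le_ofReal ?_)
  have hdec : ∏ _k : Fin d, √(Real.pi / (t * (c / 2))) ≤ √(2 * K) ^ d * decay d t := by
    rw [Finset.prod_const, Finset.card_univ, Fintype.card_fin, decay, ← mul_pow]
    gcongr
    refine le_trans (le_of_eq ?_) (sqrt_div_le_decay hK0.le ht)
    congr 1
    rw [hK]
    field_simp
  calc |(rowMatrix y).det|⁻¹ * (∏ _k : Fin d, √(Real.pi / (t * (c / 2)))) / ε ^ d
      ≤ |(rowMatrix y).det|⁻¹ * (√(2 * K) ^ d * decay d t) / ε ^ d := by gcongr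
    _ = C * decay d t := by rw [hC]; ring
    _ ≤ (C + 1) * decay d t := by
        gcongr
        · exact (decay_pos d t).le
        · linarith

lemma volume_cube_lt_top (ε : ℝ) : volume (cube d ε) < ∞ := by
  have hsub : cube d ε ⊆ Set.univ.pi fun _ => Set.Icc (-ε) ε := fun θ hθ i _ => by
    have := abs_le.1 (hθ i)
    exact ⟨this.1, this.2⟩
  refine (measure_mono hsub).trans_lt ?_
  rw [volume_pi_pi]
  exact ENNReal.prod_lt_top fun i _ => by simp

lemma eventually_exp_neg_le_decay (d : ℕ) (V : ℝ) {κ δ : ℝ} (hκ : 0 < κ) (hδ : 0 < δ) :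
    ∀ᶠ t : ℕ in atTop, V * Real.exp (-(t * κ)) ≤ δ * decay d t := by
  have h1 : Tendsto (fun x : ℝ => x ^ d * Real.exp (-x)) atTop (nhds 0) :=
    Real.tendsto_pow_mul_exp_neg_atTop_nhds_zero d
  have h2 : Tendsto (fun t : ℕ => ((t : ℝ) + 1) * κ) atTop atTop :=
    (tendsto_atTop_add_const_right _ 1 tendsto_natCast_atTop_atTop).atTop_mul_const hκ
  have h3 := (h1.comp h2).const_mul (|V| * Real.exp κ * (κ⁻¹) ^ d)
  rw [mul_zero] at h3
  filter_upwards [h3.eventually_lt_const hδ] with t ht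
  simp only [Function.comp_apply] at ht
  have hsq : (1 : ℝ) ≤ √((t : ℝ) + 1) := by
    rw [Real.one_le_sqrt]; linarith [(Nat.cast_nonneg t : (0 : ℝ) ≤ t)]
  have hsqle : √((t : ℝ) + 1) ≤ (t : ℝ) + 1 := by
    have := Real.mul_self_sqrt (by positivity : (0 : ℝ) ≤ (t : ℝ) + 1)
    nlinarith
  have hpow : √((t : ℝ) + 1) ^ d ≤ ((t : ℝ) + 1) ^ d := by gcongr
  rw [decay, inv_pow, ← div_eq_mul_inv, le_div_iff₀ (by positivity)]
  have hexp : Real.exp κ * Real.exp (-(((t : ℝ) + 1) * κ)) = Real.exp (-(t * κ)) := by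
    rw [← Real.exp_add]; ring_nf
  have heq : |V| * Real.exp κ * κ⁻¹ ^ d * ((((t : ℝ) + 1) * κ) ^ d
      * Real.exp (-(((t : ℝ) + 1) * κ))) = |V| * Real.exp (-(t * κ)) * ((t : ℝ) + 1) ^ d := by
    rw [← hexp, mul_pow, inv_pow]
    field_simp
  rw [heq] at ht
  refine le_trans ?_ ht.le
  gcongr
  exact le_abs_self V

/-- If the symmetrised step has an infinite second moment in some direction, the walk spreads out
faster than `(t + 1)^(d/2)`. -/
theorem IIDSteps.eventually_hitProb_le_of_tsum_eq_top (h : IIDSteps P X)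
    {y : Fin d → Fin d → ℤ} (hy : (rowMatrix y).det ≠ 0) (hp : ∀ k, 0 < diffProb P X (y k))
    {k₀ : Fin d}
    (htop : ∑' v, ENNReal.ofReal (diffProb P X v * replaceDet y k₀ v ^ 2) = ∞) {δ : ℝ}
    (hδ : 0 < δ) :
    ∀ᶠ t in atTop, ∀ z, hitProb P X t z ≤ ENNReal.ofReal (δ * decay d t) := by
  obtain ⟨c, ε, hc, hε, hquad⟩ := h.exists_quadratic_le_symmExponent hy hp
  -- Half of `symmExponent / 2` is spent on the basis form, half on the form over the finite set
  -- `F`; hence the quarters.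
  set a : ℝ := c / 4 with ha
  set b : ℝ := 2 / Real.pi ^ 2 / 4 with hb
  have ha0 : 0 < a := by positivity
  have hb0 : 0 < b := by positivity
  set Ka : ℝ := √(2 * (Real.pi / a)) ^ (d - 1) with hKa
  -- The factor `ε ^ d` is that of Esseen's inequality, and the 2 is for the near and the far
  -- region.
  set δ' : ℝ := δ * ε ^ d / 2 with hδ'
  have hδ'0 : 0 < δ' := by positivity
  have hlim : Tendsto (fun A : ℝ => Ka * √(2 * (Real.pi / (b * A)))) atTop (nhds 0) := by
    have h1 : Tendsto (fun A : ℝ => 2 * (Real.pi / (b * A))) atTop (nhds (2 * 0)) :=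
      (Tendsto.div_atTop tendsto_const_nhds (tendsto_id.const_mul_atTop hb0)).const_mul 2
    have h2 := (Real.continuous_sqrt.tendsto _).comp h1
    have h3 := h2.const_mul Ka
    simpa using h3
  obtain ⟨A₀, hA₀⟩ := (hlim.eventually_lt_const hδ'0).exists_forall_of_atTop
  -- Divergence supplies finitely many atoms with truncated moment `A` large enough for the Gaussian
  -- bound; the radius `ε'` on which these atoms may be used is chosen only afterwards.
  obtain ⟨F, hF⟩ : ∃ F : Finset (Fin d → ℤ),
      max A₀ 1 ≤ ∑ v ∈ F, diffProb P X v * replaceDet y k₀ v ^ 2 := by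
    have h1 : ENNReal.ofReal (max A₀ 1)
        < ∑' v, ENNReal.ofReal (diffProb P X v * replaceDet y k₀ v ^ 2) := by
      rw [htop]; exact ENNReal.ofReal_lt_top
    rw [ENNReal.tsum_eq_iSup_sum] at h1
    obtain ⟨F, hF⟩ := lt_iSup_iff.1 h1
    refine ⟨F, ?_⟩
    rw [← ENNReal.ofReal_sum_of_nonneg fun v _ => mul_nonneg (diffProb_nonneg v) (sq_nonneg _)] at hF
    exact (ENNReal.ofReal_lt_ofReal_iff_of_nonneg (by positivity)).1 hF |>.le
  set A := ∑ v ∈ F, diffProb P X v * replaceDet y k₀ v ^ 2 with hA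
  have hA0 : 0 < A := lt_of_lt_of_le (by positivity) hF
  obtain ⟨ε', hε', hcube'⟩ := exists_cube_pairing_le F
  obtain ⟨K, hK, hKle⟩ := sq_le_mul_sum_pairing_sq hy
  set κ : ℝ := c / 2 * (ε' ^ 2 / K) with hκ
  have hκ0 : 0 < κ := by positivity
  set V := (volume (cube d ε)).toReal
  filter_upwards [eventually_exp_neg_le_decay d V hκ0 hδ'0, eventually_ge_atTop 1] with t ht1 ht z
  have ht' : (0 : ℝ) < t := by exact_mod_cast ht
  set f : (Fin d → ℝ) → ℝ≥0∞ := fun θ =>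
    ENNReal.ofReal (Real.exp (-(t * (symmExponent P X θ / 2)))) with hf
  -- Outside the small cube only the basis form is available, but there it is bounded below, so the
  -- contribution is exponentially small in `t`.
  have hfar : ∫⁻ θ in cube d ε \ cube d ε', f θ ≤ ENNReal.ofReal (δ' * decay d t) := by
    calc ∫⁻ θ in cube d ε \ cube d ε', f θ
        ≤ ∫⁻ _θ in cube d ε \ cube d ε', ENNReal.ofReal (Real.exp (-(t * κ))) := by
          refine setLIntegral_mono' ((measurableSet_cube ε).diff (measurableSet_cube ε'))
            fun θ hθ => ?_
          refine ENNReal.ofReal_le_ofReal (Real.exp_le_exp.2 ?_)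
          rw [neg_le_neg_iff]
          gcongr
          have h1 := hquad θ hθ.1
          obtain ⟨i, hi⟩ : ∃ i, ε' < |θ i| := by
            by_contra hcon
            push Not at hcon
            exact hθ.2 hcon
          have h2 : ε' ^ 2 ≤ θ i ^ 2 := by
            rw [← sq_abs (θ i)]; gcongr
          have h3 : ε' ^ 2 / K ≤ ∑ k, pairing θ (y k) ^ 2 := by
            rw [div_le_iff₀ hK, mul_comm]
            exact h2.trans (hKle θ i)
          rw [hκ]
          nlinarith
      _ ≤ ENNReal.ofReal (Real.exp (-(t * κ))) * volume (cube d ε) := by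
          rw [setLIntegral_const]
          gcongr
          exact Set.sdiff_subset
      _ = ENNReal.ofReal (V * Real.exp (-(t * κ))) := by
          rw [ENNReal.ofReal_mul ENNReal.toReal_nonneg,
            ENNReal.ofReal_toReal (volume_cube_lt_top ε).ne, mul_comm]
      _ ≤ _ := ENNReal.ofReal_le_ofReal ht1
  have hnear : ∫⁻ θ in cube d ε ∩ cube d ε', f θ ≤ ENNReal.ofReal (δ' * decay d t) := by
    calc ∫⁻ θ in cube d ε ∩ cube d ε', f θ
        ≤ ∫⁻ θ in cube d ε ∩ cube d ε', ENNReal.ofReal (Real.exp (-(t * (a * ∑ k,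
            pairing θ (y k) ^ 2 + b * ∑ v ∈ F, diffProb P X v * pairing θ v ^ 2)))) := by
          refine setLIntegral_mono' ((measurableSet_cube ε).inter (measurableSet_cube ε'))
            fun θ hθ => ?_
          refine ENNReal.ofReal_le_ofReal (Real.exp_le_exp.2 ?_)
          rw [neg_le_neg_iff]
          gcongr
          have h1 := hquad θ hθ.1
          have h2 := h.symmExponent_ge F (hcube' θ hθ.2)
          simp_rw [mul_assoc] at h2
          rw [← Finset.mul_sum] at h2
          change 2 / Real.pi ^ 2 * ∑ v ∈ F, diffProb P X v * pairing θ v ^ 2 ≤ _ at h2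
          rw [ha, hb]
          linarith
      _ ≤ _ := setLIntegral_le_lintegral _ _
      _ ≤ ENNReal.ofReal (√(Real.pi / (t * a)) ^ (d - 1) * √(Real.pi / (t * (b * A)))) :=
          lintegral_exp_quadratic_le y k₀ F (fun v => diffProb_nonneg v) ha0 hb0 ht' hA0
      _ ≤ _ := by
          refine ENNReal.ofReal_le_ofReal ?_
          have hd : d - 1 + 1 = d := Nat.succ_pred_eq_of_pos k₀.pos
          have e1 : √(Real.pi / (t * a)) ≤ √(2 * (Real.pi / a)) * (√((t : ℝ) + 1))⁻¹ := by
            refine le_trans (le_of_eq ?_) (sqrt_div_le_decay (K := Real.pi / a) (by positivity) ht)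
            congr 1
            field_simp
          have e2 : √(Real.pi / (t * (b * A)))
              ≤ √(2 * (Real.pi / (b * A))) * (√((t : ℝ) + 1))⁻¹ := by
            refine le_trans (le_of_eq ?_)
              (sqrt_div_le_decay (K := Real.pi / (b * A)) (by positivity) ht)
            congr 1
            field_simp
          have e3 : Ka * √(2 * (Real.pi / (b * A))) ≤ δ' :=
            (hA₀ A ((le_max_left _ _).trans hF)).le
          calc √(Real.pi / (t * a)) ^ (d - 1) * √(Real.pi / (t * (b * A)))
              ≤ (√(2 * (Real.pi / a)) * (√((t : ℝ) + 1))⁻¹) ^ (d - 1)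
                * (√(2 * (Real.pi / (b * A))) * (√((t : ℝ) + 1))⁻¹) := by gcongr
            _ = Ka * √(2 * (Real.pi / (b * A))) * (√((t : ℝ) + 1))⁻¹ ^ (d - 1 + 1) := by
                rw [hKa, mul_pow, pow_succ]; ring
            _ = Ka * √(2 * (Real.pi / (b * A))) * decay d t := by rw [hd, decay]
            _ ≤ δ' * decay d t := by
                gcongr
                exact (decay_pos d t).le
  have hmain : hitProb P X t z * ENNReal.ofReal ε ^ d
      ≤ ENNReal.ofReal (2 * δ' * decay d t) := by
    refine (h.hitProb_mul_le_lintegral hε t z).trans ?_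
    rw [← lintegral_inter_add_sdiff (μ := volume) f (cube d ε) (measurableSet_cube ε')]
    refine (add_le_add hnear hfar).trans (le_of_eq ?_)
    have := (decay_pos d t).le
    rw [← ENNReal.ofReal_add (by positivity) (by positivity)]
    congr 1; ring
  refine (hitProb_le_of_mul_le hε hmain).trans (ENNReal.ofReal_le_ofReal (le_of_eq ?_))
  rw [hδ']
  field_simp

end SelfIntersection

/-! ### Small return probabilities without centring or second moment -/

namespace SelfIntersection

variable {Ω : Type*} [MeasurableSpace Ω] {d : ℕ} {P : Measure Ω} {X : ℕ → Ω → (Fin d → ℤ)}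

lemma enorm_toEuclidean_sq (v : Fin d → ℤ) :
    ‖toEuclidean v‖ₑ ^ 2 = ENNReal.ofReal (∑ i, (v i : ℝ) ^ 2) := by
  rw [← ofReal_norm, ← ENNReal.ofReal_pow (norm_nonneg _), EuclideanSpace.norm_sq_eq]
  simp [toEuclidean]

lemma toEuclidean_add (v w : Fin d → ℤ) :
    toEuclidean (v + w) = toEuclidean v + toEuclidean w := by
  ext i; simp [toEuclidean]

open scoped Classical in
lemma IIDSteps.tsum_ite_hitProb (h : IIDSteps P X) (t : ℕ) (B : Set (Fin d → ℤ)) :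
    ∑' z, (if z ∈ B then hitProb P X t z else 0) = P {ω | walk X t ω ∈ B} := by
  have h1 : ∀ z, (if z ∈ B then hitProb P X t z else 0)
      = P ({ω | walk X t ω = z} ∩ {ω | walk X t ω ∈ B}) := by
    intro z
    split_ifs with hz
    · rw [hitProb]
      congr 1
      ext ω
      simp only [Set.mem_inter_iff, Set.mem_ofPred_eq]
      exact ⟨fun h' => ⟨h', h' ▸ hz⟩, fun h' => h'.1⟩
    · rw [← measure_empty (μ := P)]
      congr 1
      ext ω
      simp only [Set.mem_inter_iff, Set.mem_ofPred_eq, Set.mem_empty_iff_false, false_iff]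
      rintro ⟨h2, h3⟩
      exact hz (h2 ▸ h3)
  simp_rw [h1]
  rw [← measure_iUnion]
  · congr 1
    ext ω; simp
  · intro a b hab
    exact Set.disjoint_left.2 fun ω h1 h2 => hab (h1.1.symm.trans h2.1)
  · exact fun z => (h.measurableSet_walk_eq _ _).inter (h.measurable_walk t B.to_countable.measurableSet)

variable [IsProbabilityMeasure P]

lemma exists_measure_eq_pos (Y : Ω → Fin d → ℤ) :
    ∃ x, P {ω | Y ω = x} ≠ 0 := by
  by_contra! hcon
  have h0 : P (⋃ x, {ω | Y ω = x}) = 0 := measure_iUnion_null hcon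
  have hu : (⋃ x, {ω | Y ω = x}) = Set.univ := by ext ω; simp
  rw [hu, measure_univ] at h0
  exact one_ne_zero h0

/-- A finite second moment of the symmetrised step yields one of the step. -/
lemma IIDSteps.lintegral_sq_lt_top_of_diff (h : IIDSteps P X)
    (hfin : ∫⁻ ω, ‖toEuclidean (X 0 ω - X 1 ω)‖ₑ ^ 2 ∂P < ∞) :
    ∫⁻ ω, ‖toEuclidean (X 0 ω)‖ₑ ^ 2 ∂P < ∞ := by
  -- On the event `X 1 = x`, of positive probability and independent of `X 0`, the difference is `X
  -- 0 - x`.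
  obtain ⟨x, hx⟩ := exists_measure_eq_pos (P := P) (X 1)
  have hm0 : Measurable fun v : Fin d → ℤ => ‖toEuclidean (v - x)‖ₑ ^ 2 := measurable_of_countable _
  have hm1 : Measurable (({x} : Set (Fin d → ℤ)).indicator fun _ => (1 : ℝ≥0∞)) :=
    measurable_of_countable _
  have hind := (h.indep.indepFun (i := 0) (j := 1) (by simp)).comp hm0 hm1
  have hmul := lintegral_mul_eq_lintegral_mul_lintegral_of_indepFun
    (hm0.comp (h.measurable 0)) (hm1.comp (h.measurable 1)) hind
  have hone : ∫⁻ ω, ((({x} : Set (Fin d → ℤ)).indicator fun _ => (1 : ℝ≥0∞)) ∘ X 1) ω ∂P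
      = P {ω | X 1 ω = x} := by
    have : ((({x} : Set (Fin d → ℤ)).indicator fun _ => (1 : ℝ≥0∞)) ∘ X 1)
        = {ω | X 1 ω = x}.indicator fun _ => 1 := by
      ext ω
      by_cases hω : X 1 ω = x <;> simp [hω]
    have hms : MeasurableSet {ω | X 1 ω = x} := h.measurable 1 (measurableSet_singleton x)
    rw [this, lintegral_indicator_const hms, one_mul]
  have hle : ∫⁻ ω, (((fun v : Fin d → ℤ => ‖toEuclidean (v - x)‖ₑ ^ 2) ∘ X 0)
      * ((({x} : Set (Fin d → ℤ)).indicator fun _ => (1 : ℝ≥0∞)) ∘ X 1)) ω ∂P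
      ≤ ∫⁻ ω, ‖toEuclidean (X 0 ω - X 1 ω)‖ₑ ^ 2 ∂P := by
    refine lintegral_mono fun ω => ?_
    by_cases hω : X 1 ω = x <;> simp [hω]
  rw [hmul, hone] at hle
  have hshift : ∫⁻ ω, ‖toEuclidean (X 0 ω - x)‖ₑ ^ 2 ∂P < ∞ := by
    by_contra hcon
    rw [not_lt, top_le_iff] at hcon
    have : (∫⁻ ω, ((fun v : Fin d → ℤ => ‖toEuclidean (v - x)‖ₑ ^ 2) ∘ X 0) ω ∂P) = ∞ := hcon
    rw [this, ENNReal.top_mul hx] at hle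
    exact hfin.ne (top_le_iff.1 hle)
  have hbound : ∀ ω, ‖toEuclidean (X 0 ω)‖ₑ ^ 2
      ≤ 2 * ‖toEuclidean (X 0 ω - x)‖ₑ ^ 2 + 2 * ‖toEuclidean x‖ₑ ^ 2 := by
    intro ω
    have h1 : toEuclidean (X 0 ω) = toEuclidean (X 0 ω - x) + toEuclidean x := by
      rw [← toEuclidean_add, sub_add_cancel]
    rw [h1]
    set u := toEuclidean (X 0 ω - x)
    set v := toEuclidean x
    have h2 : ‖u + v‖ ^ 2 ≤ 2 * ‖u‖ ^ 2 + 2 * ‖v‖ ^ 2 := by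
      have := norm_add_le u v
      nlinarith [norm_nonneg (u + v), norm_nonneg u, norm_nonneg v, sq_nonneg (‖u‖ - ‖v‖)]
    have h3 := ENNReal.ofReal_le_ofReal h2
    rw [ENNReal.ofReal_add (by positivity) (by positivity), ENNReal.ofReal_mul (by norm_num),
      ENNReal.ofReal_mul (by norm_num), ENNReal.ofReal_pow (norm_nonneg _),
      ENNReal.ofReal_pow (norm_nonneg _), ENNReal.ofReal_pow (norm_nonneg _), ofReal_norm,
      ofReal_norm, ofReal_norm] at h3
    simpa using h3
  refine (lintegral_mono hbound).trans_lt ?_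
  have hmX : Measurable fun ω => ‖toEuclidean (X 0 ω - x)‖ₑ ^ 2 := hm0.comp (h.measurable 0)
  rw [lintegral_add_left (hmX.const_mul 2), lintegral_const_mul _ hmX]
  refine ENNReal.add_lt_top.2 ⟨ENNReal.mul_lt_top (by simp) hshift, ?_⟩
  rw [lintegral_const, measure_univ, mul_one]
  exact ENNReal.mul_lt_top (by simp) (by simp [enorm_toEuclidean_sq])

/-- If all coordinates in the basis `y` had finite second moments under the symmetrised step, so
would that step, and hence `X 0`. -/
lemma IIDSteps.exists_tsum_eq_top (h : IIDSteps P X) {y : Fin d → Fin d → ℤ}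
    (hy : (rowMatrix y).det ≠ 0) (hinf : ∫⁻ ω, ‖toEuclidean (X 0 ω)‖ₑ ^ 2 ∂P = ∞) :
    ∃ k, ∑' v, ENNReal.ofReal (diffProb P X v * replaceDet y k v ^ 2) = ∞ := by
  by_contra! hcon
  refine (h.lintegral_sq_lt_top_of_diff ?_).ne hinf
  obtain ⟨K, hK, hKle⟩ := sq_le_mul_sum_replaceDet_sq hy
  have hm : Measurable fun v : Fin d → ℤ => ‖toEuclidean v‖ₑ ^ 2 := measurable_of_countable _
  have h1 : ∫⁻ ω, ‖toEuclidean (X 0 ω - X 1 ω)‖ₑ ^ 2 ∂P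
      = ∑' v, ‖toEuclidean v‖ₑ ^ 2 * P {ω | X 0 ω - X 1 ω = v} := by
    rw [← lintegral_map hm h.measurable_diff, lintegral_countable']
    refine tsum_congr fun v => ?_
    rw [Measure.map_apply h.measurable_diff (measurableSet_singleton v)]
    rfl
  have h2 : ∀ v, ‖toEuclidean v‖ₑ ^ 2 * P {ω | X 0 ω - X 1 ω = v}
      ≤ ENNReal.ofReal (d * K) * ∑ k, ENNReal.ofReal (diffProb P X v * replaceDet y k v ^ 2) := by
    intro v
    rw [enorm_toEuclidean_sq, ← ENNReal.ofReal_sum_of_nonneg fun k _ =>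
      mul_nonneg (diffProb_nonneg v) (sq_nonneg _), ← ENNReal.ofReal_mul (by positivity),
      ← ENNReal.ofReal_toReal (measure_ne_top P {ω | X 0 ω - X 1 ω = v}),
      ← ENNReal.ofReal_mul (Finset.sum_nonneg fun i _ => sq_nonneg _)]
    refine ENNReal.ofReal_le_ofReal ?_
    change _ * diffProb P X v ≤ _
    rw [← Finset.mul_sum, mul_left_comm, mul_comm (diffProb P X v)]
    refine mul_le_mul_of_nonneg_right ?_ (diffProb_nonneg v)
    calc ∑ i, (v i : ℝ) ^ 2 ≤ ∑ _i : Fin d, K * ∑ k, replaceDet y k v ^ 2 :=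
          Finset.sum_le_sum fun i _ => hKle v i
      _ = _ := by simp [mul_assoc]
  rw [h1]
  refine (ENNReal.tsum_le_tsum h2).trans_lt ?_
  rw [ENNReal.tsum_mul_left, Summable.tsum_finsetSum fun _ _ => ENNReal.summable]
  exact ENNReal.mul_lt_top ENNReal.ofReal_lt_top
    (ENNReal.sum_lt_top.2 fun k _ => (hcon k).lt_top)

/-- The weak law of large numbers for a coordinate of the walk. -/
lemma IIDSteps.tendsto_measure_deviation (h : IIDSteps P X) (i : Fin d)
    (hint : Integrable (fun ω => (X 0 ω i : ℝ)) P) {η : ℝ} (hη : 0 < η) :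
    Tendsto (fun t : ℕ => P {ω | η ≤ |(walk X t ω i : ℝ) / t - ∫ ω, (X 0 ω i : ℝ) ∂P|})
      atTop (nhds 0) := by
  have hm : Measurable fun v : Fin d → ℤ => (v i : ℝ) := measurable_of_countable _
  have hslln := strong_law_ae_real (fun k ω => (X k ω i : ℝ)) hint
    (fun k l hkl => (h.indep.indepFun hkl).comp hm hm) (fun k => (h.ident k).comp hm)
  have hmeas : ∀ t : ℕ, AEStronglyMeasurable
      (fun ω => (∑ k ∈ Finset.range t, (X k ω i : ℝ)) / t) P := fun t =>
    ((Finset.measurable_sum _ fun k _ => hm.comp (h.measurable k)).div_const _).aestronglyMeasurable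
  have hmeasure := tendstoInMeasure_of_tendsto_ae hmeas hslln
  have := tendstoInMeasure_iff_norm.1 hmeasure η hη
  refine this.congr fun t => ?_
  congr 1
  ext ω
  simp [walk, Real.norm_eq_abs]

lemma decay_le_of_le {r t : ℕ} (hrt : t ≤ 2 * r + 1) : decay d r ≤ 2 ^ d * decay d t := by
  rw [decay, decay, ← mul_pow]
  gcongr
  rw [← div_eq_mul_inv, le_div_iff₀ (by positivity), inv_mul_le_iff₀ (by positivity)]
  have h4 : √((t : ℝ) + 1) ≤ √(2 ^ 2 * ((r : ℝ) + 1)) := by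
    refine Real.sqrt_le_sqrt ?_
    have : (t : ℝ) ≤ 2 * r + 1 := by exact_mod_cast hrt
    have := (Nat.cast_nonneg r : (0 : ℝ) ≤ r)
    linarith
  rw [Real.sqrt_mul (by norm_num), Real.sqrt_sq (by norm_num)] at h4
  linarith

/-- A walk with drift returns to the origin with smaller probability than `(t + 1)^(-d/2)`. -/
theorem IIDSteps.eventually_hitProb_zero_le_of_mean_ne_zero (h : IIDSteps P X)
    (hdim : GenuinelyDimensional P X) (i : Fin d)
    (hint : Integrable (fun ω => (X 0 ω i : ℝ)) P) (hmean : ∫ ω, (X 0 ω i : ℝ) ∂P ≠ 0) {δ : ℝ}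
    (hδ : 0 < δ) :
    ∀ᶠ t in atTop, hitProb P X t 0 ≤ ENNReal.ofReal (δ * decay d t) := by
  classical
  obtain ⟨C, hC, hle⟩ := h.exists_hitProb_le_decay hdim
  set m := ∫ ω, (X 0 ω i : ℝ) ∂P with hm
  -- The atypical positions at time `r`. Outside `B r` the coordinate `i` has the sign of the mean
  -- `m`, so `z` and `-z` cannot both be typical for the two halves of a loop.
  set B : ℕ → Set (Fin d → ℤ) := fun r => {z | |m| ≤ |(z i : ℝ) / r - m|} with hB
  set η : ℝ := δ / (2 * (C * 2 ^ d)) with hη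
  have hη0 : 0 < η := by positivity
  have hdev := h.tendsto_measure_deviation i hint (abs_pos.2 hmean)
  have hdev' : ∀ᶠ r in atTop, P {ω | walk X r ω ∈ B r} ≤ ENNReal.ofReal η :=
    (hdev.eventually_lt_const (ENNReal.ofReal_pos.2 hη0)).mono fun r hr => hr.le
  obtain ⟨N, hN⟩ := hdev'.exists_forall_of_atTop
  filter_upwards [eventually_ge_atTop (2 * N + 2)] with t ht
  set r := t / 2 with hr
  set r' := t - t / 2 with hr'
  have hrr : t = r + r' := by omega
  have hr0 : 0 < r := by omega
  have hr0' : 0 < r' := by omega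
  have hpos : ∀ {r : ℕ}, 0 < r → ∀ {z : Fin d → ℤ}, z ∉ B r → 0 < (z i : ℝ) * m := by
    intro r hr z hz
    have hr' : (0 : ℝ) < r := by exact_mod_cast hr
    simp only [hB, Set.mem_ofPred_eq, not_le] at hz
    have h1 : ((z i : ℝ) / r - m) ^ 2 < m ^ 2 := sq_lt_sq.2 hz
    have h2 : 0 < (z i : ℝ) / r * m := by nlinarith [sq_nonneg ((z i : ℝ) / r)]
    have h3 : (z i : ℝ) * m = (z i : ℝ) / r * m * r := by field_simp
    rw [h3]
    positivity
  -- The half that ends at an atypical point is kept, the other is bounded by the uniform decay;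
  -- summing over `z` leaves a deviation probability.
  have hterm : ∀ z, hitProb P X r z * hitProb P X r' (-z)
      ≤ (if z ∈ B r then hitProb P X r z else 0) * ENNReal.ofReal (C * decay d r')
        + (if -z ∈ B r' then hitProb P X r' (-z) else 0) * ENNReal.ofReal (C * decay d r) := by
    intro z
    by_cases hz : z ∈ B r
    · refine le_add_right ?_
      rw [if_pos hz]
      gcongr
      exact hle _ _
    · refine le_add_left ?_
      by_cases hz' : -z ∈ B r'
      · rw [if_pos hz', mul_comm]
        gcongr
        exact hle _ _
      · have h1 := hpos hr0 hz
        have h2 := hpos hr0' hz'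
        simp only [Pi.neg_apply, Int.cast_neg] at h2
        linarith
  have hneg : ∑' z, (if -z ∈ B r' then hitProb P X r' (-z) else 0)
      = P {ω | walk X r' ω ∈ B r'} := by
    rw [← h.tsum_ite_hitProb r' (B r')]
    exact (Equiv.neg (Fin d → ℤ)).tsum_eq fun z => if z ∈ B r' then hitProb P X r' z else 0
  have hsplit : hitProb P X t 0 ≤ ENNReal.ofReal η * ENNReal.ofReal (C * decay d r')
      + ENNReal.ofReal η * ENNReal.ofReal (C * decay d r) := by
    conv_lhs => rw [hrr]
    rw [← h.tsum_hitProb_mul_neg r r']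
    refine (ENNReal.tsum_le_tsum hterm).trans ?_
    rw [ENNReal.tsum_add, ENNReal.tsum_mul_right, ENNReal.tsum_mul_right,
      h.tsum_ite_hitProb r (B r), hneg]
    gcongr
    · exact hN r (by omega)
    · exact hN r' (by omega)
  refine hsplit.trans ?_
  have hd0 := (decay_pos d r).le
  have hd0' := (decay_pos d r').le
  rw [← ENNReal.ofReal_mul hη0.le, ← ENNReal.ofReal_mul hη0.le,
    ← ENNReal.ofReal_add (by positivity) (by positivity)]
  refine ENNReal.ofReal_le_ofReal ?_
  have e1 : decay d r ≤ 2 ^ d * decay d t := decay_le_of_le (by omega)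
  have e2 : decay d r' ≤ 2 ^ d * decay d t := decay_le_of_le (by omega)
  calc η * (C * decay d r') + η * (C * decay d r)
      ≤ η * (C * (2 ^ d * decay d t)) + η * (C * (2 ^ d * decay d t)) := by gcongr
    _ = δ * decay d t := by rw [hη]; field_simp; ring

/-- Unless the steps are centred with a finite second moment, the return probabilities are of
smaller order than `(t + 1)^(-d/2)`. -/
theorem IIDSteps.eventually_hitProb_zero_le (h : IIDSteps P X) (hdim : GenuinelyDimensional P X)
    (hnot : ¬ ((∫⁻ ω, ‖toEuclidean (X 0 ω)‖ₑ ^ 2 ∂P) < ∞ ∧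
      Integrable (fun ω => toEuclidean (X 0 ω)) P ∧ ∫ ω, toEuclidean (X 0 ω) ∂P = 0))
    {δ : ℝ} (hδ : 0 < δ) :
    ∀ᶠ t in atTop, hitProb P X t 0 ≤ ENNReal.ofReal (δ * decay d t) := by
  by_cases hfin : ∫⁻ ω, ‖toEuclidean (X 0 ω)‖ₑ ^ 2 ∂P < ∞
  · have hmeas : AEStronglyMeasurable (fun ω => toEuclidean (X 0 ω)) P :=
      ((measurable_of_countable toEuclidean).comp (h.measurable 0)).aestronglyMeasurable
    have hmem : MemLp (fun ω => toEuclidean (X 0 ω)) 2 P := by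
      refine ⟨hmeas, ?_⟩
      rw [eLpNorm_lt_top_iff_lintegral_rpow_enorm_lt_top (by norm_num) (by norm_num)]
      simpa using hfin
    have hint := hmem.integrable (by norm_num)
    have hmean : ∫ ω, toEuclidean (X 0 ω) ∂P ≠ 0 := fun h0 => hnot ⟨hfin, hint, h0⟩
    obtain ⟨i, hi⟩ : ∃ i, (∫ ω, toEuclidean (X 0 ω) ∂P) i ≠ 0 := by
      by_contra! hcon
      exact hmean (by ext i; simpa using hcon i)
    have hcomm := (EuclideanSpace.proj i : EuclideanSpace ℝ (Fin d) →L[ℝ] ℝ).integral_comp_comm hint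
    have hinti := (EuclideanSpace.proj i : EuclideanSpace ℝ (Fin d) →L[ℝ] ℝ).integrable_comp hint
    exact h.eventually_hitProb_zero_le_of_mean_ne_zero hdim i hinti
      (fun h0 => hi (hcomm.symm.trans h0)) hδ
  · obtain ⟨y, hy, hp⟩ := hdim.exists_rowMatrix
    obtain ⟨k, hk⟩ := h.exists_tsum_eq_top hy (by simpa using hfin)
    exact (h.eventually_hitProb_le_of_tsum_eq_top hy hp hk hδ).mono fun t ht => ht 0

end SelfIntersection

/-! ### Growth rates of the Green function and of the weighted returns -/

namespace SelfIntersection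

open Asymptotics Finset

lemma sum_inv_sqrt_le (n : ℕ) : ∑ w ∈ range n, (√((w : ℝ) + 1))⁻¹ ≤ 2 * √n := by
  induction n with
  | zero => simp
  | succ n ih =>
    rw [sum_range_succ]
    refine (add_le_add_left ih _).trans ?_
    push_cast
    have h0 : 0 < √((n : ℝ) + 1) := by positivity
    have h1 : √((n : ℝ) + 1) ^ 2 = n + 1 := Real.sq_sqrt (by positivity)
    have h2 : √(n : ℝ) ^ 2 = n := Real.sq_sqrt (by positivity)
    rw [← sub_nonneg]
    have : 2 * √((n : ℝ) + 1) - (2 * √(n : ℝ) + (√((n : ℝ) + 1))⁻¹)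
        = (√((n : ℝ) + 1) - √(n : ℝ)) ^ 2 * (√((n : ℝ) + 1))⁻¹ := by
      field_simp
      nlinarith
    rw [this]
    positivity

/-- Up to `T` the terms are `(w + 1)^(-1/2)` and beyond it `T (w + 1)^(-3/2)`; each part contributes
at most `2 √T`. -/
lemma sum_decay_three_mul_min_le {T : ℕ} (hT : 1 ≤ T) (n : ℕ) :
    ∑ w ∈ range n, decay 3 w * (min T (w + 1) : ℕ) ≤ 4 * √T := by
  have hT0 : (0 : ℝ) < T := by exact_mod_cast hT
  have hstart : ∀ n ≤ T, ∑ w ∈ range n, decay 3 w * (min T (w + 1) : ℕ) ≤ 2 * √n := by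
    intro n hn
    refine le_trans (le_of_eq (sum_congr rfl fun w hw => ?_)) (sum_inv_sqrt_le n)
    have : w + 1 ≤ T := by have := mem_range.1 hw; omega
    rw [min_eq_right this, decay]
    push_cast
    have h1 : √((w : ℝ) + 1) ^ 2 = w + 1 := Real.sq_sqrt (by positivity)
    have h0 : 0 < √((w : ℝ) + 1) := by positivity
    rw [← h1]
    field_simp
    simp [h1]
  -- The subtracted tail makes the induction telescope.
  have hrest : ∀ k : ℕ, ∑ w ∈ range (T + k), decay 3 w * (min T (w + 1) : ℕ)
      ≤ 4 * √T - 2 * T * (√((T : ℝ) + k))⁻¹ := by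
    intro k
    induction k with
    | zero =>
      have h1 : √(T : ℝ) ^ 2 = T := Real.sq_sqrt hT0.le
      have h0 : 0 < √(T : ℝ) := by positivity
      refine (hstart T le_rfl).trans (le_of_eq ?_)
      simp only [Nat.cast_zero, add_zero]
      field_simp
      linarith
    | succ k ih =>
      rw [← add_assoc, sum_range_succ, min_eq_left (by omega)]
      refine (add_le_add_left ih _).trans ?_
      rw [decay]
      push_cast
      rw [← add_assoc]
      have hx : (0 : ℝ) < T + k := by positivity
      set s := √((T : ℝ) + k) with hs
      set u := √((T : ℝ) + k + 1) with hu
      have h0 : 0 < s := by positivity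
      have h1 : 0 < u := by positivity
      have h2 : u ^ 2 = s ^ 2 + 1 := by
        rw [hu, hs, Real.sq_sqrt (by positivity), Real.sq_sqrt hx.le]
      have h3 : s ≤ u := Real.sqrt_le_sqrt (by linarith)
      have h4 : u⁻¹ ^ 3 ≤ 2 * (s⁻¹ - u⁻¹) := by
        rw [inv_pow, inv_sub_inv h0.ne' h1.ne', inv_eq_one_div, mul_div_assoc',
          div_le_div_iff₀ (by positivity) (by positivity)]
        have h5 : (u - s) * (u + s) = 1 := by nlinarith
        have h6 : 1 ≤ 2 * (u - s) * u := by nlinarith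
        nlinarith [mul_pos h0 h1, mul_le_mul_of_nonneg_left h6 (sq_nonneg u), mul_le_mul_of_nonneg_right h3 h1.le]
      nlinarith [mul_le_mul_of_nonneg_left h4 hT0.le]
  refine le_trans ?_ ((hrest n).trans (sub_le_self _ (by positivity)))
  exact sum_le_sum_of_subset_of_nonneg (range_mono (by omega))
    fun w _ _ => mul_nonneg (decay_pos 3 w).le (Nat.cast_nonneg _)

/-- The number of returns weighted as in `returnWeight`, for return probabilities
`e t * decay d t`. -/
noncomputable def weightedReturns (d : ℕ) (e : ℕ → ℝ) (n : ℕ) : ℝ :=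
  ∑ w ∈ range (n + 1), decay d w * ∑ t ∈ range (2 * n + 1),
    (min (t + 1) (w + 1) : ℕ) * (e t * decay d t)

lemma decay_one (t : ℕ) : decay 1 t = (√((t : ℝ) + 1))⁻¹ := pow_one _

lemma decay_two (t : ℕ) : decay 2 t = ((t : ℝ) + 1)⁻¹ := by
  rw [decay, inv_pow, Real.sq_sqrt (by positivity)]

lemma decay_two_eq (t : ℕ) : decay 2 t = decay 1 t * decay 1 t := by
  simp [decay, sq]

lemma decay_three (t : ℕ) : decay 3 t = decay 2 t * decay 1 t := by
  simp [decay, pow_succ]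

/-- The minimum is at most the geometric mean. -/
lemma decay_one_mul_min_le (t w : ℕ) :
    decay 1 w * ((min (t + 1) (w + 1) : ℕ) * decay 1 t) ≤ 1 := by
  rw [decay_one, decay_one]
  have h1 : 0 < √((t : ℝ) + 1) := by positivity
  have h2 : 0 < √((w : ℝ) + 1) := by positivity
  have h3 : ((min (t + 1) (w + 1) : ℕ) : ℝ) ≤ √((t : ℝ) + 1) * √((w : ℝ) + 1) := by
    rw [← Real.sqrt_mul (by positivity)]
    refine Real.le_sqrt_of_sq_le ?_
    have ha : ((min (t + 1) (w + 1) : ℕ) : ℝ) ≤ (t : ℝ) + 1 := by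
      exact_mod_cast min_le_left _ _
    have hb : ((min (t + 1) (w + 1) : ℕ) : ℝ) ≤ (w : ℝ) + 1 := by
      exact_mod_cast min_le_right _ _
    rw [sq]
    gcongr
  rw [inv_mul_le_iff₀ h2, mul_inv_le_iff₀ h1]
  linarith

/-- Weights that tend to zero make partial sums of a divergent series negligible. -/
lemma isLittleO_sum_mul {e D : ℕ → ℝ} (he : Tendsto e atTop (nhds 0)) (hD : 0 ≤ D)
    (hdiv : Tendsto (fun n => ∑ t ∈ range n, D t) atTop atTop) :
    (fun n : ℕ => ∑ t ∈ range (2 * n + 1), e t * D t)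
      =o[atTop] fun n => ∑ t ∈ range (2 * n + 1), D t := by
  have h1 : (fun t => e t * D t) =o[atTop] D := by
    simpa using ((isLittleO_one_iff ℝ).2 he).mul_isBigO (isBigO_refl D atTop)
  exact (h1.sum_range hD hdiv).comp_tendsto
    (tendsto_atTop_mono (fun n => by simp only [id]; omega) tendsto_id)

lemma tendsto_sum_decay_two : Tendsto (fun n => ∑ t ∈ range n, decay 2 t) atTop atTop := by
  simpa only [decay_two, one_div] using Real.tendsto_sum_range_one_div_nat_succ_atTop

lemma decay_two_le_decay_one (t : ℕ) : decay 2 t ≤ decay 1 t := by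
  rw [decay_two_eq]
  refine mul_le_of_le_one_left (decay_pos 1 t).le ?_
  rw [decay_one]
  refine inv_le_one_of_one_le₀ (Real.one_le_sqrt.2 ?_)
  have := (Nat.cast_nonneg t : (0 : ℝ) ≤ t)
  linarith

lemma tendsto_sum_decay_one : Tendsto (fun n => ∑ t ∈ range n, decay 1 t) atTop atTop :=
  tendsto_atTop_mono (fun _ => sum_le_sum fun t _ => decay_two_le_decay_one t)
    tendsto_sum_decay_two

lemma sum_decay_two_le (n : ℕ) : ∑ t ∈ range n, decay 2 t ≤ 1 + Real.log n := by
  refine le_trans (le_of_eq ?_) (harmonic_le_one_add_log n)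
  rw [harmonic]
  push_cast
  exact sum_congr rfl fun t _ => decay_two t

/-- An affine function of the time does not change the order of `√n`. -/
lemma isBigO_sum_decay_one {φ : ℕ → ℕ} (hφ : ∀ n, φ n ≤ 3 * n + 1) :
    (fun n => ∑ t ∈ range (φ n), decay 1 t) =O[atTop] fun n : ℕ => √(n : ℝ) := by
  refine IsBigO.of_bound (2 * √4) ((eventually_ge_atTop 1).mono fun n hn => ?_)
  rw [Real.norm_of_nonneg (sum_nonneg fun t _ => (decay_pos 1 t).le),
    Real.norm_of_nonneg (by positivity)]
  simp only [decay_one]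
  refine (sum_inv_sqrt_le _).trans ?_
  rw [mul_assoc, ← Real.sqrt_mul (by norm_num)]
  gcongr
  have h1 := hφ n
  exact_mod_cast (by omega : φ n ≤ 4 * n)

lemma isBigO_sum_decay_two {φ : ℕ → ℕ} (hφ : ∀ n, φ n ≤ 3 * n + 1) :
    (fun n => ∑ t ∈ range (φ n), decay 2 t) =O[atTop] fun n : ℕ => Real.log n := by
  refine IsBigO.of_bound 4 ((eventually_ge_atTop 4).mono fun n hn => ?_)
  have hn' : (4 : ℝ) ≤ n := by exact_mod_cast hn
  have hlog : 1 ≤ Real.log n := by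
    rw [Real.le_log_iff_exp_le (by linarith)]
    linarith [Real.exp_one_lt_d9]
  rw [Real.norm_of_nonneg (sum_nonneg fun t _ => (decay_pos 2 t).le),
    Real.norm_of_nonneg (by linarith)]
  calc ∑ t ∈ range (φ n), decay 2 t ≤ ∑ t ∈ range (4 * n), decay 2 t :=
        sum_le_sum_of_subset_of_nonneg (range_mono (by have := hφ n; omega))
          fun t _ _ => (decay_pos 2 t).le
    _ ≤ 1 + Real.log (4 * n : ℕ) := sum_decay_two_le _
    _ ≤ 1 + (Real.log n + Real.log n) := by
        push_cast
        rw [Real.log_mul (by norm_num) (by linarith)]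
        gcongr
    _ ≤ 4 * Real.log n := by linarith

lemma weightedReturns_nonneg (d : ℕ) {e : ℕ → ℝ} (he : 0 ≤ e) (n : ℕ) :
    0 ≤ weightedReturns d e n :=
  sum_nonneg fun w _ => mul_nonneg (decay_pos d w).le
    (sum_nonneg fun t _ => mul_nonneg (Nat.cast_nonneg _) (mul_nonneg (he t) (decay_pos d t).le))

/-- By `decay_one_mul_min_le` every term is at most `e t`, which leaves about `n` times a sum of the
null sequence `e`. -/
lemma isLittleO_weightedReturns_one {e : ℕ → ℝ} (he : 0 ≤ e) (he0 : Tendsto e atTop (nhds 0)) :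
    weightedReturns 1 e =o[atTop] fun n : ℕ => (n : ℝ) ^ 2 := by
  have hlin : ∀ φ : ℕ → ℕ, (∀ n, φ n ≤ 3 * n + 1) →
      (fun n => (φ n : ℝ)) =O[atTop] fun n : ℕ => (n : ℝ) := by
    intro φ hφ
    refine IsBigO.of_bound 4 ((eventually_ge_atTop 1).mono fun n hn => ?_)
    rw [Real.norm_natCast, Real.norm_natCast]
    have := hφ n
    exact_mod_cast (by omega : φ n ≤ 4 * n)
  have h1 := isLittleO_sum_mul (D := fun _ => 1) he0 (fun _ => zero_le_one)
    (by simpa using tendsto_natCast_atTop_atTop)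
  have h2 := (hlin (fun n => n + 1) fun n => by omega).mul_isLittleO
    (h1.trans_isBigO (by simpa using hlin (fun n => 2 * n + 1) fun n => by omega))
  simp only [← sq] at h2
  refine (IsBigO.of_bound 1 (Eventually.of_forall fun n => ?_)).trans_isLittleO h2
  rw [one_mul, Real.norm_of_nonneg (weightedReturns_nonneg 1 he n),
    Real.norm_of_nonneg (mul_nonneg (Nat.cast_nonneg _) (sum_nonneg fun t _ => by simpa using he t))]
  calc weightedReturns 1 e n ≤ ∑ w ∈ range (n + 1), ∑ t ∈ range (2 * n + 1), e t * 1 := by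
        refine sum_le_sum fun w _ => ?_
        rw [mul_sum]
        refine sum_le_sum fun t _ => ?_
        calc _ = e t * (decay 1 w * ((min (t + 1) (w + 1) : ℕ) * decay 1 t)) := by ring
          _ ≤ e t * 1 := mul_le_mul_of_nonneg_left (decay_one_mul_min_le t w) (he t)
    _ = _ := by simp

/-- One factor `decay 1` at each of `w` and `t` absorbs the minimum; the remaining double sum splits
into `O(√n)` times `o(√n)`. -/
lemma isLittleO_weightedReturns_two {e : ℕ → ℝ} (he : 0 ≤ e) (he0 : Tendsto e atTop (nhds 0)) :
    weightedReturns 2 e =o[atTop] fun n : ℕ => (n : ℝ) := by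
  have h1 := isLittleO_sum_mul he0 (fun t => (decay_pos 1 t).le) tendsto_sum_decay_one
  have h2 := (isBigO_sum_decay_one (φ := fun n => n + 1) fun n => by omega).mul_isLittleO
    (h1.trans_isBigO (isBigO_sum_decay_one (φ := fun n => 2 * n + 1) fun n => by omega))
  have h3 : (fun n : ℕ => √(n : ℝ) * √(n : ℝ)) = fun n : ℕ => (n : ℝ) :=
    funext fun n => Real.mul_self_sqrt (Nat.cast_nonneg n)
  rw [h3] at h2
  refine (IsBigO.of_bound 1 (Eventually.of_forall fun n => ?_)).trans_isLittleO h2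
  rw [one_mul, Real.norm_of_nonneg (weightedReturns_nonneg 2 he n),
    Real.norm_of_nonneg (mul_nonneg (sum_nonneg fun t _ => (decay_pos 1 t).le)
      (sum_nonneg fun t _ => mul_nonneg (he t) (decay_pos 1 t).le)), sum_mul]
  refine sum_le_sum fun w _ => ?_
  rw [mul_sum, mul_sum]
  refine sum_le_sum fun t _ => ?_
  rw [decay_two_eq, decay_two_eq]
  calc _ = decay 1 w * (e t * decay 1 t)
        * (decay 1 w * ((min (t + 1) (w + 1) : ℕ) * decay 1 t)) := by ring
    _ ≤ decay 1 w * (e t * decay 1 t) * 1 := mul_le_mul_of_nonneg_left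
        (decay_one_mul_min_le t w)
        (mul_nonneg (decay_pos 1 w).le (mul_nonneg (he t) (decay_pos 1 t).le))
    _ = _ := mul_one _

/-- The geometric mean would leave a squared logarithm. Summing over `w` first gives at most `4 √(t
+ 1)`, and a single harmonic sum with null weights remains. -/
lemma isLittleO_weightedReturns_three {e : ℕ → ℝ} (he : 0 ≤ e)
    (he0 : Tendsto e atTop (nhds 0)) :
    weightedReturns 3 e =o[atTop] fun n : ℕ => Real.log n := by
  have h1 := isLittleO_sum_mul he0 (fun t => (decay_pos 2 t).le) tendsto_sum_decay_two
  have h2 := h1.trans_isBigO (isBigO_sum_decay_two (φ := fun n => 2 * n + 1) fun n => by omega)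
  refine (IsBigO.of_bound 4 (Eventually.of_forall fun n => ?_)).trans_isLittleO h2
  rw [Real.norm_of_nonneg (weightedReturns_nonneg 3 he n),
    Real.norm_of_nonneg (sum_nonneg fun t _ => mul_nonneg (he t) (decay_pos 2 t).le)]
  simp only [weightedReturns, mul_sum]
  rw [sum_comm]
  refine sum_le_sum fun t _ => ?_
  have h4 := sum_decay_three_mul_min_le (T := t + 1) (by omega) (n + 1)
  push_cast at h4
  calc _ = e t * decay 3 t * ∑ w ∈ range (n + 1), decay 3 w * (min (t + 1) (w + 1) : ℕ) := by
        rw [mul_sum]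
        exact sum_congr rfl fun w _ => by ring
    _ ≤ e t * decay 3 t * (4 * √((t : ℝ) + 1)) := by
        refine mul_le_mul_of_nonneg_left ?_ (mul_nonneg (he t) (decay_pos 3 t).le)
        push_cast
        exact h4
    _ = 4 * (e t * decay 2 t) := by
        rw [decay_three, decay_one]
        have : 0 < √((t : ℝ) + 1) := by positivity
        field_simp

end SelfIntersection

/-! ### The variance is of smaller order -/

namespace SelfIntersection

open Asymptotics Finset

variable {Ω : Type*} [MeasurableSpace Ω] {d : ℕ} {P : Measure Ω} {X : ℕ → Ω → (Fin d → ℤ)}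

/-- The rates of the Green function and of the weighted number of returns in dimension `d`, which
together give the order of the variance. -/
lemma exists_rates (hd : d = 1 ∨ d = 2 ∨ d = 3) {α : ℕ} (hα : 2 ≤ α) :
    ∃ g ρ : ℕ → ℝ, (fun n => ∑ t ∈ range (n + 1), decay d t) =O[atTop] g ∧
      (fun n => g n ^ 3) =o[atTop] ρ ∧
      (∀ e : ℕ → ℝ, 0 ≤ e → Tendsto e atTop (nhds 0) → weightedReturns d e =o[atTop] ρ) ∧
      ∀ n : ℕ, order d α n = n * (g n ^ (2 * α - 4) * ρ n) := by
  -- With `α = 2 + β` the truncated exponent `2 * α - 4` and the integer exponent in `order` are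
  -- both `2 * β`.
  obtain ⟨β, rfl⟩ := Nat.exists_eq_add_of_le hα
  have hexp : 2 * (2 + β) - 4 = 2 * β := by omega
  have hlog : Tendsto (fun n : ℕ => Real.log n) atTop atTop :=
    Real.tendsto_log_atTop.comp tendsto_natCast_atTop_atTop
  rcases hd with rfl | rfl | rfl
  · refine ⟨fun n => √n, fun n => (n : ℝ) ^ 2, isBigO_sum_decay_one fun n => by omega, ?_,
      fun e => isLittleO_weightedReturns_one, fun n => ?_⟩
    · have hsqrt : Tendsto (fun n : ℕ => √(n : ℝ)) atTop atTop :=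
        Real.tendsto_sqrt_atTop.comp tendsto_natCast_atTop_atTop
      have h := (isLittleO_pow_pow_atTop_of_lt (𝕜 := ℝ) (show 3 < 4 by norm_num)).comp_tendsto hsqrt
      refine h.congr_right fun n => ?_
      simp only [Function.comp]
      rw [show 4 = 2 * 2 from rfl, pow_mul, Real.sq_sqrt (Nat.cast_nonneg n)]
    · rw [hexp, pow_mul, Real.sq_sqrt (Nat.cast_nonneg n), order]
      ring
  · refine ⟨fun n => Real.log n, fun n => (n : ℝ), isBigO_sum_decay_two fun n => by omega, ?_,
      fun e => isLittleO_weightedReturns_two, fun n => ?_⟩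
    · exact (Real.isLittleO_pow_log_id_atTop (n := 3)).comp_tendsto tendsto_natCast_atTop_atTop
    · have : 2 * ((2 + β : ℕ) : ℤ) - 4 = ((2 * β : ℕ) : ℤ) := by push_cast; ring
      rw [hexp, order, this, zpow_natCast]
      ring
  · refine ⟨fun _ => 1, fun n => Real.log n, ?_, ?_, fun e => isLittleO_weightedReturns_three,
      fun n => ?_⟩
    · refine IsBigO.of_bound 4 (Eventually.of_forall fun n => ?_)
      rw [Real.norm_of_nonneg (sum_nonneg fun t _ => (decay_pos 3 t).le)]
      have h := sum_decay_three_mul_min_le le_rfl (n + 1)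
      simpa using h
    · simpa using (isLittleO_const_left.2 (Or.inr (tendsto_norm_atTop_atTop.comp hlog)) :
        (fun _ : ℕ => (1 : ℝ)) =o[atTop] fun n : ℕ => Real.log n)
    · simp [order]

lemma returnWeight_eq_ofReal {C : ℝ} (hC : 0 ≤ C) {e : ℕ → ℝ} (he : 0 ≤ e)
    (hret : ∀ t, hitProb P X t 0 = ENNReal.ofReal (e t * decay d t)) (n : ℕ) :
    returnWeight P X (fun t => ENNReal.ofReal (C * decay d t)) n
      = ENNReal.ofReal (C * weightedReturns d e n) := by
  have hr : ∀ t, 0 ≤ e t * decay d t := fun t => mul_nonneg (he t) (decay_pos d t).le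
  have hin : ∀ w t : ℕ, 0 ≤ ((min (t + 1) (w + 1) : ℕ) : ℝ) * (e t * decay d t) :=
    fun w t => mul_nonneg (Nat.cast_nonneg _) (hr t)
  rw [returnWeight, weightedReturns, mul_sum, ENNReal.ofReal_sum_of_nonneg fun w _ =>
    mul_nonneg hC (mul_nonneg (decay_pos d w).le (sum_nonneg fun t _ => hin w t))]
  refine sum_congr rfl fun w _ => ?_
  rw [← mul_assoc, ENNReal.ofReal_mul (mul_nonneg hC (decay_pos d w).le),
    ENNReal.ofReal_sum_of_nonneg fun t _ => hin w t]
  congr 1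
  refine sum_congr rfl fun t _ => ?_
  rw [hret, ENNReal.ofReal_mul (Nat.cast_nonneg _), ENNReal.ofReal_natCast]

variable [IsProbabilityMeasure P]

/-- Unless the steps are centred with a finite second moment, the variance of the
self-intersection local time is of smaller order than for the simple random walk. -/
theorem IIDSteps.isLittleO_variance (h : IIDSteps P X) (hd : d = 1 ∨ d = 2 ∨ d = 3)
    (hdim : GenuinelyDimensional P X) {α : ℕ} (hα : 2 ≤ α)
    (hnot : ¬ ((∫⁻ ω, ‖toEuclidean (X 0 ω)‖ₑ ^ 2 ∂P) < ∞ ∧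
      Integrable (fun ω => toEuclidean (X 0 ω)) P ∧ ∫ ω, toEuclidean (X 0 ω) ∂P = 0)) :
    (fun n => variance (selfIntersection X α n) P) =o[atTop] order d α := by
  obtain ⟨C, hC, hle⟩ := h.exists_hitProb_le_decay hdim
  obtain ⟨g, ρ, hg, hgρ, hρ, horder⟩ := exists_rates hd hα
  obtain ⟨K, hK⟩ := h.variance_le hle hα
  -- The ratio of the return probability to its maximal order; its convergence to 0 is the only
  -- place where `hnot` enters.
  set e : ℕ → ℝ := fun t => (hitProb P X t 0).toReal / decay d t with he_def
  have he : 0 ≤ e := fun t => div_nonneg ENNReal.toReal_nonneg (decay_pos d t).le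
  have hret : ∀ t, hitProb P X t 0 = ENNReal.ofReal (e t * decay d t) := by
    intro t
    rw [he_def]
    simp only
    rw [div_mul_cancel₀ _ (decay_pos d t).ne']
    exact (ENNReal.ofReal_toReal (measure_ne_top P _)).symm
  have he0 : Tendsto e atTop (nhds 0) := by
    refine Metric.tendsto_nhds.2 fun δ hδ => ?_
    filter_upwards [h.eventually_hitProb_zero_le hdim hnot (half_pos hδ)] with t ht
    rw [Real.dist_0_eq_abs, abs_of_nonneg (he t), he_def]
    refine lt_of_le_of_lt ?_ (half_lt_self hδ)
    rw [div_le_iff₀ (decay_pos d t)]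
    exact ENNReal.toReal_le_of_le_ofReal (mul_nonneg (half_pos hδ).le (decay_pos d t).le) ht
  set G : ℕ → ℝ := fun n => C * ∑ t ∈ range (n + 1), decay d t with hG_def
  have hG0 : ∀ n, 0 ≤ G n := fun n =>
    mul_nonneg hC.le (sum_nonneg fun t _ => (decay_pos d t).le)
  have hGO : G =O[atTop] g := hg.const_mul_left C
  set R : ℕ → ℝ := fun n => C * weightedReturns d e n with hR_def
  have hR0 : ∀ n, 0 ≤ R n := fun n => mul_nonneg hC.le (weightedReturns_nonneg d he n)
  have hRo : R =o[atTop] ρ := (hρ e he he0).const_mul_left C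
  have hbound : ∀ n, variance (selfIntersection X α n) P
      ≤ K * (n * (G n ^ (2 * α - 4) * (G n ^ 3 + R n))) := by
    intro n
    have h1 : ∑ t ∈ range (n + 1), ENNReal.ofReal (C * decay d t) = ENNReal.ofReal (G n) := by
      rw [hG_def]
      simp only
      rw [mul_sum, ENNReal.ofReal_sum_of_nonneg fun t _ => mul_nonneg hC.le (decay_pos d t).le]
    have h2 := hK n
    rw [h1, returnWeight_eq_ofReal hC.le he hret, show 2 * α - 1 = 2 * α - 4 + 3 by omega, pow_add,
      ← mul_add, ← ENNReal.ofReal_pow (hG0 n), ← ENNReal.ofReal_pow (hG0 n),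
      ← ENNReal.ofReal_add (pow_nonneg (hG0 n) _) (hR0 n),
      ← ENNReal.ofReal_mul (pow_nonneg (hG0 n) _), ← ENNReal.ofReal_natCast n,
      ← ENNReal.ofReal_mul (Nat.cast_nonneg n), ← ENNReal.ofReal_natCast K,
      ← ENNReal.ofReal_mul (Nat.cast_nonneg K)] at h2
    refine (ENNReal.ofReal_le_ofReal_iff ?_).1 h2
    have := hG0 n
    have := hR0 n
    positivity
  -- Both summands are `o(ρ)`: the cube of the Green function by `hgρ`, the weighted returns because
  -- `e` tends to 0.
  have hsmall : (fun n : ℕ => (K : ℝ) * (n * (G n ^ (2 * α - 4) * (G n ^ 3 + R n))))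
      =o[atTop] fun n : ℕ => (n : ℝ) * (g n ^ (2 * α - 4) * ρ n) :=
    ((isBigO_refl _ _).mul_isLittleO ((hGO.pow _).mul_isLittleO
      (((hGO.pow 3).trans_isLittleO hgρ).add hRo))).const_mul_left _
  refine (IsBigO.of_bound 1 (Eventually.of_forall fun n => ?_)).trans_isLittleO
    (hsmall.congr_right fun n => (horder n).symm)
  rw [one_mul, Real.norm_of_nonneg (variance_nonneg _ _)]
  exact (hbound n).trans (le_abs_self _)

/-- The one-fold self-intersection local time is the number of steps, which is constant. -/
lemma variance_selfIntersection_one (n : ℕ) :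
    variance (selfIntersection X 1 n) P = 0 := by
  classical
  have h : selfIntersection X 1 n = fun _ => ((timeTuples (Fin 1) n).card : ℝ) := by
    funext ω
    rw [selfIntersection_eq_sum le_rfl, card_eq_sum_ones, Nat.cast_sum]
    refine sum_congr rfl fun t _ => ?_
    rw [Set.indicator_of_mem, Nat.cast_one]
    intro r r'
    rw [Subsingleton.elim r r']
  rw [h, variance_eq_integral aemeasurable_const]
  simp

end SelfIntersection

theorem theorem2 {Ω : Type*} [MeasurableSpace Ω] (P : Measure Ω) [IsProbabilityMeasure P]
    (d : ℕ) (hd : d = 1 ∨ d = 2 ∨ d = 3) (α : ℕ) (hα : 1 ≤ α)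
    (X : ℕ → Ω → (Fin d → ℤ)) (hmeas : ∀ i, Measurable (X i))
    (hindep : iIndepFun X P) (hident : ∀ i, IdentDistrib (X i) (X 0) P P)
    (hdim : SelfIntersection.GenuinelyDimensional P X)
    (hliminf : (0 : EReal) < liminf (fun n : ℕ =>
      ((variance (SelfIntersection.selfIntersection X α n) P
        / SelfIntersection.order d α n : ℝ) : EReal)) atTop) :
    (∫⁻ ω, ‖SelfIntersection.toEuclidean (X 0 ω)‖ₑ ^ 2 ∂P) < ∞ ∧
      Integrable (fun ω => SelfIntersection.toEuclidean (X 0 ω)) P ∧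
      ∫ ω, SelfIntersection.toEuclidean (X 0 ω) ∂P = 0 := by
  by_contra hnot
  have hlim : Tendsto (fun n : ℕ => variance (SelfIntersection.selfIntersection X α n) P
      / SelfIntersection.order d α n) atTop (nhds 0) := by
    rcases hα.eq_or_lt with rfl | hα2
    -- For `α = 1` the ratio is identically 0, so the hypothesis on the liminf fails outright.
    · simp [SelfIntersection.variance_selfIntersection_one]
    · have h : SelfIntersection.IIDSteps P X := ⟨hmeas, hindep, hident⟩
      exact (h.isLittleO_variance hd hdim hα2 hnot).tendsto_div_nhds_zero
  have hcoe := (continuous_coe_real_ereal.tendsto 0).comp hlim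
  have hzero := hcoe.liminf_eq
  simp only [Function.comp_def, EReal.coe_zero] at hzero
  exact hliminf.ne' hzero
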